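/- Work over $\mathbb{C}$. Let $\mathbb{A}_\Pi$ be the affine $19$-space with coordinates $p_1,p_2,p_3,p_4,u_1,u_2,s_1,s_2,s_3,t_1,t_2,t_{123},t_{124},t_{125},t_{126},t_{135},t_{136},t_{245},t_{246}$, and let $\Pi=\Pi^{15}_{\mathbb{A}}\subset\mathbb{A}_\Pi$ be the affine scheme $F_1=\cdots=F_9=0$, where, with $$U_1=p_1^2+t_1p_2^2+p_2u_1,\quad U_2=2p_1p_3+2t_1p_2p_4+p_4u_1+p_2u_2,\quad U_3=p_3^2+t_1p_4^2+p_4u_2,$$ $$I_1=t_2p_2^2+p_1u_1,\quad I_2=2t_2p_2p_4+p_3u_1+p_1u_2,\quad I_3=t_2p_4^2+p_3u_2,$$ $$A_1=t_1p_2u_1-t_2p_1p_2+u_1^2,\quad A_2=t_1(p_4u_1+p_2u_2)-t_2(p_2p_3+p_1p_4)+2u_1u_2,\quad A_3=t_1p_4u_2-t_2p_3p_4+u_2^2,$$ $$a=t_{123}t_{136}-t_{124}t_{135},\quad b=t_{123}t_{245}-t_{124}t_{136},\quad c=t_{123}t_{246}-t_{124}t_{245},$$ $$a'=t_{126}t_{135}-t_{125}t_{136},\quad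 b'=t_{126}t_{136}-t_{125}t_{245},\quad c'=t_{126}t_{245}-t_{125}t_{246},$$ $$\alpha=t_{136}^2-t_{135}t_{245},\quad \beta=t_{135}t_{246}-t_{136}t_{245},\quad \gamma=t_{245}^2-t_{136}t_{246},$$ one puts $$\begin{aligned} F_1&=u_1s_1-p_1s_2-p_2s_3+t_{126}(p_2p_3-p_1p_4)-t_{136}U_1-t_{245}U_2-t_{246}U_3,\\ F_2&=u_2s_1-p_3s_2-p_4s_3-t_{125}(p_2p_3-p_1p_4)+t_{135}U_1+t_{136}U_2+t_{245}U_3,\\ F_3&=-t_2p_2s_1+(t_1p_2+u_1)s_2-p_1s_3+t_{124}(p_2p_3-p_1p_4)-t_{136}I_1-t_{245}I_2-t_{246}I_3,\\ F_4&=-t_2p_4s_1+(t_1p_4+u_2)s_2-p_3s_3-t_{123}(p_2p_3-p_1p_4)+t_{135}I_1+t_{136}I_2+t_{245}I_3,\\ F_5&=-t_2p_1s_1+(t_1p_1-t_2p_2)s_2+(t_1p_2+u_1)s_3+t_{123}U_1+t_{124}(t_1p_2p_4+p_1p_3+p_2u_2)\\ &\quad-t_{125}I_1-t_{126}(t_2p_2p_4+p_1u_2)-t_{136}A_1-t_{245}A_2-t_{246}A_3,\\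 F_6&=-t_2p_3s_1+(t_1p_3-t_2p_4)s_2+(t_1p_4+u_2)s_3+t_{123}(t_1p_2p_4+p_1p_3+p_4u_1)+t_{124}U_3\\ &\quad-t_{125}(t_2p_2p_4+p_3u_1)-t_{126}I_3+t_{135}A_1+t_{136}A_2+t_{245}A_3,\\ F_7&=-s_2^2+s_1s_3+(t_{123}p_2+t_{124}p_4)s_1-(t_{125}p_2+t_{126}p_4)s_2+\alpha(p_1^2-2p_2u_1-t_1p_2^2)+\gamma(p_3^2-2p_4u_2-t_1p_4^2)\\ &\quad+\beta(p_2u_2+p_4u_1-p_1p_3+t_1p_2p_4)+ap_2^2+2bp_2p_4+cp_4^2+a'p_1p_2+b'(p_1p_4+p_2p_3)+c'p_3p_4,\\ F_8&=s_2s_3+t_1s_1s_2-t_2s_1^2+(t_{123}p_1+t_{124}p_3)s_1-(t_{125}p_1+t_{126}p_3)s_2\\ &\quad+\alpha(-2p_1u_1-2t_1p_1p_2+t_2p_2^2)+\gamma(-2p_3u_2-2t_1p_3p_4+t_2p_4^2)\\ &\quad+\beta\big(p_1u_2+p_3u_1+t_1(p_1p_4+p_2p_3)-t_2p_2p_4\big)+a'p_1^2+2b'p_1p_3+c'p_3^2\\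 &\quad+ap_1p_2+b(p_1p_4+p_2p_3)+cp_3p_4,\\ F_9&=s_3^2+t_1s_2^2-t_2s_1s_2+(t_{123}u_1+t_{124}u_2)s_1-(t_{125}u_1+t_{126}u_2)s_2-\alpha(2t_2p_1p_2+u_1^2)\\ &\quad+\beta\big(t_2(p_2p_3+p_1p_4)+u_1u_2\big)-\gamma(2t_2p_3p_4+u_2^2)-t_1(ap_2^2+2bp_2p_4+cp_4^2)\\ &\quad-t_2(a'p_2^2+2b'p_2p_4+c'p_4^2)-(ap_1^2+2bp_1p_3+cp_3^2)+(t_{124}t_{125}-t_{123}t_{126})(p_1p_4-p_2p_3). \end{aligned}$$ Let $\mathbb{A}_T\subset\Pi$ be the affine $10$-space $\{p_1=\cdots=p_4=u_1=u_2=s_1=s_2=s_3=0\}$. Let $c(\mathrm{G}(2,5))$ be the affine cone over the Grassmannian $\mathrm{G}(2,5)$ in its Plücker embedding, i.e. the subscheme of the affine $10$-space with coordinates $m_{ij}$ $(1\le i<j\le5)$ defined by the five $4\times4$ Pfaffians of the skew-symmetric $5\times5$ matrix $(m_{ij})$; its vertex is the origin. Then the open subset $\Pi\setminus\mathbb{A}_T$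 of $\Pi$ is irreducible of dimension $15$. Its singular locus (the set of points whose local ring is not regular) is a locally closed subset $\Delta$ of dimension $8$, and $\Delta\cap\{p_2p_4\ne0\}$ is the set of points of $\Pi$ with $p_2p_4\neq 0$ that satisfy $$\begin{aligned} &p_1=\tfrac{p_2p_3}{p_4},\quad u_1=\tfrac{p_2u_2}{p_4},\quad u_2=-\tfrac{p_3^2+t_1p_4^2}{p_4},\quad t_2=-\tfrac{p_3u_2}{p_4^2},\\ &s_1=-\tfrac{t_{136}p_2^2+2t_{245}p_2p_4+t_{246}p_4^2}{p_2},\quad s_2=\tfrac{p_3}{p_4}s_1,\quad s_3=-\tfrac{2p_3^2+t_1p_4^2}{p_4^2}s_1,\\ &t_{123}=-\tfrac{t_{126}p_2p_3p_4^2+t_{136}(3p_3^2+2t_1p_4^2)p_2^2+3t_{245}(p_3^2+t_1p_4^2)p_2p_4+t_{246}t_1p_4^4}{p_2^2p_4^2},\\ &t_{124}=\tfrac{t_{126}p_2p_3p_4-t_{245}(3p_3^2+t_1p_4^2)p_2-t_{246}(3p_3^2+t_1p_4^2)p_4}{p_2p_4^2},\\ &t_{125}=\tfrac{-t_{126}p_2p_4^2+3t_{136}p_2^2p_3+6t_{245}p_2p_3p_4+3t_{246}p_3p_4^2}{p_2^2p_4},\\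 &t_{135}=-\tfrac{p_4(3t_{136}p_2^2+3t_{245}p_2p_4+t_{246}p_4^2)}{p_2^3}. \end{aligned}$$ Moreover $\Pi\setminus\mathbb{A}_T$ has $c(\mathrm{G}(2,5))$-singularities along $\Delta$: every point of $\Delta$ has a Zariski open neighbourhood $V$ in $\Pi$ such that the pair $(V,\Delta\cap V)$ is isomorphic to an open piece of the pair $(\mathbb{A}^8\times c(\mathrm{G}(2,5)),\ \mathbb{A}^8\times\{\text{vertex}\})$. In particular, the open subscheme $\Pi\cap\{p_2p_4\neq0\}$ is isomorphic to the open subscheme $\{p_2p_4\ne0\}$ of the Pfaffian variety in the affine $18$-space with coordinates $p_2,p_3,p_4,t_1,t_{126},t_{136},t_{245},t_{246}$ and $m_{ij}$ $(1\le i<j\le 5)$ defined by the five $4\times 4$ Pfaffians of $(m_{ij})$, by an isomorphism that preserves the eight coordinates $p_2,p_3,p_4,t_1,t_{126},t_{136},t_{245},t_{246}$ and carries $\Delta\cap\{p_2p_4\ne0\}$ onto the locus where all $m_{ij}$ vanish. -/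

import Mathlib

namespace PiFifteen

/-- The nineteen coordinates of the ambient affine space. -/
inductive Coord
  | p1 | p2 | p3 | p4 | u1 | u2 | s1 | s2 | s3
  | t1 | t2 | t123 | t124 | t125 | t126 | t135 | t136 | t245 | t246
  deriving DecidableEq

instance : Fintype Coord where
  elems := {.p1, .p2, .p3, .p4, .u1, .u2, .s1, .s2, .s3,
    .t1, .t2, .t123, .t124, .t125, .t126, .t135, .t136, .t245, .t246}
  complete := by intro c; cases c <;> decide

section Equations

open Coord

/-- The nine polynomials `F₁, …, F₉`, evaluated at a point `v` with coordinates in a commutative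
ring. -/
def equations {A : Type*} [CommRing A] (v : Coord → A) : Fin 9 → A :=
  ![
    v u1 * v s1 - v p1 * v s2 - v p2 * v s3 + v t126 * (v p2 * v p3 - v p1 * v p4)
      + v t136 * (-v p1 ^ 2 - v t1 * v p2 ^ 2 - v p2 * v u1)
      + v t245 * (-2 * v p1 * v p3 - 2 * v t1 * v p2 * v p4 - v p4 * v u1 - v p2 * v u2)
      + v t246 * (-v p3 ^ 2 - v t1 * v p4 ^ 2 - v p4 * v u2),
    v u2 * v s1 - v p3 * v s2 - v p4 * v s3 + v t125 * (-v p2 * v p3 + v p1 * v p4)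
      + v t135 * (v p1 ^ 2 + v t1 * v p2 ^ 2 + v p2 * v u1)
      + v t136 * (2 * v p1 * v p3 + 2 * v t1 * v p2 * v p4 + v p4 * v u1 + v p2 * v u2)
      + v t245 * (v p3 ^ 2 + v t1 * v p4 ^ 2 + v p4 * v u2),
    -v t2 * v p2 * v s1 + (v t1 * v p2 + v u1) * v s2 - v p1 * v s3
      + v t124 * (v p2 * v p3 - v p1 * v p4) + v t136 * (-v p2 ^ 2 * v t2 - v p1 * v u1)
      + v t245 * (-2 * v t2 * v p2 * v p4 - v p3 * v u1 - v p1 * v u2)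
      + v t246 * (-v t2 * v p4 ^ 2 - v p3 * v u2),
    -v t2 * v p4 * v s1 + (v t1 * v p4 + v u2) * v s2 - v p3 * v s3
      + v t123 * (-v p2 * v p3 + v p1 * v p4) + v t135 * (v t2 * v p2 ^ 2 + v p1 * v u1)
      + v t136 * (2 * v t2 * v p2 * v p4 + v p3 * v u1 + v p1 * v u2)
      + v t245 * (v t2 * v p4 ^ 2 + v p3 * v u2),
    -v t2 * v p1 * v s1 + (v t1 * v p1 - v t2 * v p2) * v s2 + (v t1 * v p2 + v u1) * v s3
      + v t123 * (v t1 * v p2 ^ 2 + v p1 ^ 2 + v p2 * v u1)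
      + v t124 * (v t1 * v p2 * v p4 + v p1 * v p3 + v p2 * v u2)
      - v t125 * (v t2 * v p2 ^ 2 + v p1 * v u1) - v t126 * (v t2 * v p2 * v p4 + v p1 * v u2)
      - v t136 * (v t1 * v p2 * v u1 - v t2 * v p1 * v p2 + v u1 ^ 2)
      - v t245 * (v t1 * v p4 * v u1 + v t1 * v p2 * v u2 - v t2 * v p2 * v p3
        - v t2 * v p1 * v p4 + 2 * v u1 * v u2)
      - v t246 * (v t1 * v p4 * v u2 - v t2 * v p3 * v p4 + v u2 ^ 2),
    -v t2 * v p3 * v s1 + (v t1 * v p3 - v t2 * v p4) * v s2 + (v t1 * v p4 + v u2) * v s3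
      + v t123 * (v p1 * v p3 + v t1 * v p2 * v p4 + v p4 * v u1)
      + v t124 * (v p3 ^ 2 + v t1 * v p4 ^ 2 + v p4 * v u2)
      - v t125 * (v t2 * v p2 * v p4 + v p3 * v u1) - v t126 * (v t2 * v p4 ^ 2 + v p3 * v u2)
      + v t135 * (v t1 * v p2 * v u1 - v t2 * v p1 * v p2 + v u1 ^ 2)
      + v t136 * (v t1 * v p4 * v u1 + v t1 * v p2 * v u2 - v t2 * v p2 * v p3
        - v t2 * v p1 * v p4 + 2 * v u1 * v u2)
      + v t245 * (v t1 * v p4 * v u2 - v t2 * v p3 * v p4 + v u2 ^ 2),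
    -v s2 ^ 2 + v s1 * v s3 + (v t123 * v p2 + v t124 * v p4) * v s1
      - (v t125 * v p2 + v t126 * v p4) * v s2
      + (v t136 ^ 2 - v t135 * v t245) * (v p1 ^ 2 - 2 * v p2 * v u1 - v t1 * v p2 ^ 2)
      + (v t245 ^ 2 - v t136 * v t246) * (v p3 ^ 2 - 2 * v p4 * v u2 - v t1 * v p4 ^ 2)
      + (v t135 * v t246 - v t136 * v t245) * (v p2 * v u2 + v p4 * v u1 - v p1 * v p3
        + v t1 * v p2 * v p4)
      + (v t123 * v t136 - v t124 * v t135) * v p2 ^ 2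
      + 2 * (v t123 * v t245 - v t124 * v t136) * v p2 * v p4
      + (v t123 * v t246 - v t124 * v t245) * v p4 ^ 2
      + (v t126 * v t135 - v t125 * v t136) * v p1 * v p2
      + (v t126 * v t136 - v t125 * v t245) * (v p1 * v p4 + v p2 * v p3)
      + (v t126 * v t245 - v t125 * v t246) * v p3 * v p4,
    (v s2 * v s3 + v t1 * v s1 * v s2 - v t2 * v s1 ^ 2) + (v t123 * v p1 + v t124 * v p3) * v s1
      - (v t125 * v p1 + v t126 * v p3) * v s2
      + (v t136 ^ 2 - v t135 * v t245) * (-2 * v p1 * v u1 - 2 * v t1 * v p1 * v p2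
        + v t2 * v p2 ^ 2)
      + (v t245 ^ 2 - v t136 * v t246) * (-2 * v p3 * v u2 - 2 * v t1 * v p3 * v p4
        + v t2 * v p4 ^ 2)
      + (v t135 * v t246 - v t136 * v t245) * (v p1 * v u2 + v p3 * v u1 + v t1 * (v p1 * v p4
        + v p2 * v p3) - v t2 * v p2 * v p4)
      + (v t126 * v t135 - v t125 * v t136) * v p1 ^ 2
      + 2 * (v t126 * v t136 - v t125 * v t245) * v p1 * v p3
      + (v t126 * v t245 - v t125 * v t246) * v p3 ^ 2
      + (v t123 * v t136 - v t124 * v t135) * v p1 * v p2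
      + (v t123 * v t245 - v t124 * v t136) * (v p1 * v p4 + v p2 * v p3)
      + (v t123 * v t246 - v t124 * v t245) * v p3 * v p4,
    (v s3 ^ 2 + v t1 * v s2 ^ 2 - v t2 * v s1 * v s2) + (v t123 * v u1 + v t124 * v u2) * v s1
      - (v t125 * v u1 + v t126 * v u2) * v s2
      + (-v t136 ^ 2 + v t135 * v t245) * (2 * v t2 * v p1 * v p2 + v u1 ^ 2)
      + (-v t136 * v t245 + v t135 * v t246) * (v t2 * (v p2 * v p3 + v p1 * v p4) + v u1 * v u2)
      + (-v t245 ^ 2 + v t136 * v t246) * (2 * v t2 * v p3 * v p4 + v u2 ^ 2)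
      - v t1 * ((v t123 * v t136 - v t124 * v t135) * v p2 ^ 2 + 2 * (v t123 * v t245
        - v t124 * v t136) * v p2 * v p4 + (v t123 * v t246 - v t124 * v t245) * v p4 ^ 2)
      + v t2 * ((v t125 * v t136 - v t126 * v t135) * v p2 ^ 2 + 2 * (v t125 * v t245
        - v t126 * v t136) * v p2 * v p4 + (v t125 * v t246 - v t126 * v t245) * v p4 ^ 2)
      + (v t124 * v t135 - v t123 * v t136) * v p1 ^ 2
      - 2 * (-v t124 * v t136 + v t123 * v t245) * v p1 * v p3
      + (v t124 * v t245 - v t123 * v t246) * v p3 ^ 2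
      + (v t124 * v t125 - v t123 * v t126) * (-v p2 * v p3 + v p1 * v p4)]

end Equations

/-- The ideal of `ℂ[p₁, …, t₂₄₆]` generated by `F₁, …, F₉`. -/
noncomputable def piIdeal : Ideal (MvPolynomial Coord ℂ) :=
  Ideal.span (Set.range (equations (MvPolynomial.X : Coord → MvPolynomial Coord ℂ)))

/-- The coordinate ring of the affine scheme `Π = {F₁ = ⋯ = F₉ = 0}` in affine `19`-space.
The scheme `Π` itself is the prime spectrum of this ring. -/
abbrev PiRing : Type := MvPolynomial Coord ℂ ⧸ piIdeal

/-- The coordinate functions on `Π`. -/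
noncomputable def coord (c : Coord) : PiRing := Ideal.Quotient.mk piIdeal (MvPolynomial.X c)

/-- The nine coordinates that vanish on the affine `10`-space with coordinates `t₁, …, t₂₄₆`. -/
def fiberCoords : Set Coord :=
  {Coord.p1, Coord.p2, Coord.p3, Coord.p4, Coord.u1, Coord.u2, Coord.s1, Coord.s2, Coord.s3}

/-- Every `Fᵢ` vanishes where the nine coordinates `p₁, …, s₃` do, so the affine `10`-space of the
coordinates `t₁, …, t₂₄₆` is contained in `Π`. -/
theorem equations_eq_zero {A : Type*} [CommRing A] (v : Coord → A)
    (h : ∀ c ∈ fiberCoords, v c = 0) : equations v = 0 := by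
  have h1 := h Coord.p1 (by simp [fiberCoords])
  have h2 := h Coord.p2 (by simp [fiberCoords])
  have h3 := h Coord.p3 (by simp [fiberCoords])
  have h4 := h Coord.p4 (by simp [fiberCoords])
  have h5 := h Coord.u1 (by simp [fiberCoords])
  have h6 := h Coord.u2 (by simp [fiberCoords])
  have h7 := h Coord.s1 (by simp [fiberCoords])
  have h8 := h Coord.s2 (by simp [fiberCoords])
  have h9 := h Coord.s3 (by simp [fiberCoords])
  simp [equations, h1, h2, h3, h4, h5, h6, h7, h8, h9]

/-- The closed subset `𝔸_T` of `Π`: the affine `10`-space `{p = u = s = 0}`. -/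
def affineT : Set (PrimeSpectrum PiRing) := PrimeSpectrum.zeroLocus (coord '' fiberCoords)

/-- The set of points of `Spec A` whose local ring is not regular. -/
def singularLocus (A : Type*) [CommRing A] : Set (PrimeSpectrum A) :=
  {x | ¬ IsRegularLocalRing (Localization.AtPrime x.asIdeal)}

/-- The singular locus `Δ` of the open subscheme `Π ∖ 𝔸_T`. -/
def Delta : Set (PrimeSpectrum PiRing) := singularLocus PiRing ∩ affineTᶜ

/-- The value of a coordinate function at a point, in the residue field of that point. -/
noncomputable def valueAt (x : PrimeSpectrum PiRing) (c : Coord) : x.asIdeal.ResidueField :=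
  algebraMap PiRing x.asIdeal.ResidueField (coord c)

section Explicit

open Coord

/-- The explicit equations of `Δ` on `{p₂ p₄ ≠ 0}`, for a point `v` over a field. -/
def ExplicitEquations {K : Type*} [Field K] (v : Coord → K) : Prop :=
  v p1 = (v p2 * v p3) / v p4 ∧
  v u1 = (v p2 * v u2) / v p4 ∧
  v u2 = -(v p3 ^ 2 + v t1 * v p4 ^ 2) / v p4 ∧
  v t2 = -(v p3 * v u2) / v p4 ^ 2 ∧
  v s1 = -(v t136 * v p2 ^ 2 + 2 * v t245 * v p2 * v p4 + v t246 * v p4 ^ 2) / v p2 ∧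
  v s2 = (v p3 / v p4) * v s1 ∧
  v s3 = -((2 * v p3 ^ 2 + v t1 * v p4 ^ 2) / v p4 ^ 2) * v s1 ∧
  v t123 = -(v t126 * v p2 * v p3 * v p4 ^ 2
      + v t136 * (3 * v p3 ^ 2 + 2 * v t1 * v p4 ^ 2) * v p2 ^ 2
      + 3 * v t245 * (v p3 ^ 2 + v t1 * v p4 ^ 2) * v p2 * v p4
      + v t246 * v t1 * v p4 ^ 4) / (v p2 ^ 2 * v p4 ^ 2) ∧
  v t124 = (v t126 * v p2 * v p3 * v p4
      - v t245 * (3 * v p3 ^ 2 + v t1 * v p4 ^ 2) * v p2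
      - v t246 * (3 * v p3 ^ 2 + v t1 * v p4 ^ 2) * v p4) / (v p2 * v p4 ^ 2) ∧
  v t125 = (-v t126 * v p2 * v p4 ^ 2 + 3 * v t136 * v p2 ^ 2 * v p3
      + 6 * v t245 * v p2 * v p3 * v p4 + 3 * v t246 * v p3 * v p4 ^ 2) / (v p2 ^ 2 * v p4) ∧
  v t135 = -(v p4 * (3 * v t136 * v p2 ^ 2 + 3 * v t245 * v p2 * v p4 + v t246 * v p4 ^ 2))
      / v p2 ^ 3

end Explicit

/-- The ten pairs `i < j` that index the Plücker coordinates `mᵢⱼ` of `∧² ℂ⁵`. -/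
abbrev PairIndex : Type := {e : Fin 5 × Fin 5 // e.1 < e.2}

/-- The `4 × 4` Pfaffian of a skew matrix on the rows and columns `a, b, c, d`. -/
def pfaffian {A : Type*} [CommRing A] (M : Matrix (Fin 5) (Fin 5) A) (a b c d : Fin 5) : A :=
  M a b * M c d - M a c * M b d + M a d * M b c

/-- The skew-symmetric `5 × 5` matrix with entries `mᵢⱼ` above the diagonal. -/
def skewMatrix {A : Type*} [CommRing A] (m : PairIndex → A) : Matrix (Fin 5) (Fin 5) A :=
  Matrix.of fun i j =>
    if h : i < j then m ⟨(i, j), h⟩ else if h : j < i then -m ⟨(j, i), h⟩ else 0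

/-- The five `4 × 4` Pfaffians of the matrix `skewMatrix m`. -/
def pfaffians {A : Type*} [CommRing A] (m : PairIndex → A) : Set A :=
  {q | ∃ a b c d : Fin 5, a < b ∧ b < c ∧ c < d ∧ q = pfaffian (skewMatrix m) a b c d}

/-- The points at which the Pfaffians (the Plücker relations) vanish are exactly the decomposable
bivectors `x ∧ y`, i.e. the points of the affine cone over the Grassmannian `G(2, 5)`. -/
theorem pfaffians_vanish_iff {K : Type*} [Field K] (m : PairIndex → K) :
    (∀ q ∈ pfaffians m, q = 0) ↔
      ∃ x y : Fin 5 → K, ∀ e : PairIndex, m e = x e.1.1 * y e.1.2 - x e.1.2 * y e.1.1 := by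
  have key : ∀ M : Matrix (Fin 5) (Fin 5) K, (∀ i, M i i = 0) → (∀ i j, M j i = -M i j) →
      (∀ a b c d : Fin 5, a < b → b < c → c < d → pfaffian M a b c d = 0) →
      ∀ a b c d : Fin 5, pfaffian M a b c d = 0 := by
    intro M h0 hs hP
    have e1 : ∀ a b c d, pfaffian M b a c d = -pfaffian M a b c d := by
      intro a b c d; simp only [pfaffian]; rw [hs a b]; ring
    have e2 : ∀ a b c d, pfaffian M a c b d = -pfaffian M a b c d := by
      intro a b c d; simp only [pfaffian]; rw [hs b c]; ring
    have e3 : ∀ a b c d, pfaffian M a b d c = -pfaffian M a b c d := by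
      intro a b c d; simp only [pfaffian]; rw [hs c d]; ring
    have f1 : ∀ a c d, pfaffian M a a c d = 0 := by
      intro a c d; simp only [pfaffian, h0]; ring
    have f2 : ∀ a b d, pfaffian M a b b d = 0 := by
      intro a b d; simp only [pfaffian, h0]; ring
    have f3 : ∀ a b c, pfaffian M a b c c = 0 := by
      intro a b c; simp only [pfaffian, h0]; ring
    have g3 : ∀ a b c d, a < b → b < c → b < d → pfaffian M a b c d = 0 := by
      intro a b c d hab hbc hbd
      rcases lt_trichotomy c d with h | rfl | h
      · exact hP a b c d hab hbc h
      · exact f3 a b c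
      · rw [e3, hP a b d c hab hbd h, neg_zero]
    have g2' : ∀ a b c d, a < b → a < c → a < d → b < c → pfaffian M a b c d = 0 := by
      intro a b c d hab hac had hbc
      rcases lt_trichotomy b d with h | rfl | h
      · exact g3 a b c d hab hbc h
      · rw [e3, f2, neg_zero]
      · rw [e3, e2, g3 a d b c had h (h.trans hbc), neg_zero, neg_zero]
    have g2 : ∀ a b c d, a < b → a < c → a < d → pfaffian M a b c d = 0 := by
      intro a b c d hab hac had
      rcases lt_trichotomy b c with h | rfl | h
      · exact g2' a b c d hab hac had h
      · exact f2 a b d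
      · rw [e2, g2' a c b d hac hab had h, neg_zero]
    have g1'' : ∀ a b c d, a < b → a < c → pfaffian M a b c d = 0 := by
      intro a b c d hab hac
      rcases lt_trichotomy a d with h | rfl | h
      · exact g2 a b c d hab hac h
      · rw [e3, e2, f1, neg_zero, neg_zero]
      · rw [e3, e2, e1, g2 d a b c h (h.trans hab) (h.trans hac)]; simp
    have g1' : ∀ a b c d, a < b → pfaffian M a b c d = 0 := by
      intro a b c d hab
      rcases lt_trichotomy a c with h | rfl | h
      · exact g1'' a b c d hab h
      · rw [e2, f1, neg_zero]
      · rw [e2, e1, g1'' c a b d h (h.trans hab), neg_zero, neg_zero]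
    intro a b c d
    rcases lt_trichotomy a b with h | rfl | h
    · exact g1' a b c d h
    · exact f1 a c d
    · rw [e1, g1' b a c d h, neg_zero]
  constructor
  · intro h
    by_cases hm : ∀ e, m e = 0
    · exact ⟨0, 0, fun e => by simp [hm e]⟩
    push Not at hm
    obtain ⟨⟨⟨a, b⟩, hab⟩, hne⟩ := hm
    have hs : ∀ i j, skewMatrix m j i = -skewMatrix m i j := by
      intro i j
      rcases lt_trichotomy i j with hij | rfl | hij
      · simp [skewMatrix, hij, hij.not_gt]
      · simp [skewMatrix]
      · simp [skewMatrix, hij, hij.not_gt]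
    have hQ := key (skewMatrix m) (fun i => by simp [skewMatrix]) hs
      (fun a b c d h1 h2 h3 => h _ ⟨a, b, c, d, h1, h2, h3, rfl⟩)
    have hne' : skewMatrix m a b ≠ 0 := by
      have hab' : a < b := hab
      simpa [skewMatrix, hab'] using hne
    refine ⟨fun i => skewMatrix m a i, fun i => skewMatrix m b i / skewMatrix m a b, ?_⟩
    rintro ⟨⟨i, j⟩, hij⟩
    have hij' : i < j := hij
    have e : m ⟨(i, j), hij⟩ = skewMatrix m i j := by simp [skewMatrix, hij']
    have q := hQ a b i j
    simp only [pfaffian] at q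
    rw [e]
    field_simp
    linear_combination q
  · rintro ⟨x, y, h⟩ q ⟨a, b, c, d, hab, hbc, hcd, rfl⟩
    simp [pfaffian, skewMatrix, h, hab, hbc, hcd, hab.trans hbc, hbc.trans hcd,
      hab.trans (hbc.trans hcd)]
    ring

/-- The ideal of the five `4 × 4` Pfaffians in `B[mᵢⱼ]`. -/
noncomputable def pfaffianIdeal (B : Type*) [CommRing B] : Ideal (MvPolynomial PairIndex B) :=
  Ideal.span (pfaffians (MvPolynomial.X : PairIndex → MvPolynomial PairIndex B))

/-- The coordinate ring of the affine cone `c(G(2, 5))` over the Plücker embedded Grassmannian,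
over the base ring `B`. For `B = ℂ[y₁, …, yₙ]` it is the coordinate ring of
`𝔸ⁿ × c(G(2, 5))`. -/
abbrev ConeRing (B : Type*) [CommRing B] : Type _ := MvPolynomial PairIndex B ⧸ pfaffianIdeal B

/-- The Plücker coordinate `mᵢⱼ` as a function on the cone. The vertex is the locus where all of
them vanish. -/
noncomputable def plucker (B : Type*) [CommRing B] (k : PairIndex) : ConeRing B :=
  Ideal.Quotient.mk (pfaffianIdeal B) (MvPolynomial.X k)

/-- An isomorphism `e` of the basic open subscheme `{f ≠ 0}` of `Spec A` with the basic open
subscheme `{g ≠ 0}` of `𝔸^τ × c(G(2, 5))` is a cone chart for `Z ⊆ Spec A` if it matches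
`Z ∩ {f ≠ 0}` with `(𝔸^τ × {vertex}) ∩ {g ≠ 0}`. -/
def IsConeChart {A : Type*} [CommRing A] [Algebra ℂ A] (Z : Set (PrimeSpectrum A)) {τ : Type*}
    {f : A} {g : ConeRing (MvPolynomial τ ℂ)}
    (e : Localization.Away f ≃ₐ[ℂ] Localization.Away g) : Prop :=
  ∀ z : PrimeSpectrum (Localization.Away f),
    PrimeSpectrum.comap (algebraMap A (Localization.Away f)) z ∈ Z ↔
      ∀ k : PairIndex, e.symm (algebraMap _ _ (plucker (MvPolynomial τ ℂ) k)) ∈ z.asIdeal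

/-- `Spec A` has `c(G(2, 5))`-singularities along the `n`-dimensional subset `Z`: every point of
`Z` has an open neighbourhood on which the pair `(Spec A, Z)` is isomorphic to an open piece of
`(𝔸ⁿ × c(G(2, 5)), 𝔸ⁿ × {vertex})`. -/
def HasConeSingularitiesAlong (A : Type*) [CommRing A] [Algebra ℂ A] (n : ℕ)
    (Z : Set (PrimeSpectrum A)) : Prop :=
  ∀ x ∈ Z, ∃ f : A, f ∉ x.asIdeal ∧ ∃ (g : ConeRing (MvPolynomial (Fin n) ℂ))
    (e : Localization.Away f ≃ₐ[ℂ] Localization.Away g), IsConeChart Z e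

/-- The eight coordinates that stay unchanged in the chart on `{p₂ p₄ ≠ 0}`. -/
inductive BaseCoord
  | p2 | p3 | p4 | t1 | t126 | t136 | t245 | t246
  deriving DecidableEq

instance : Fintype BaseCoord where
  elems := {.p2, .p3, .p4, .t1, .t126, .t136, .t245, .t246}
  complete := by intro c; cases c <;> decide

/-- The eight coordinates as coordinates of the ambient affine `19`-space. -/
def BaseCoord.toCoord : BaseCoord → Coord
  | .p2 => .p2
  | .p3 => .p3
  | .p4 => .p4
  | .t1 => .t1
  | .t126 => .t126
  | .t136 => .t136
  | .t245 => .t245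
  | .t246 => .t246

/-- The coordinate ring of the Pfaffian variety in the affine `18`-space with the ten coordinates
`mᵢⱼ` and the eight coordinates `BaseCoord`. -/
abbrev PfaffianRing : Type := ConeRing (MvPolynomial BaseCoord ℂ)

/-- The eight base coordinates as functions on the Pfaffian variety. -/
noncomputable def baseCoord (b : BaseCoord) : PfaffianRing :=
  algebraMap (MvPolynomial BaseCoord ℂ) PfaffianRing (MvPolynomial.X b)

end PiFifteen

/-! The main chart comes from the slice `p₂ = 0`, `p₄ = 1`. There `F₂` expresses `s₃` through the
other coordinates, and `F₁`, `F₃`, `F₆ - p₃F₄`, `F₄ - p₃F₂`, `F₇ + t₂₄₅F₂` are the five Pfaffians of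
a skew matrix whose ten entries serve as coordinates beside `p₃, t₁, t₁₂₅, t₁₃₅, t₁₃₆, t₂₄₅`; the
remaining `F₅, F₈, F₉` lie in the ideal of the others. So the slice is `𝔸⁶ × c(G(2, 5))`
(`slicePlucker_pfaffians`, `equations_slicePoint`). Shearing by `p₂ / p₄` and rescaling by `p₄`
carries `{p₄ ≠ 0}` to this slice. Where also `p₂ ≠ 0`, the coordinates `t₁₂₅, t₁₃₅` can be traded
for `t₁₂₆, t₂₄₆`, which gives the chart with the eight prescribed base coordinates
(`exists_mainChart`).

The cone is understood independently of `Π`. Off the vertex it is covered by open pieces of affine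
spaces (`coneChart`); at the vertex the Pfaffians lie in the square of the maximal ideal, so the
local ring is not regular (`singularLocus_coneRing`). Hence every isomorphism with an open piece of
`𝔸ⁿ × c(G(2, 5))` matches the singular locus with the vertices (`isConeChart_singularLocus`), and
the explicit equations of `Δ` are the vanishing of the ten Plücker coordinates
(`mainPlucker_eq_zero_iff`).

Three automorphisms of `Π`, namely `swap`, `shear` and the less obvious `twistedShear`, move every
point at which some `pᵢ` or `uᵢ` is nonzero into `{p₂p₄ ≠ 0}`. At a point where all of these vanish,
`F₇` and `F₉` reduce to relations among `s₁, s₂, s₃` which force `s₁ ≠ 0` outside `𝔸_T`; near it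
`u₁, u₂, s₃, t₂` are rational functions of the other fifteen coordinates (`nonempty_sChart`), so `Π`
is regular there. This dichotomy is `isMovable_or_sDenominator_notMem`.

Irreducibility follows because all charts are irreducible and meet `{p₂p₄ ≠ 0}`: the translated
charts at the generic point of a linear subspace of `Π` stable under the automorphisms, the smooth
chart at an explicit point. The dimension is at most `8 + 7` on the cone charts and equals `15` on
the smooth one; `Δ` is locally an open piece of `𝔸⁸`. -/

namespace PiFifteen

/-! ### Dimension and irreducibility from open covers. -/

section Topology

open TopologicalSpace Topology

/-- A space covered by open subsets of dimension at most `n` has dimension at most `n`. -/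
theorem topologicalKrullDim_le_of_open_cover {X : Type*} [TopologicalSpace X] {n : WithBot ℕ∞}
    (h : ∀ x : X, ∃ V : Set X, IsOpen V ∧ x ∈ V ∧ topologicalKrullDim ↥V ≤ n) :
    topologicalKrullDim X ≤ n := by
  rw [topologicalKrullDim, Order.krullDim_eq_iSup_coheight]
  refine iSup_le fun Z => ?_
  obtain ⟨x, hx⟩ := Z.isIrreducible.nonempty
  obtain ⟨V, hV, hxV, hn⟩ := h x
  have hj := hV.isOpenEmbedding_subtypeVal
  obtain ⟨T, hT⟩ := (IrreducibleCloseds.orderIsoOfIsOpenEmbedding _ hj).surjective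
    ⟨Z, ⟨⟨x, hxV⟩, hx⟩⟩
  have hT' : IrreducibleCloseds.map Subtype.val hj.continuous T = Z := congrArg Subtype.val hT
  rw [← hT', hj.coheight_map]
  exact (Order.coheight_le_krullDim T).trans hn

/-- A subset of the range of an embedding has the same dimension as its preimage. -/
theorem topologicalKrullDim_preimage_of_isEmbedding {X Y : Type*} [TopologicalSpace X]
    [TopologicalSpace Y] {j : Y → X} (hj : IsEmbedding j) {S : Set X} (hS : S ⊆ Set.range j) :
    topologicalKrullDim ↥(j ⁻¹' S) = topologicalKrullDim ↥S := by
  refine IsHomeomorph.topologicalKrullDim_eq (S.restrictPreimage j) ?_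
  rw [isHomeomorph_iff_isEmbedding_surjective]
  refine ⟨hj.restrictPreimage S, ?_⟩
  rintro ⟨x, hx⟩
  obtain ⟨y, rfl⟩ := hS hx
  exact ⟨⟨y, hx⟩, rfl⟩

theorem topologicalKrullDim_univ (X : Type*) [TopologicalSpace X] :
    topologicalKrullDim ↥(Set.univ : Set X) = topologicalKrullDim X :=
  IsHomeomorph.topologicalKrullDim_eq _ (Homeomorph.Set.univ X).isHomeomorph

theorem topologicalKrullDim_mono {X : Type*} [TopologicalSpace X] {S T : Set X} (h : S ⊆ T) :
    topologicalKrullDim ↥S ≤ topologicalKrullDim ↥T :=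
  (IsEmbedding.inclusion h).isInducing.topologicalKrullDim_le

/-- A subset that is locally of dimension at most `n` has dimension at most `n`. -/
theorem topologicalKrullDim_le_of_local {X : Type*} [TopologicalSpace X] {n : WithBot ℕ∞}
    {S : Set X} (h : ∀ x ∈ S, ∃ V : Set X, IsOpen V ∧ x ∈ V ∧
      topologicalKrullDim ↥(S ∩ V) ≤ n) : topologicalKrullDim ↥S ≤ n := by
  refine topologicalKrullDim_le_of_open_cover fun x => ?_
  obtain ⟨V, hV, hxV, hn⟩ := h x x.2
  refine ⟨Subtype.val ⁻¹' (S ∩ V), ?_, ⟨x.2, hxV⟩, ?_⟩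
  · rw [Set.preimage_inter, Subtype.coe_preimage_self, Set.univ_inter]
    exact hV.preimage continuous_subtype_val
  · rwa [topologicalKrullDim_preimage_of_isEmbedding IsEmbedding.subtypeVal]
    rw [Subtype.range_coe]
    exact Set.inter_subset_left

/-- A union of irreducible open sets that all meet one of them is irreducible. -/
theorem isIrreducible_of_open_cover {X : Type*} [TopologicalSpace X] {U U₀ : Set X}
    (h₀ : IsOpen U₀) (hi : IsIrreducible U₀) (hs : U₀ ⊆ U)
    (h : ∀ x ∈ U, ∃ V : Set X, x ∈ V ∧ IsIrreducible V ∧ (V ∩ U₀).Nonempty) :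
    IsIrreducible U := by
  refine hi.isPreirreducible.closure.subset_irreducible hi.nonempty h₀ hs fun x hx => ?_
  obtain ⟨V, hxV, hV, hne⟩ := h x hx
  exact closure_mono Set.inter_subset_right
    (subset_closure_inter_of_isPreirreducible_of_isOpen hV.isPreirreducible h₀ hne hxV)

end Topology

/-! ### Basic open subschemes: singular locus, dimension, irreducibility, isomorphisms. -/

section Localization

open PrimeSpectrum

/-- The singular locus of a basic open subscheme is the trace of the singular locus. -/
theorem mem_singularLocus_away {A : Type*} [CommRing A] {f : A}
    (z : PrimeSpectrum (Localization.Away f)) :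
    z ∈ singularLocus (Localization.Away f) ↔
      comap (algebraMap A (Localization.Away f)) z ∈ singularLocus A := by
  have e := (IsLocalization.localizationLocalizationAtPrimeIsoLocalization
    (Submonoid.powers f) z.asIdeal).toRingEquiv
  exact not_congr ⟨fun h => @IsRegularLocalRing.of_ringEquiv _ _ h _ _ e.symm,
    fun h => @IsRegularLocalRing.of_ringEquiv _ _ h _ _ e⟩

theorem mem_singularLocus_ringEquiv {A B : Type*} [CommRing A] [CommRing B] (e : A ≃+* B)
    (z : PrimeSpectrum B) :
    comap (e : A →+* B) z ∈ singularLocus A ↔ z ∈ singularLocus B := by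
  have e := IsLocalization.ringEquivOfRingEquiv (M := (z.asIdeal.comap e).primeCompl)
    (T := z.asIdeal.primeCompl) (Localization.AtPrime (z.asIdeal.comap e))
    (Localization.AtPrime z.asIdeal) e (e.map_primeCompl_comap_eq z.asIdeal)
  exact not_congr ⟨fun h => @IsRegularLocalRing.of_ringEquiv _ _ h _ _ e,
    fun h => @IsRegularLocalRing.of_ringEquiv _ _ h _ _ e.symm⟩

theorem singularLocus_eq_empty (A : Type*) [CommRing A] [IsRegularRing A] :
    singularLocus A = ∅ :=
  Set.eq_empty_of_forall_notMem fun _ hx => hx inferInstance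

theorem comap_away_mem_basicOpen {A : Type*} [CommRing A] (f : A)
    (z : PrimeSpectrum (Localization.Away f)) :
    f ∉ (comap (algebraMap A (Localization.Away f)) z).asIdeal := fun h =>
  z.isPrime.ne_top (Ideal.eq_top_of_isUnit_mem _ h
    (IsLocalization.Away.algebraMap_isUnit f))

theorem exists_comap_away_eq {A : Type*} [CommRing A] {f : A} {x : PrimeSpectrum A}
    (h : f ∉ x.asIdeal) :
    ∃ z : PrimeSpectrum (Localization.Away f),
      comap (algebraMap A (Localization.Away f)) z = x := by
  have := localization_away_comap_range (Localization.Away f) f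
  exact (Set.ext_iff.1 this x).2 h

theorem isEmbedding_comap_away {A : Type*} [CommRing A] (f : A) :
    Topology.IsEmbedding (comap (algebraMap A (Localization.Away f))) :=
  localization_comap_isEmbedding _ (Submonoid.powers f)

theorem topologicalKrullDim_basicOpen {A : Type*} [CommRing A] (f : A) :
    topologicalKrullDim ↥(basicOpen f : Set (PrimeSpectrum A)) =
      ringKrullDim (Localization.Away f) := by
  rw [← topologicalKrullDim_preimage_of_isEmbedding (isEmbedding_comap_away f)
      (localization_away_comap_range (Localization.Away f) f).ge,
    ← topologicalKrullDim_eq_ringKrullDim,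
    ← topologicalKrullDim_univ (PrimeSpectrum (Localization.Away f)),
    Set.eq_univ_of_forall (s := comap (algebraMap A (Localization.Away f)) ⁻¹' basicOpen f)
      fun z => comap_away_mem_basicOpen f z]

theorem ringKrullDim_away_le {A : Type*} [CommRing A] (f : A) :
    ringKrullDim (Localization.Away f) ≤ ringKrullDim A := by
  rw [← topologicalKrullDim_eq_ringKrullDim, ← topologicalKrullDim_eq_ringKrullDim]
  exact (isEmbedding_comap_away f).isInducing.topologicalKrullDim_le

/-- The spectrum of the local ring at `x` embeds into `{f ≠ 0}`, because `f` becomes a unit there,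
and a subspace has at most the dimension of the ambient space. -/
theorem height_le_ringKrullDim_away {A : Type*} [CommRing A] {f : A} {x : Ideal A} [x.IsPrime]
    (h : f ∉ x) : x.height ≤ ringKrullDim (Localization.Away f) := by
  rw [← IsLocalization.AtPrime.ringKrullDim_eq_height x (Localization.AtPrime x),
    ← topologicalKrullDim_basicOpen, ← topologicalKrullDim_eq_ringKrullDim,
    ← topologicalKrullDim_univ,
    ← Set.preimage_range (comap (algebraMap A (Localization.AtPrime x))),
    topologicalKrullDim_preimage_of_isEmbedding
      (localization_comap_isEmbedding _ x.primeCompl) subset_rfl]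
  refine topologicalKrullDim_mono ?_
  rintro _ ⟨z, rfl⟩
  exact fun hz => z.isPrime.ne_top (Ideal.eq_top_of_isUnit_mem _ hz
    (IsLocalization.map_units (Localization.AtPrime x) (⟨f, h⟩ : x.primeCompl)))

theorem isIrreducible_basicOpen {A : Type*} [CommRing A] (f : A)
    [IrreducibleSpace (PrimeSpectrum (Localization.Away f))] :
    IsIrreducible (basicOpen f : Set (PrimeSpectrum A)) := by
  rw [← localization_away_comap_range (Localization.Away f) f, ← Set.image_univ]
  exact (IrreducibleSpace.isIrreducible_univ _).image _ (by fun_prop)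

theorem irreducibleSpace_away {A : Type*} [CommRing A] [IrreducibleSpace (PrimeSpectrum A)]
    {f : A} (hf : ¬ IsNilpotent f) : IrreducibleSpace (PrimeSpectrum (Localization.Away f)) := by
  have h : IsIrreducible (Set.univ : Set (PrimeSpectrum (Localization.Away f))) := by
    rw [← Set.preimage_univ (f := comap (algebraMap A (Localization.Away f)))]
    refine (IrreducibleSpace.isIrreducible_univ _).preimage
      (localization_away_isOpenEmbedding (Localization.Away f) f) ?_
    rw [Set.univ_inter, localization_away_comap_range (Localization.Away f) f,
      Set.nonempty_iff_ne_empty]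
    intro h0
    exact hf (basicOpen_eq_bot_iff f |>.1 (TopologicalSpace.Opens.ext h0))
  exact { isPreirreducible_univ := h.2, toNonempty := ⟨h.nonempty.some⟩ }

theorem irreducibleSpace_of_ringEquiv {A B : Type*} [CommRing A] [CommRing B] (e : A ≃+* B)
    [IrreducibleSpace (PrimeSpectrum B)] : IrreducibleSpace (PrimeSpectrum A) := by
  have h := (IrreducibleSpace.isIrreducible_univ (PrimeSpectrum B)).image
    (homeomorphOfRingEquiv e).symm (homeomorphOfRingEquiv e).symm.continuous.continuousOn
  rw [Set.image_univ, (homeomorphOfRingEquiv e).symm.surjective.range_eq] at h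
  exact { isPreirreducible_univ := h.2, toNonempty := ⟨h.nonempty.some⟩ }

/-- Mutually inverse morphisms between basic open subschemes, given on functions. -/
noncomputable def awayEquiv {k A B : Type*} [CommRing k] [CommRing A] [CommRing B] [Algebra k A]
    [Algebra k B] {f : A} {g : B} (φ : A →ₐ[k] Localization.Away g)
    (ψ : B →ₐ[k] Localization.Away f) (hφ : IsUnit (φ f)) (hψ : IsUnit (ψ g))
    (h₁ : ∀ χ : Localization.Away g →ₐ[k] Localization.Away f,
      (∀ b, χ (algebraMap B _ b) = ψ b) → ∀ a, χ (φ a) = algebraMap A _ a)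
    (h₂ : ∀ χ : Localization.Away f →ₐ[k] Localization.Away g,
      (∀ a, χ (algebraMap A _ a) = φ a) → ∀ b, χ (ψ b) = algebraMap B _ b) :
    Localization.Away f ≃ₐ[k] Localization.Away g :=
  let Φ : Localization.Away f →ₐ[k] Localization.Away g :=
    IsLocalization.liftAlgHom (M := Submonoid.powers f) (f := φ) (by
      rintro ⟨_, n, rfl⟩; simpa using hφ.pow n)
  let Ψ : Localization.Away g →ₐ[k] Localization.Away f :=
    IsLocalization.liftAlgHom (M := Submonoid.powers g) (f := ψ) (by
      rintro ⟨_, n, rfl⟩; simpa using hψ.pow n)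
  have hΦ : ∀ a, Φ (algebraMap A _ a) = φ a := fun a => by simp [Φ]
  have hΨ : ∀ b, Ψ (algebraMap B _ b) = ψ b := fun b => by simp [Ψ]
  AlgEquiv.ofAlgHom Φ Ψ
    (IsLocalization.algHom_ext (Submonoid.powers g) (AlgHom.ext fun b => by
      exact (congrArg Φ (hΨ b)).trans (h₂ Φ hΦ b)))
    (IsLocalization.algHom_ext (Submonoid.powers f) (AlgHom.ext fun a => by
      exact (congrArg Ψ (hΦ a)).trans (h₁ Ψ hΨ a)))

theorem awayEquiv_algebraMap {k A B : Type*} [CommRing k] [CommRing A] [CommRing B] [Algebra k A]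
    [Algebra k B] {f : A} {g : B} (φ : A →ₐ[k] Localization.Away g)
    (ψ : B →ₐ[k] Localization.Away f) (hφ : IsUnit (φ f)) (hψ : IsUnit (ψ g)) (h₁ h₂) (a : A) :
    awayEquiv φ ψ hφ hψ h₁ h₂ (algebraMap A _ a) = φ a := by
  simp [awayEquiv]

theorem awayEquiv_symm_algebraMap {k A B : Type*} [CommRing k] [CommRing A] [CommRing B]
    [Algebra k A] [Algebra k B] {f : A} {g : B} (φ : A →ₐ[k] Localization.Away g)
    (ψ : B →ₐ[k] Localization.Away f) (hφ : IsUnit (φ f)) (hψ : IsUnit (ψ g)) (h₁ h₂) (b : B) :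
    (awayEquiv φ ψ hφ hψ h₁ h₂).symm (algebraMap B _ b) = ψ b := by
  simp [awayEquiv]

end Localization

/-! ### A criterion for non-regular local rings. -/

section Regularity

open IsLocalRing

/-- A nontrivial quotient of a local domain by an ideal in the square of the maximal ideal is not
regular. -/
theorem not_isRegularLocalRing_of_ker_le_sq {R S : Type*} [CommRing R] [CommRing S]
    [IsLocalRing R] [IsNoetherianRing R] [IsDomain R] (φ : R →+* S)
    (hφ : Function.Surjective φ) (hker : RingHom.ker φ ≤ maximalIdeal R ^ 2)
    {r : R} (hr : r ≠ 0) (hr' : φ r = 0) : ¬ IsRegularLocalRing S := by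
  intro hS
  have hd := hS.spanFinrank_maximalIdeal
  obtain ⟨t, ht, hspan⟩ := Submodule.FG.exists_span_finset_card_eq_spanFinrank
    (maximalIdeal S).fg_of_isNoetherianRing
  have : IsLocalHom φ := hφ.isLocalHom
  choose g hg using hφ
  -- If `S` were regular, lifts of a minimal system of generators of its maximal ideal would
  -- generate that of `R`, giving `dim R ≤ dim S`.
  set J : Ideal R := Ideal.span (g '' t) with hJ
  have hmap : J.map φ = maximalIdeal S := by
    rw [hJ, Ideal.map_span, ← Set.image_comp, show (φ ∘ g) = id from funext hg, Set.image_id]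
    exact hspan
  -- Nakayama: the lifts generate modulo the kernel, and the kernel lies in the square of the
  -- maximal ideal.
  have hle : maximalIdeal R ≤ J := by
    refine Submodule.le_of_le_smul_of_le_jacobson_bot (I := maximalIdeal R)
      (maximalIdeal R).fg_of_isNoetherianRing (maximalIdeal_le_jacobson _) fun a ha => ?_
    have ha' : φ a ∈ J.map φ := by
      rw [hmap]
      exact (mem_maximalIdeal _).2 (map_mem_nonunits_iff φ a |>.2 ha)
    obtain ⟨j, hj, hja⟩ := (Ideal.mem_map_iff_of_surjective φ (fun s => ⟨g s, hg s⟩)).1 ha'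
    refine Submodule.mem_sup.2 ⟨j, hj, a - j, ?_, by ring⟩
    rw [smul_eq_mul, ← sq]
    exact hker (by rw [RingHom.mem_ker, map_sub, hja, sub_self])
  have hJm : maximalIdeal R = J := le_antisymm hle (Ideal.span_le.2 (by
    rintro _ ⟨s, hs, rfl⟩
    have hs' : s ∈ maximalIdeal S := hspan ▸ Submodule.subset_span hs
    exact (map_mem_nonunits_iff φ (g s)).1 (by rw [hg]; exact hs')))
  have h1 : ringKrullDim R ≤ (t.card : ℕ) := by
    refine (ringKrullDim_le_spanFinrank_maximalIdeal R).trans ?_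
    rw [hJm]
    exact_mod_cast (Submodule.spanFinrank_span_le_ncard_of_finite (t.finite_toSet.image g)).trans
      ((Set.ncard_image_le t.finite_toSet).trans (Set.ncard_coe_finset t).le)
  -- Killing a nonzero element of a domain lowers the dimension, which contradicts the bound above.
  have h2 := ringKrullDim_succ_le_of_surjective φ (fun s => ⟨g s, hg s⟩)
    (mem_nonZeroDivisors_of_ne_zero hr) hr'
  rw [← hd, ← ht] at h2
  have h3 := h2.trans h1
  norm_cast at h3
  omega

/-- Localizing at the preimage of `x` puts `I` into the square of the maximal ideal, since
denominators are units, and the criterion for local domains applies. -/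
theorem not_isRegularLocalRing_quotient {A : Type*} [CommRing A] [IsNoetherianRing A] [IsDomain A]
    {I : Ideal A} {r : A} (hr : r ≠ 0) (hrI : r ∈ I) (x : Ideal (A ⧸ I)) [x.IsPrime]
    (h : I ≤ x.comap (Ideal.Quotient.mk I) ^ 2) :
    ¬ IsRegularLocalRing (Localization.AtPrime x) := by
  have hs := RingHom.surjective_localRingHom_of_surjective (Ideal.Quotient.mk I)
    Ideal.Quotient.mk_surjective x
  set P := x.comap (Ideal.Quotient.mk I) with hP
  have hinj : Function.Injective (algebraMap A (Localization.AtPrime P)) :=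
    IsLocalization.injective _ P.primeCompl_le_nonZeroDivisors
  have : IsDomain (Localization.AtPrime P) :=
    IsLocalization.isDomain_localization P.primeCompl_le_nonZeroDivisors
  refine not_isRegularLocalRing_of_ker_le_sq _ hs (fun a ha => ?_)
    (r := algebraMap A _ r) ((map_ne_zero_iff _ hinj).2 hr) ?_
  · obtain ⟨a, s, rfl⟩ := IsLocalization.exists_mk'_eq P.primeCompl a
    rw [RingHom.mem_ker, Localization.localRingHom_mk', IsLocalization.mk'_eq_zero_iff] at ha
    obtain ⟨⟨t, htx⟩, ht⟩ := ha
    obtain ⟨t, rfl⟩ := Ideal.Quotient.mk_surjective t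
    rw [← map_mul, Ideal.Quotient.eq_zero_iff_mem] at ht
    have h1 : algebraMap A (Localization.AtPrime P) (t * a) ∈
        maximalIdeal (Localization.AtPrime P) ^ 2 := by
      rw [← Localization.AtPrime.map_eq_maximalIdeal, ← Ideal.map_pow]
      exact Ideal.mem_map_of_mem _ (h ht)
    have ht' : IsUnit (algebraMap A (Localization.AtPrime P) t) :=
      IsLocalization.map_units (Localization.AtPrime P) (⟨t, htx⟩ : P.primeCompl)
    rw [map_mul, Ideal.unit_mul_mem_iff_mem _ ht'] at h1
    rw [IsLocalization.mk'_eq_mul_mk'_one]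
    exact Ideal.mul_mem_right _ _ h1
  · rw [Localization.localRingHom_to_map, Ideal.Quotient.eq_zero_iff_mem.2 hrI, map_zero]

end Regularity

/-! ### Dimension of open subsets of affine space. -/

section AffineSpace

open MvPolynomial

variable {k : Type*} [Field k] {σ : Type*}

/-- Translation of affine space by a vector. -/
noncomputable def translate (a : σ → k) : MvPolynomial σ k ≃ₐ[k] MvPolynomial σ k :=
  AlgEquiv.ofAlgHom (aeval fun i => X i + C (a i)) (aeval fun i => X i - C (a i))
    (by ext; simp) (by ext; simp)

theorem height_vanishingIdeal_eq (a : σ → k) :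
    (vanishingIdeal k {a}).height = (vanishingIdeal k {(0 : σ → k)}).height := by
  rw [← (translate (-a)).toRingEquiv.height_comap]
  congr 1
  ext p
  simp only [Ideal.mem_comap, mem_vanishingIdeal_singleton_iff]
  have : (aeval a).comp (translate (-a) : MvPolynomial σ k →ₐ[k] _) = aeval (0 : σ → k) := by
    ext; simp [translate]
  exact Eq.congr_left (DFunLike.congr_fun this p)

variable [IsAlgClosed k] [Finite σ]

/-- The dimension is the supremum of the heights of maximal ideals; by the Nullstellensatz these are
points, and translations make all their heights equal, so each one attains the supremum. -/
theorem natCard_le_height_vanishingIdeal (a : σ → k) :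
    (Nat.card σ : WithBot ℕ∞) ≤ (vanishingIdeal k {a}).height := by
  have h : ringKrullDim (MvPolynomial σ k) = Nat.card σ := by
    rw [MvPolynomial.ringKrullDim_of_isNoetherianRing, ringKrullDim_eq_zero_of_field, zero_add]
  rw [← h, ringKrullDim_le_iff_isMaximal_height_le]
  intro m hm
  obtain ⟨b, rfl⟩ := (isMaximal_iff_eq_vanishingIdeal_singleton (K := k)).1 hm
  rw [height_vanishingIdeal_eq, height_vanishingIdeal_eq a]

/-- Nonempty basic open subsets of affine space have full dimension. -/
theorem ringKrullDim_away_mvPolynomial {g : MvPolynomial σ k} (hg : g ≠ 0) :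
    ringKrullDim (Localization.Away g) = Nat.card σ := by
  refine le_antisymm ((ringKrullDim_away_le g).trans ?_) ?_
  · rw [MvPolynomial.ringKrullDim_of_isNoetherianRing, ringKrullDim_eq_zero_of_field, zero_add]
  obtain ⟨a, ha⟩ : ∃ a : σ → k, eval a g ≠ 0 := by
    by_contra! h
    exact hg (MvPolynomial.funext fun a => by simpa using h a)
  have hm : (vanishingIdeal k {a}).IsMaximal :=
    (isMaximal_iff_eq_vanishingIdeal_singleton (K := k)).2 ⟨a, rfl⟩
  refine (natCard_le_height_vanishingIdeal a).trans (height_le_ringKrullDim_away ?_)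
  rw [mem_vanishingIdeal_singleton_iff]
  simpa [aeval_eq_eval] using ha

end AffineSpace

/-! ### Formal properties of Pfaffians. -/

section Pfaffians

variable {A : Type*} [CommRing A]

theorem skewMatrix_self (m : PairIndex → A) (i : Fin 5) : skewMatrix m i i = 0 := by
  simp [skewMatrix]

theorem skewMatrix_swap (m : PairIndex → A) (i j : Fin 5) :
    skewMatrix m j i = -skewMatrix m i j := by
  rcases lt_trichotomy i j with hij | rfl | hij
  · simp [skewMatrix, hij, hij.not_gt]
  · simp [skewMatrix]
  · simp [skewMatrix, hij, hij.not_gt]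

theorem skewMatrix_of_lt (m : PairIndex → A) {i j : Fin 5} (h : i < j) :
    skewMatrix m i j = m ⟨(i, j), h⟩ := by
  simp [skewMatrix, h]

theorem map_skewMatrix {B F : Type*} [CommRing B] [FunLike F A B] [RingHomClass F A B] (f : F)
    (m : PairIndex → A) (i j : Fin 5) :
    f (skewMatrix m i j) = skewMatrix (fun k => f (m k)) i j := by
  simp only [skewMatrix, Matrix.of_apply]
  split_ifs <;> simp

theorem map_pfaffian {B F : Type*} [CommRing B] [FunLike F A B] [RingHomClass F A B] (f : F)
    (m : PairIndex → A) (a b c d : Fin 5) :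
    f (pfaffian (skewMatrix m) a b c d) = pfaffian (skewMatrix fun k => f (m k)) a b c d := by
  simp [pfaffian, map_skewMatrix]

theorem pfaffians_map {B F : Type*} [CommRing B] [FunLike F A B] [RingHomClass F A B] (f : F)
    {m : PairIndex → A} (h : ∀ q ∈ pfaffians m, q = 0) :
    ∀ q ∈ pfaffians (fun k => f (m k)), q = 0 := by
  rintro q ⟨a, b, c, d, hab, hbc, hcd, rfl⟩
  rw [← map_pfaffian, h _ ⟨a, b, c, d, hab, hbc, hcd, rfl⟩, map_zero]

/-- Unlike its converse, this half of `pfaffians_vanish_iff` is a polynomial identity and needs no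
field. -/
theorem pfaffians_eq_zero_of_decomposable {m : PairIndex → A} (x y : Fin 5 → A)
    (h : ∀ e : PairIndex, m e = x e.1.1 * y e.1.2 - x e.1.2 * y e.1.1) :
    ∀ q ∈ pfaffians m, q = 0 := by
  rintro q ⟨a, b, c, d, hab, hbc, hcd, rfl⟩
  simp [pfaffian, skewMatrix, h, hab, hbc, hcd, hab.trans hbc, hbc.trans hcd,
    hab.trans (hbc.trans hcd)]
  ring

/-- Exchanging neighbouring indices only changes the sign, so two disjoint increasing pairs can be
sorted. The relation is needed in this form to express `M c d` through entries that involve `a` or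
`b` once `M a b` is invertible. -/
theorem pfaffian_eq_zero_of_pairwise_ne {M : Matrix (Fin 5) (Fin 5) A}
    (hs : ∀ i j, M j i = -M i j)
    (hP : ∀ a b c d : Fin 5, a < b → b < c → c < d → pfaffian M a b c d = 0)
    {a b c d : Fin 5} (hab : a < b) (hac : a ≠ c) (had : a ≠ d) (hbc : b ≠ c) (hbd : b ≠ d)
    (hcd : c < d) : pfaffian M a b c d = 0 := by
  have e1 : ∀ a b c d, pfaffian M b a c d = -pfaffian M a b c d := by
    intro a b c d; simp only [pfaffian]; rw [hs a b]; ring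
  have e2 : ∀ a b c d, pfaffian M a c b d = -pfaffian M a b c d := by
    intro a b c d; simp only [pfaffian]; rw [hs b c]; ring
  have e3 : ∀ a b c d, pfaffian M a b d c = -pfaffian M a b c d := by
    intro a b c d; simp only [pfaffian]; rw [hs c d]; ring
  rcases lt_or_gt_of_ne hbc with h | h
  · exact hP a b c d hab h hcd
  rcases lt_or_gt_of_ne hac with h' | h'
  · rw [e2]
    rcases lt_or_gt_of_ne hbd with h'' | h''
    · rw [hP a c b d h' h h'', neg_zero]
    · rw [e3, hP a c d b h' hcd h'', neg_zero, neg_zero]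
  · rw [e2, e1]
    rcases lt_or_gt_of_ne had with k | k
    · rcases lt_or_gt_of_ne hbd with h'' | h''
      · rw [hP c a b d h' hab h'', neg_zero, neg_zero]
      · rw [e3, hP c a d b h' k h'']; simp
    · rw [e3, e2, hP c d a b hcd k hab]; simp

end Pfaffians

/-! ### Morphisms to the cone and its vertex section. -/

section Lift

variable {k B A : Type*} [CommRing k] [CommRing B] [CommRing A] [Algebra k B] [Algebra k A]

theorem plucker_pfaffians (B : Type*) [CommRing B] : ∀ q ∈ pfaffians (plucker B), q = 0 := by
  rintro q ⟨a, b, c, d, hab, hbc, hcd, rfl⟩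
  have := map_pfaffian (Ideal.Quotient.mk (pfaffianIdeal B)) MvPolynomial.X a b c d
  exact this.symm.trans (Ideal.Quotient.eq_zero_iff_mem.2
    (Ideal.subset_span ⟨a, b, c, d, hab, hbc, hcd, rfl⟩))

/-- The morphism to the cone with given base coordinates and given Plücker coordinates. -/
noncomputable def coneLift (φ : B →ₐ[k] A) (m : PairIndex → A) (h : ∀ q ∈ pfaffians m, q = 0) :
    ConeRing B →ₐ[k] A :=
  Ideal.Quotient.liftₐ (pfaffianIdeal B) (MvPolynomial.aevalTower φ m) (by
    change pfaffianIdeal B ≤ RingHom.ker (MvPolynomial.aevalTower φ m)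
    refine Ideal.span_le.2 ?_
    rintro _ ⟨a, b, c, d, hab, hbc, hcd, rfl⟩
    rw [SetLike.mem_coe, RingHom.mem_ker, map_pfaffian]
    refine h _ ⟨a, b, c, d, hab, hbc, hcd, ?_⟩
    simp)

@[simp]
theorem coneLift_plucker (φ : B →ₐ[k] A) (m : PairIndex → A) (h) (e : PairIndex) :
    coneLift φ m h (plucker B e) = m e := by
  exact MvPolynomial.aevalTower_X φ m e

@[simp]
theorem coneLift_algebraMap (φ : B →ₐ[k] A) (m : PairIndex → A) (h) (b : B) :
    coneLift φ m h (algebraMap B (ConeRing B) b) = φ b := by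
  exact MvPolynomial.aevalTower_C φ m b

theorem coneRing_algHom_ext {φ ψ : ConeRing B →ₐ[k] A}
    (h₁ : ∀ b, φ (algebraMap B (ConeRing B) b) = ψ (algebraMap B (ConeRing B) b))
    (h₂ : ∀ e, φ (plucker B e) = ψ (plucker B e)) : φ = ψ := by
  have : (φ : ConeRing B →+* A) = ψ := Ideal.Quotient.ringHom_ext
    (MvPolynomial.ringHom_ext h₁ h₂)
  exact AlgHom.ext fun a => RingHom.congr_fun this a

/-- The projection of the cone onto its base along the vertex section. -/
noncomputable def coneVertex (B : Type*) [CommRing B] : ConeRing B →ₐ[B] B :=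
  coneLift (AlgHom.id B B) 0 (by
    refine pfaffians_eq_zero_of_decomposable 0 0 ?_
    simp)

theorem coneVertex_surjective (B : Type*) [CommRing B] : Function.Surjective (coneVertex B) :=
  fun b => ⟨algebraMap B _ b, by simp [coneVertex]⟩

/-- Modulo the Plücker coordinates every function agrees with its value at the vertex; this need
only be compared on the base and on each `mᵢⱼ`. -/
theorem ker_coneVertex (B : Type*) [CommRing B] :
    RingHom.ker (coneVertex B) = Ideal.span (Set.range (plucker B)) := by
  refine le_antisymm (fun a ha => ?_) (Ideal.span_le.2 ?_)
  · let J := Ideal.span (Set.range (plucker B))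
    have h : ((Ideal.Quotient.mk J).comp (algebraMap B (ConeRing B))).comp
        (coneVertex B : ConeRing B →+* B) = Ideal.Quotient.mk J := by
      refine Ideal.Quotient.ringHom_ext (MvPolynomial.ringHom_ext (fun b => ?_) fun e => ?_)
      · have := coneLift_algebraMap (AlgHom.id B B) 0
          (pfaffians_eq_zero_of_decomposable 0 0 (by simp)) b
        exact congrArg (fun b => Ideal.Quotient.mk J (algebraMap B (ConeRing B) b)) this
      · have := coneLift_plucker (AlgHom.id B B) 0
          (pfaffians_eq_zero_of_decomposable 0 0 (by simp)) e
        have h0 : Ideal.Quotient.mk J (plucker B e) = 0 :=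
          Ideal.Quotient.eq_zero_iff_mem.2 (Ideal.subset_span ⟨e, rfl⟩)
        refine (congrArg (fun b => Ideal.Quotient.mk J (algebraMap B (ConeRing B) b)) this).trans ?_
        exact (by simp : _ = (0 : ConeRing B ⧸ J)).trans h0.symm
    have h' := RingHom.congr_fun h a
    rw [RingHom.comp_apply] at h'
    refine Ideal.Quotient.eq_zero_iff_mem.1 (h'.symm.trans ?_)
    have ha' : (coneVertex B : ConeRing B →+* B) a = 0 := ha
    rw [ha', map_zero]
  · rintro _ ⟨e, rfl⟩
    simp [coneVertex]

end Lift

/-! ### Irreducibility of the cone. -/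

section Irreducible

/-- The spectrum of the cone is parametrized by pairs of vectors `x, y`. -/
instance irreducibleSpace_coneRing (B : Type*) [CommRing B] [IsDomain B] :
    IrreducibleSpace (PrimeSpectrum (ConeRing B)) := by
  let P := MvPolynomial (Fin 2 × Fin 5) B
  let m : PairIndex → P := fun e => MvPolynomial.X (0, e.1.1) * MvPolynomial.X (1, e.1.2) -
    MvPolynomial.X (0, e.1.2) * MvPolynomial.X (1, e.1.1)
  let φ : ConeRing B →ₐ[B] P := coneLift (Algebra.ofId B P) m
    (pfaffians_eq_zero_of_decomposable (fun i => MvPolynomial.X (0, i))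
      (fun i => MvPolynomial.X (1, i)) fun _ => rfl)
  -- At any point the Plücker coordinates, read in the residue field, form a decomposable bivector.
  -- Its two vectors define a map from `P` to that field, whose kernel is a preimage of the point.
  have hs : Function.Surjective (PrimeSpectrum.comap (φ : ConeRing B →+* P)) := by
    intro x
    have hpf := pfaffians_map (algebraMap (ConeRing B) x.asIdeal.ResidueField)
      (plucker_pfaffians B)
    obtain ⟨y, z, hyz⟩ := (pfaffians_vanish_iff _).1 hpf
    let ψ : P →ₐ[B] x.asIdeal.ResidueField :=
      MvPolynomial.aeval fun i => if i.1 = 0 then y i.2 else z i.2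
    have hy : ∀ i, ψ (MvPolynomial.X (0, i)) = y i := fun i =>
      (MvPolynomial.aeval_X _ _).trans (if_pos rfl)
    have hz : ∀ i, ψ (MvPolynomial.X (1, i)) = z i := fun i =>
      (MvPolynomial.aeval_X _ _).trans (if_neg one_ne_zero)
    have hψ : ψ.comp φ = Algebra.algHom B _ _ := by
      refine coneRing_algHom_ext (fun b => ?_) fun e => ?_
      · simp
      · simp only [AlgHom.comp_apply, φ, coneLift_plucker, m, map_sub, map_mul, hy, hz]
        exact (hyz e).symm
    refine ⟨⟨RingHom.ker ψ, RingHom.ker_isPrime ψ⟩, ?_⟩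
    ext a
    have : ψ (φ a) = algebraMap (ConeRing B) x.asIdeal.ResidueField a := DFunLike.congr_fun hψ a
    simp [this]
  have h := (IrreducibleSpace.isIrreducible_univ (PrimeSpectrum P)).image
    (PrimeSpectrum.comap (φ : ConeRing B →+* P)) (PrimeSpectrum.continuous_comap _).continuousOn
  rw [Set.image_univ, hs.range_eq] at h
  exact { isPreirreducible_univ := h.2, toNonempty := ⟨h.nonempty.some⟩ }

end Irreducible

/-! ### The cone off the vertex as an open piece of affine space. -/

section Charts

/-- The Plücker coordinates that involve one of the two indices of `e`. -/
def Meets (e l : PairIndex) : Prop :=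
  l.1.1 = e.1.1 ∨ l.1.1 = e.1.2 ∨ l.1.2 = e.1.1 ∨ l.1.2 = e.1.2

instance (e : PairIndex) : DecidablePred (Meets e) := fun l => by
  unfold Meets; infer_instance

theorem meets_self (e : PairIndex) : Meets e e := Or.inl rfl

theorem natCard_meets (e : PairIndex) : Nat.card {l // Meets e l} = 7 := by
  rw [Nat.card_eq_fintype_card]
  revert e
  decide

variable {A : Type*} [CommRing A] {e : PairIndex}

/-- Extension by zero. -/
def extendMeets (m : {l // Meets e l} → A) : PairIndex → A :=
  fun l => if h : Meets e l then m ⟨l, h⟩ else 0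

/-- The Plücker coordinates on the chart where the `e`-th one has inverse `j`. -/
def chartPlucker (m : {l // Meets e l} → A) (j : A) : PairIndex → A := fun l =>
  j * (skewMatrix (extendMeets m) e.1.1 l.1.1 * skewMatrix (extendMeets m) e.1.2 l.1.2 -
    skewMatrix (extendMeets m) e.1.1 l.1.2 * skewMatrix (extendMeets m) e.1.2 l.1.1)

theorem chartPlucker_pfaffians (m : {l // Meets e l} → A) (j : A) :
    ∀ q ∈ pfaffians (chartPlucker m j), q = 0 :=
  pfaffians_eq_zero_of_decomposable (fun i => j * skewMatrix (extendMeets m) e.1.1 i)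
    (fun i => skewMatrix (extendMeets m) e.1.2 i) fun l => by simp only [chartPlucker]; ring

/-- If `l` shares an index with `e`, one of the two products contains a diagonal entry, and the
other is the product of the `e`-th and `l`-th entries up to sign, from which `j` cancels the `e`-th.
-/
theorem chartPlucker_of_meets (m : {l // Meets e l} → A) {j : A}
    (hj : m ⟨e, meets_self e⟩ * j = 1) (l : {l // Meets e l}) : chartPlucker m j l = m l := by
  obtain ⟨⟨⟨a, b⟩, hab⟩, rfl⟩ : ∃ e', e' = e := ⟨e, rfl⟩
  obtain ⟨⟨⟨c, d⟩, hcd⟩, hl⟩ := l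
  have hM : skewMatrix (extendMeets m) a b = m ⟨_, meets_self _⟩ := by
    rw [skewMatrix_of_lt _ hab, extendMeets, dif_pos]
  have hN : skewMatrix (extendMeets m) c d = m ⟨_, hl⟩ := by
    rw [skewMatrix_of_lt _ hcd, extendMeets, dif_pos]
  rw [← hM] at hj
  rw [← hN]
  simp only [chartPlucker]
  rcases hl with h | h | h | h <;> simp only at h <;> subst h
  · rw [skewMatrix_self, skewMatrix_swap _ c b]
    linear_combination skewMatrix (extendMeets m) c d * hj
  · rw [skewMatrix_self]
    linear_combination skewMatrix (extendMeets m) c d * hj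
  · rw [skewMatrix_self, skewMatrix_swap _ c d, skewMatrix_swap _ d b]
    linear_combination skewMatrix (extendMeets m) c d * hj
  · rw [skewMatrix_self, skewMatrix_swap _ c d]
    linear_combination skewMatrix (extendMeets m) c d * hj

/-- For a pair disjoint from `e` this is the Plücker relation on the four indices, divided by the
`e`-th coordinate. -/
theorem chartPlucker_restrict {m : PairIndex → A} (h : ∀ q ∈ pfaffians m, q = 0) {j : A}
    (hj : m e * j = 1) (l : PairIndex) :
    chartPlucker (e := e) (fun l => m l.1) j l = m l := by
  by_cases hl : Meets e l
  · exact chartPlucker_of_meets (fun l => m l.1) hj ⟨l, hl⟩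
  obtain ⟨⟨a, b⟩, hab⟩ := e
  obtain ⟨⟨c, d⟩, hcd⟩ := l
  have hM : ∀ x y : Fin 5, x = a ∨ x = b →
      skewMatrix (extendMeets (e := ⟨(a, b), hab⟩) fun l => m l.1) x y = skewMatrix m x y := by
    intro x y hx
    rcases lt_trichotomy x y with h | rfl | h
    · rw [skewMatrix_of_lt _ h, skewMatrix_of_lt _ h, extendMeets, dif_pos]
      exact hx.elim Or.inl fun h => Or.inr (Or.inl h)
    · rw [skewMatrix_self, skewMatrix_self]
    · rw [skewMatrix_swap _ y x, skewMatrix_swap _ y x, skewMatrix_of_lt _ h,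
        skewMatrix_of_lt _ h, extendMeets, dif_pos]
      exact hx.elim (fun h => Or.inr (Or.inr (Or.inl h))) fun h => Or.inr (Or.inr (Or.inr h))
  simp only [Meets, not_or] at hl
  have hp := pfaffian_eq_zero_of_pairwise_ne (skewMatrix_swap m)
    (fun a b c d h1 h2 h3 => h _ ⟨a, b, c, d, h1, h2, h3, rfl⟩) hab (Ne.symm hl.1)
    (Ne.symm hl.2.2.1) (Ne.symm hl.2.1) (Ne.symm hl.2.2.2) hcd
  simp only [chartPlucker]
  rw [hM _ _ (Or.inl rfl), hM _ _ (Or.inl rfl), hM _ _ (Or.inr rfl), hM _ _ (Or.inr rfl)]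
  rw [← skewMatrix_of_lt m hab] at hj
  rw [← skewMatrix_of_lt m hcd]
  simp only [pfaffian] at hp
  linear_combination -j * hp + skewMatrix m c d * hj

theorem map_chartPlucker {B F : Type*} [CommRing B] [FunLike F A B] [RingHomClass F A B] (f : F)
    (m : {l // Meets e l} → A) (j : A) (l : PairIndex) :
    f (chartPlucker m j l) = chartPlucker (fun l => f (m l)) (f j) l := by
  have : (fun k => f (extendMeets m k)) = extendMeets fun l => f (m l) := by
    funext k
    simp only [extendMeets]
    split_ifs <;> simp
  simp [chartPlucker, map_skewMatrix, this]

/-- The open subscheme of the cone where the `e`-th Plücker coordinate does not vanish is an open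
subscheme of affine space. -/
noncomputable def coneChart (B : Type*) [CommRing B] (e : PairIndex) :
    Localization.Away (plucker B e) ≃ₐ[B]
      Localization.Away (MvPolynomial.X ⟨e, meets_self e⟩ : MvPolynomial {l // Meets e l} B) :=
  let g : MvPolynomial {l // Meets e l} B := MvPolynomial.X ⟨e, meets_self e⟩
  let j : Localization.Away g := IsLocalization.Away.invSelf g
  let m : {l // Meets e l} → Localization.Away g := fun l => algebraMap _ _ (MvPolynomial.X l)
  have hj : m ⟨e, meets_self e⟩ * j = 1 := IsLocalization.Away.mul_invSelf g
  awayEquiv (coneLift (Algebra.ofId B _) (chartPlucker m j) (chartPlucker_pfaffians m j))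
    (MvPolynomial.aeval fun l => algebraMap _ _ (plucker B l.1))
    (by
      rw [coneLift_plucker, chartPlucker_of_meets m hj ⟨e, meets_self e⟩]
      exact IsLocalization.Away.algebraMap_isUnit g)
    (by
      rw [MvPolynomial.aeval_X]
      exact IsLocalization.Away.algebraMap_isUnit _)
    (fun χ hχ a => by
      have hm : ∀ l, χ (m l) = algebraMap _ _ (plucker B l.1) := fun l => by
        rw [hχ, MvPolynomial.aeval_X]
      have : (χ.comp (coneLift (Algebra.ofId B _) (chartPlucker m j)
          (chartPlucker_pfaffians m j))) = Algebra.algHom B _ _ := by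
        refine coneRing_algHom_ext (fun b => by simp) fun l => ?_
        rw [AlgHom.comp_apply, coneLift_plucker, map_chartPlucker, funext hm]
        refine chartPlucker_restrict (pfaffians_map _ (plucker_pfaffians B)) ?_ l
        rw [← hm ⟨e, meets_self e⟩, ← map_mul, hj, map_one]
      exact DFunLike.congr_fun this a)
    (fun χ hχ b => by
      have : (χ.comp (MvPolynomial.aeval fun l : {l // Meets e l} =>
          algebraMap (ConeRing B) _ (plucker B l.1))) = Algebra.algHom B _ _ := by
        refine MvPolynomial.algHom_ext fun l => ?_
        rw [AlgHom.comp_apply, MvPolynomial.aeval_X, hχ, coneLift_plucker,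
          chartPlucker_of_meets m hj]
        rfl
      exact DFunLike.congr_fun this b)

end Charts

/-! ### Singular locus and dimension of the cone. -/

section ConeGeometry

open PrimeSpectrum

variable (B : Type*) [CommRing B]

/-- Pfaffians are quadratic in the entries; this is what makes the vertices singular. -/
theorem pfaffianIdeal_le_sq {P : Ideal (MvPolynomial PairIndex B)}
    (h : ∀ e, (MvPolynomial.X e : MvPolynomial PairIndex B) ∈ P) : pfaffianIdeal B ≤ P ^ 2 := by
  have hM : ∀ i j, skewMatrix (MvPolynomial.X : PairIndex → MvPolynomial PairIndex B) i j ∈ P := by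
    intro i j
    simp only [skewMatrix, Matrix.of_apply]
    split_ifs
    exacts [h _, P.neg_mem (h _), P.zero_mem]
  refine Ideal.span_le.2 ?_
  rintro _ ⟨a, b, c, d, -, -, -, rfl⟩
  rw [sq]
  exact Ideal.add_mem _ (Ideal.sub_mem _ (Ideal.mul_mem_mul (hM _ _) (hM _ _))
    (Ideal.mul_mem_mul (hM _ _) (hM _ _))) (Ideal.mul_mem_mul (hM _ _) (hM _ _))

theorem pfaffian_X_ne_zero [Nontrivial B] :
    pfaffian (skewMatrix (MvPolynomial.X : PairIndex → MvPolynomial PairIndex B)) 0 1 2 3 ≠ 0 := by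
  intro h
  -- At `m₀₁ = m₂₃ = 1`, with all other coordinates zero, the Pfaffian has the value `1`.
  have h' := congrArg (MvPolynomial.eval fun e : PairIndex =>
    if e.1 = (0, 1) ∨ e.1 = (2, 3) then (1 : B) else 0) h
  rw [map_pfaffian] at h'
  simp [pfaffian, skewMatrix] at h'

/-- The cone over `G(2, 5)` with regular base is singular exactly along its vertices. -/
theorem singularLocus_coneRing [IsDomain B] [IsRegularRing B] :
    singularLocus (ConeRing B) = zeroLocus (Set.range (plucker B)) := by
  ext x
  constructor
  · rintro hx _ ⟨e, rfl⟩
    by_contra hne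
    obtain ⟨z, rfl⟩ := exists_comap_away_eq hne
    rw [← mem_singularLocus_away] at hx
    obtain ⟨y, rfl⟩ := (comapEquiv (coneChart B e).toRingEquiv).symm.surjective z
    have h := (mem_singularLocus_away y).1
      ((mem_singularLocus_ringEquiv (coneChart B e).toRingEquiv y).1 hx)
    rw [singularLocus_eq_empty] at h
    exact h
  · intro hx
    exact not_isRegularLocalRing_quotient (I := pfaffianIdeal B) (pfaffian_X_ne_zero B)
      (Ideal.subset_span ⟨0, 1, 2, 3, by decide, by decide, by decide, rfl⟩) x.asIdeal
      (pfaffianIdeal_le_sq B fun e => hx ⟨e, rfl⟩)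

/-- Seven linear forms that cut out the vertex. -/
def vertexForms : Set (ConeRing B) :=
  let m := skewMatrix (plucker B)
  {m 0 1, m 0 2, m 0 3 + m 1 2, m 0 4 + m 1 3, m 1 4 + m 2 3, m 2 4, m 3 4}

/-- The forms are the sums of the `mᵢⱼ` with `i + j` fixed. Where they vanish, the Pfaffians on
`0123`, `0134`, `1234` become successively `-m₀₃²`, `-m₀₄²`, `-m₁₄²`. -/
theorem zeroLocus_vertexForms :
    zeroLocus (vertexForms B) = zeroLocus (Set.range (plucker B)) := by
  refine Set.Subset.antisymm (fun x hx => ?_) (fun x hx => ?_)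
  · let K := x.asIdeal.ResidueField
    let ι := algebraMap (ConeRing B) K
    have hι : ∀ a, a ∈ x.asIdeal ↔ ι a = 0 := fun a =>
      Ideal.algebraMap_residueField_eq_zero.symm
    have hpf := pfaffians_map ι (plucker_pfaffians B)
    let M := skewMatrix fun e => ι (plucker B e)
    have hM : ∀ i j, ι (skewMatrix (plucker B) i j) = M i j := map_skewMatrix ι _
    have hP : ∀ a b c d, a < b → b < c → c < d →
        M a b * M c d - M a c * M b d + M a d * M b c = 0 :=
      fun a b c d h1 h2 h3 => hpf _ ⟨a, b, c, d, h1, h2, h3, rfl⟩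
    have hf : ∀ f ∈ vertexForms B, ι f = 0 := fun f hf => (hι f).1 (hx hf)
    simp only [vertexForms, Set.mem_insert_iff, Set.mem_singleton_iff, forall_eq_or_imp, forall_eq,
      map_add, hM] at hf
    obtain ⟨h01, h02, h03, h04, h14, h24, h34⟩ := hf
    have e03 : M 0 3 = 0 := by
      rw [← sq_eq_zero_iff]
      linear_combination -hP 0 1 2 3 (by decide) (by decide) (by decide) + M 2 3 * h01 -
        M 1 3 * h02 + M 0 3 * h03
    have e12 : M 1 2 = 0 := by linear_combination h03 - e03
    have e04 : M 0 4 = 0 := by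
      rw [← sq_eq_zero_iff]
      linear_combination -hP 0 1 3 4 (by decide) (by decide) (by decide) + M 3 4 * h01 -
        M 1 4 * e03 + M 0 4 * h04
    have e13 : M 1 3 = 0 := by linear_combination h04 - e04
    have e14 : M 1 4 = 0 := by
      rw [← sq_eq_zero_iff]
      linear_combination -hP 1 2 3 4 (by decide) (by decide) (by decide) + M 3 4 * e12 -
        M 2 4 * e13 + M 1 4 * h14
    have e23 : M 2 3 = 0 := by linear_combination h14 - e14
    rintro _ ⟨⟨⟨i, j⟩, hij⟩, rfl⟩
    rw [SetLike.mem_coe, hι, ← skewMatrix_of_lt (plucker B) hij, hM]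
    have hij' : i < j := hij
    fin_cases i <;> fin_cases j <;> first | exact absurd hij' (by decide) | assumption
  · have hM : ∀ i j, skewMatrix (plucker B) i j ∈ x.asIdeal := by
      intro i j
      simp only [skewMatrix, Matrix.of_apply]
      split_ifs
      exacts [hx ⟨_, rfl⟩, x.asIdeal.neg_mem (hx ⟨_, rfl⟩), x.asIdeal.zero_mem]
    intro f hf
    simp only [vertexForms, Set.mem_insert_iff, Set.mem_singleton_iff] at hf
    rcases hf with rfl | rfl | rfl | rfl | rfl | rfl | rfl
    exacts [hM _ _, hM _ _, add_mem (hM _ _) (hM _ _), add_mem (hM _ _) (hM _ _),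
      add_mem (hM _ _) (hM _ _), hM _ _, hM _ _]

theorem encard_vertexForms_le : (vertexForms B).encard ≤ 7 := by
  refine (Set.encard_insert_le _ _).trans ?_
  refine (add_le_add_left (Set.encard_insert_le _ _) 1).trans ?_
  refine (add_le_add_left (add_le_add_left (Set.encard_insert_le _ _) 1) 1).trans ?_
  refine (add_le_add_left (add_le_add_left (add_le_add_left (Set.encard_insert_le _ _) 1) 1)
    1).trans ?_
  refine (add_le_add_left (add_le_add_left (add_le_add_left (add_le_add_left
    (Set.encard_insert_le _ _) 1) 1) 1) 1).trans ?_
  refine (add_le_add_left (add_le_add_left (add_le_add_left (add_le_add_left (add_le_add_left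
    (Set.encard_insert_le _ _) 1) 1) 1) 1) 1).trans ?_
  rw [Set.encard_singleton]
  norm_num

theorem zeroLocus_range_plucker :
    zeroLocus (Set.range (plucker B)) =
      Set.range (comap (coneVertex B : ConeRing B →+* B)) := by
  rw [← zeroLocus_span (Set.range (plucker B)), ← ker_coneVertex]
  exact (range_comap_of_surjective _ _ (coneVertex_surjective B)).symm

/-- The dimension of a quotient depends only on the zero locus of the ideal, so the forms may be
replaced by the kernel of the vertex section. -/
theorem ringKrullDim_quotient_vertexForms :
    ringKrullDim (ConeRing B ⧸ Ideal.span (vertexForms B)) = ringKrullDim B := by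
  rw [ringKrullDim_quotient, zeroLocus_span, zeroLocus_vertexForms, ← zeroLocus_span,
    ← ker_coneVertex, ← ringKrullDim_quotient]
  exact ringKrullDim_eq_of_ringEquiv
    (Ideal.quotientKerAlgEquivOfSurjective (coneVertex_surjective B)).toRingEquiv

/-- The cone over `G(2, 5)` has relative dimension at most seven. -/
theorem ringKrullDim_coneRing_le [IsNoetherianRing B] :
    ringKrullDim (ConeRing B) ≤ ringKrullDim B + 7 := by
  rw [ringKrullDim_le_iff_height_le]
  intro q hq
  by_cases h : ∀ e, plucker B e ∈ q
  -- At a vertex, Krull's height theorem for the seven forms bounds the height; off the vertices the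
  -- affine charts do.
  · refine (Ideal.height_le_ringKrullDim_quotient_add_encard (vertexForms B) ?_).trans ?_
    · have hx : (⟨q, hq⟩ : PrimeSpectrum (ConeRing B)) ∈ zeroLocus (vertexForms B) := by
        rw [zeroLocus_vertexForms]
        rintro _ ⟨e, rfl⟩
        exact h e
      exact hx
    · rw [ringKrullDim_quotient_vertexForms]
      gcongr
      exact WithBot.coe_le_coe.2 (encard_vertexForms_le B)
  · push Not at h
    obtain ⟨e, he⟩ := h
    refine (height_le_ringKrullDim_away he).trans ?_
    rw [ringKrullDim_eq_of_ringEquiv (coneChart B e).toRingEquiv]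
    refine (ringKrullDim_away_le _).trans ?_
    rw [MvPolynomial.ringKrullDim_of_isNoetherianRing, natCard_meets]
    rfl

end ConeGeometry

/-! ### Symmetries of the nine equations. -/

section Equations

open Coord

variable {A : Type*} [CommRing A]

theorem equations_eq_zero_of {v : Coord → A} (h0 : equations v 0 = 0) (h1 : equations v 1 = 0)
    (h2 : equations v 2 = 0) (h3 : equations v 3 = 0) (h4 : equations v 4 = 0)
    (h5 : equations v 5 = 0) (h6 : equations v 6 = 0) (h7 : equations v 7 = 0)
    (h8 : equations v 8 = 0) : equations v = 0 := by
  funext i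
  fin_cases i <;> assumption

theorem map_equations {B F : Type*} [CommRing B] [FunLike F A B] [RingHomClass F A B] (f : F)
    (v : Coord → A) (i : Fin 9) : f (equations v i) = equations (fun c => f (v c)) i := by
  have h2 : f 2 = 2 := map_ofNat f 2
  fin_cases i <;> simp [equations, h2]

theorem equations_map {B F : Type*} [CommRing B] [FunLike F A B] [RingHomClass F A B] (f : F)
    {v : Coord → A} (h : equations v = 0) : equations (fun c => f (v c)) = 0 := by
  funext i
  rw [← map_equations, h, Pi.zero_apply, map_zero, Pi.zero_apply]

/-- Exchange of the vectors `(p₁, p₂, u₁)` and `(p₃, p₄, u₂)`. -/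
def swap (v : Coord → A) : Coord → A
  | p1 => v p3 | p2 => v p4 | p3 => v p1 | p4 => v p2 | u1 => v u2 | u2 => v u1
  | s1 => v s1 | s2 => v s2 | s3 => v s3 | t1 => v t1 | t2 => v t2
  | t123 => v t124 | t124 => v t123 | t125 => v t126 | t126 => v t125
  | t135 => -v t246 | t136 => -v t245 | t245 => -v t136 | t246 => -v t135

/-- Addition of `r` times `(p₃, p₄, u₂)` to `(p₁, p₂, u₁)`. -/
def shear (r : A) (v : Coord → A) : Coord → A
  | p1 => v p1 + r * v p3 | p2 => v p2 + r * v p4 | p3 => v p3 | p4 => v p4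
  | u1 => v u1 + r * v u2 | u2 => v u2
  | s1 => v s1 | s2 => v s2 | s3 => v s3 | t1 => v t1 | t2 => v t2
  | t123 => v t123 | t124 => v t124 - r * v t123 | t125 => v t125 | t126 => v t126 - r * v t125
  | t135 => v t135 | t136 => v t136 - r * v t135
  | t245 => v t245 - 2 * r * v t136 + r ^ 2 * v t135
  | t246 => v t246 - 3 * r * v t245 + 3 * r ^ 2 * v t136 - r ^ 3 * v t135

/-- Multiplication of the nine fiber coordinates by `r`. -/
def scale (r : A) (v : Coord → A) : Coord → A
  | p1 => r * v p1 | p2 => r * v p2 | p3 => r * v p3 | p4 => r * v p4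
  | u1 => r * v u1 | u2 => r * v u2 | s1 => r * v s1 | s2 => r * v s2 | s3 => r * v s3
  | t1 => v t1 | t2 => v t2 | t123 => v t123 | t124 => v t124 | t125 => v t125 | t126 => v t126
  | t135 => v t135 | t136 => v t136 | t245 => v t245 | t246 => v t246

/-- With `u₁ - p₁ e - p₂ e²` and `u₂ - p₃ e - p₄ e²` regarded as elements of the cubic algebra
defined by `e³ + t₁ e - t₂`, addition of `3 r e` times the first one to the second one. -/
def twistedShear (r : A) (v : Coord → A) : Coord → A
  | p1 => v p1 | p2 => v p2
  | p3 => v p3 - 3 * r * (v t1 * v p2 + v u1) | p4 => v p4 + 3 * r * v p1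
  | u1 => v u1 | u2 => v u2 - 3 * r * v t2 * v p2
  | s1 => v s1 + r * (v t126 * v p2 - 6 * v t245 * v p1 - 6 * v t246 * v p3)
      + r ^ 2 * v t246 * (6 * v t1 * v p2 + 9 * v u1)
  | s2 => v s2 + r * (3 * v t124 * v p2 - 2 * v t126 * v p1 - 3 * v t245 * v u1
      - 3 * v t246 * v u2) + r ^ 2 * v t246 * (6 * v t1 * v p1 - 9 * v t2 * v p2)
  | s3 => v s3 - r * (3 * v t124 * v p1 + v t126 * (2 * v t1 * v p2 + v u1)
      - 3 * v t2 * (v t245 * v p2 + v t246 * v p4))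
      + r ^ 2 * v t246 * (18 * v t2 * v p1 + 6 * v t1 ^ 2 * v p2 + 3 * v t1 * v u1)
  | t1 => v t1 | t2 => v t2
  | t123 => v t123 + r * (2 * v t1 * v t126 - 9 * v t2 * v t245) - 6 * r ^ 2 * v t1 ^ 2 * v t246
  | t124 => v t124 - 9 * r * v t2 * v t246
  | t125 => v t125 - 6 * r * (v t1 * v t245 + v t124) + 27 * r ^ 2 * v t2 * v t246
  | t126 => v t126 - 6 * r * v t1 * v t246
  | t135 => v t135 - 3 * r * v t125 + 9 * r ^ 2 * (v t1 * v t245 + v t124)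
      - 27 * r ^ 3 * v t2 * v t246
  | t136 => v t136 - r * v t126 + 3 * r ^ 2 * v t1 * v t246
  | t245 => v t245 | t246 => v t246

theorem swap_swap (v : Coord → A) : swap (swap v) = v := by
  funext c; cases c <;> simp [swap]

theorem shear_neg_shear (r : A) (v : Coord → A) : shear (-r) (shear r v) = v := by
  funext c; cases c <;> simp only [shear] <;> ring

theorem shear_shear_neg (r : A) (v : Coord → A) : shear r (shear (-r) v) = v := by
  funext c; cases c <;> simp only [shear] <;> ring

theorem scale_scale {r r' : A} (h : r * r' = 1) (v : Coord → A) : scale r (scale r' v) = v := by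
  funext c; cases c <;> simp only [scale, ← mul_assoc, h, one_mul]

theorem twistedShear_neg (r : A) (v : Coord → A) :
    twistedShear (-r) (twistedShear r v) = v := by
  funext c; cases c <;> simp only [twistedShear] <;> ring

/-- The pairs `F₁, F₂`, `F₃, F₄`, `F₅, F₆` are exchanged, and `F₇, F₈, F₉` are invariant. -/
theorem equations_swap {v : Coord → A} (h : equations v = 0) : equations (swap v) = 0 := by
  have e := fun i => congrFun h i
  apply equations_eq_zero_of
  · have := e 1; simp only [equations, swap, Matrix.cons_val, Pi.zero_apply] at this ⊢
    linear_combination this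
  · have := e 0; simp only [equations, swap, Matrix.cons_val, Pi.zero_apply] at this ⊢
    linear_combination this
  · have := e 3; simp only [equations, swap, Matrix.cons_val, Pi.zero_apply] at this ⊢
    linear_combination this
  · have := e 2; simp only [equations, swap, Matrix.cons_val, Pi.zero_apply] at this ⊢
    linear_combination this
  · have := e 5; simp only [equations, swap, Matrix.cons_val, Pi.zero_apply] at this ⊢
    linear_combination this
  · have := e 4; simp only [equations, swap, Matrix.cons_val, Pi.zero_apply] at this ⊢
    linear_combination this
  · have := e 6; simp only [equations, swap, Matrix.cons_val, Pi.zero_apply] at this ⊢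
    linear_combination this
  · have := e 7; simp only [equations, swap, Matrix.cons_val, Pi.zero_apply] at this ⊢
    linear_combination this
  · have := e 8; simp only [equations, swap, Matrix.cons_val, Pi.zero_apply] at this ⊢
    linear_combination this

/-- `F₁, F₃, F₅` gain `r` times `F₂, F₄, F₆`, just as `p₁, p₂, u₁` gain multiples of `p₃, p₄, u₂`;
the other equations are invariant. -/
theorem equations_shear (r : A) {v : Coord → A} (h : equations v = 0) :
    equations (shear r v) = 0 := by
  have e0 := congrFun h 0
  have e1 := congrFun h 1
  have e2 := congrFun h 2
  have e3 := congrFun h 3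
  have e4 := congrFun h 4
  have e5 := congrFun h 5
  have e6 := congrFun h 6
  have e7 := congrFun h 7
  have e8 := congrFun h 8
  simp only [equations, Matrix.cons_val, Pi.zero_apply] at e0 e1 e2 e3 e4 e5 e6 e7 e8
  apply equations_eq_zero_of <;> simp only [equations, shear, Matrix.cons_val]
  · linear_combination e0 + r * e1
  · linear_combination e1
  · linear_combination e2 + r * e3
  · linear_combination e3
  · linear_combination e4 + r * e5
  · linear_combination e5
  · linear_combination e6
  · linear_combination e7
  · linear_combination e8

/-- Every `Fᵢ` is homogeneous of degree two in the nine fiber coordinates. -/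
theorem equations_scale (r : A) {v : Coord → A} (h : equations v = 0) :
    equations (scale r v) = 0 := by
  have e0 := congrFun h 0
  have e1 := congrFun h 1
  have e2 := congrFun h 2
  have e3 := congrFun h 3
  have e4 := congrFun h 4
  have e5 := congrFun h 5
  have e6 := congrFun h 6
  have e7 := congrFun h 7
  have e8 := congrFun h 8
  simp only [equations, Matrix.cons_val, Pi.zero_apply] at e0 e1 e2 e3 e4 e5 e6 e7 e8
  apply equations_eq_zero_of <;> simp only [equations, scale, Matrix.cons_val]
  · linear_combination r ^ 2 * e0
  · linear_combination r ^ 2 * e1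
  · linear_combination r ^ 2 * e2
  · linear_combination r ^ 2 * e3
  · linear_combination r ^ 2 * e4
  · linear_combination r ^ 2 * e5
  · linear_combination r ^ 2 * e6
  · linear_combination r ^ 2 * e7
  · linear_combination r ^ 2 * e8

/-- `F₁, F₃, F₅` are fixed, and `F₂, F₄, F₆` gain `3r` times `F₃, F₅, t₂F₁ - t₁F₃`, the effect of
multiplication by `e` on `1, e, e²`. The last three gain combinations of the first six. -/
theorem equations_twistedShear (r : A) {v : Coord → A} (h : equations v = 0) :
    equations (twistedShear r v) = 0 := by
  have e0 := congrFun h 0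
  have e1 := congrFun h 1
  have e2 := congrFun h 2
  have e3 := congrFun h 3
  have e4 := congrFun h 4
  have e5 := congrFun h 5
  have e6 := congrFun h 6
  have e7 := congrFun h 7
  have e8 := congrFun h 8
  simp only [equations, Matrix.cons_val, Pi.zero_apply] at e0 e1 e2 e3 e4 e5 e6 e7 e8
  apply equations_eq_zero_of <;> simp only [equations, twistedShear, Matrix.cons_val]
  · linear_combination e0
  · linear_combination e1 + 3 * r * e2
  · linear_combination e2
  · linear_combination e3 + 3 * r * e4
  · linear_combination e4
  · linear_combination e5 + 3 * v t2 * r * e0 - 3 * v t1 * r * e2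
  · linear_combination e6 + (3 * v t1 * v t246 * r ^ 2 - v t126 * r) * e0 + 6 * v t245 * r * e2 +
      6 * v t246 * r * e3 + 9 * v t246 * r ^ 2 * e4
  · linear_combination e7 + (-3 * v t1 * v t245 * r + 9 * v t2 * v t246 * r ^ 2 -
      3 * v t124 * r) * e0 - 3 * v t1 * v t246 * r * e1 + (-6 * v t1 * v t246 * r ^ 2 +
      2 * v t126 * r) * e2 - 3 * v t245 * r * e4 - 3 * v t246 * r * e5
  · linear_combination e8 + (-6 * v t1 ^ 2 * v t246 * r ^ 2 + 2 * v t1 * v t126 * r -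
      6 * v t2 * v t245 * r) * e0 - 6 * v t2 * v t246 * r * e1 + (-36 * v t2 * v t246 * r ^ 2 +
      6 * v t124 * r) * e2 + (6 * v t1 * v t246 * r ^ 2 - 2 * v t126 * r) * e4

end Equations

/-! ### The slice `p₂ = 0`, `p₄ = 1` as a product of the cone and an affine space. -/

section Slice

open Coord

theorem pairIndex_funext {A : Type*} {f g : PairIndex → A}
    (h01 : f ⟨(0, 1), by decide⟩ = g ⟨(0, 1), by decide⟩)
    (h02 : f ⟨(0, 2), by decide⟩ = g ⟨(0, 2), by decide⟩)
    (h03 : f ⟨(0, 3), by decide⟩ = g ⟨(0, 3), by decide⟩)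
    (h04 : f ⟨(0, 4), by decide⟩ = g ⟨(0, 4), by decide⟩)
    (h12 : f ⟨(1, 2), by decide⟩ = g ⟨(1, 2), by decide⟩)
    (h13 : f ⟨(1, 3), by decide⟩ = g ⟨(1, 3), by decide⟩)
    (h14 : f ⟨(1, 4), by decide⟩ = g ⟨(1, 4), by decide⟩)
    (h23 : f ⟨(2, 3), by decide⟩ = g ⟨(2, 3), by decide⟩)
    (h24 : f ⟨(2, 4), by decide⟩ = g ⟨(2, 4), by decide⟩)
    (h34 : f ⟨(3, 4), by decide⟩ = g ⟨(3, 4), by decide⟩) : f = g := by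
  funext e
  obtain ⟨⟨i, j⟩, hij⟩ := e
  have hij' : i < j := hij
  fin_cases i <;> fin_cases j <;> first | exact absurd hij' (by decide) | assumption

variable {A : Type*} [CommRing A]

theorem pfaffians_eq_zero_iff (m : PairIndex → A) : (∀ q ∈ pfaffians m, q = 0) ↔
    pfaffian (skewMatrix m) 0 1 2 3 = 0 ∧ pfaffian (skewMatrix m) 0 1 2 4 = 0 ∧
    pfaffian (skewMatrix m) 0 1 3 4 = 0 ∧ pfaffian (skewMatrix m) 0 2 3 4 = 0 ∧
    pfaffian (skewMatrix m) 1 2 3 4 = 0 := by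
  constructor
  · intro h
    exact ⟨h _ ⟨0, 1, 2, 3, by decide, by decide, by decide, rfl⟩,
      h _ ⟨0, 1, 2, 4, by decide, by decide, by decide, rfl⟩,
      h _ ⟨0, 1, 3, 4, by decide, by decide, by decide, rfl⟩,
      h _ ⟨0, 2, 3, 4, by decide, by decide, by decide, rfl⟩,
      h _ ⟨1, 2, 3, 4, by decide, by decide, by decide, rfl⟩⟩
  · rintro ⟨h1, h2, h3, h4, h5⟩ q ⟨a, b, c, d, hab, hbc, hcd, rfl⟩
    have key : ∀ d c b a : Fin 5, c < d → b < c → a < b →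
        (a = 0 ∧ b = 1 ∧ c = 2 ∧ d = 3) ∨ (a = 0 ∧ b = 1 ∧ c = 2 ∧ d = 4) ∨
        (a = 0 ∧ b = 1 ∧ c = 3 ∧ d = 4) ∨ (a = 0 ∧ b = 2 ∧ c = 3 ∧ d = 4) ∨
        (a = 1 ∧ b = 2 ∧ c = 3 ∧ d = 4) := by omega
    rcases key d c b a hcd hbc hab with ⟨rfl, rfl, rfl, rfl⟩ | ⟨rfl, rfl, rfl, rfl⟩ |
      ⟨rfl, rfl, rfl, rfl⟩ | ⟨rfl, rfl, rfl, rfl⟩ | ⟨rfl, rfl, rfl, rfl⟩ <;> assumption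

/-- The Plücker coordinates on the slice `p₂ = 0`, `p₄ = 1`. -/
def slicePlucker (v : Coord → A) (e : PairIndex) : A :=
  let d := v p3 ^ 2 + v t1 + v u2
  !![0, v u1, v p1, -d, -v t2 - v p3 * v u2;
    0, 0, v t246, v s2 + v t126 + v t136 * v p1 + 2 * v t245 * v p3,
      v s3 + v t124 + v t245 * v u2;
    0, 0, 0, v s1 - v t245, v s2 - v t136 * v p1 - v t245 * v p3;
    0, 0, 0, 0, v t123 + v t135 * (v u1 - v p3 * v p1) + v t136 * (v u2 - 2 * v p3 ^ 2 + d)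
      - v p3 * v t125;
    0, 0, 0, 0, 0] e.1.1 e.1.2

/-- The point of the slice `p₂ = 0`, `p₄ = 1` with given base coordinates `b` and Plücker
coordinates `m`. -/
def slicePoint (b : Coord → A) (m : PairIndex → A) : Coord → A :=
  let p := m ⟨(0, 2), by decide⟩
  let w := m ⟨(0, 1), by decide⟩
  let d := -m ⟨(0, 3), by decide⟩
  let u := d - b p3 ^ 2 - b t1
  let x := m ⟨(2, 3), by decide⟩ + b t245
  let y := m ⟨(2, 4), by decide⟩ + b t136 * p + b t245 * b p3
  let z := u * x - b p3 * y + b t125 * p + b t135 * p ^ 2 + b t136 * (2 * p * b p3 + w) + b t245 * d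
  fun
  | p1 => p | p2 => 0 | p3 => b p3 | p4 => 1 | u1 => w | u2 => u
  | s1 => x | s2 => y | s3 => z
  | t1 => b t1 | t2 => -m ⟨(0, 4), by decide⟩ - b p3 * u
  | t123 => m ⟨(3, 4), by decide⟩ - b t135 * (w - b p3 * p) - b t136 * (u - 2 * b p3 ^ 2 + d)
      + b p3 * b t125
  | t124 => m ⟨(1, 4), by decide⟩ - z - b t245 * u
  | t125 => b t125
  | t126 => m ⟨(1, 3), by decide⟩ - y - b t136 * p - 2 * b t245 * b p3
  | t135 => b t135 | t136 => b t136 | t245 => b t245 | t246 => m ⟨(1, 2), by decide⟩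

theorem slicePlucker_slicePoint (b : Coord → A) (m : PairIndex → A) :
    slicePlucker (slicePoint b m) = m := by
  apply pairIndex_funext <;> simp [slicePlucker, slicePoint] <;> ring

/-- The five Pfaffians are literally `F₁`, `F₃`, `F₆ - p₃F₄`, `F₄ - p₃F₂`, `F₇ + t₂₄₅F₂` on the
slice. -/
theorem slicePlucker_pfaffians {v : Coord → A} (h : equations v = 0) (h2 : v p2 = 0)
    (h4 : v p4 = 1) : ∀ q ∈ pfaffians (slicePlucker v), q = 0 := by
  have e0 := congrFun h 0
  have e1 := congrFun h 1
  have e2 := congrFun h 2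
  have e3 := congrFun h 3
  have e5 := congrFun h 5
  have e6 := congrFun h 6
  simp only [equations, Matrix.cons_val, Pi.zero_apply, h2, h4] at e0 e1 e2 e3 e5 e6
  rw [pfaffians_eq_zero_iff]
  refine ⟨?_, ?_, ?_, ?_, ?_⟩ <;> simp [pfaffian, skewMatrix, slicePlucker]
  · linear_combination e0
  · linear_combination e2
  · linear_combination e5 - v p3 * e3
  · linear_combination e3 - v p3 * e1
  · linear_combination e6 + v t245 * e1

/-- The entries are triangular in the coordinates they replace. Only `s₃`, which `F₂` determines,
and `t₁₂₄`, whose entry contains `s₃`, need an equation. -/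
theorem slicePoint_slicePlucker {v : Coord → A} (h : equations v = 0) (h2 : v p2 = 0)
    (h4 : v p4 = 1) : slicePoint v (slicePlucker v) = v := by
  have e1 := congrFun h 1
  simp only [equations, Matrix.cons_val, Pi.zero_apply, h2, h4] at e1
  funext c
  cases c <;> simp [slicePoint, slicePlucker, h2, h4] <;> try ring1
  · linear_combination e1
  · linear_combination -e1

theorem equations_slicePoint (b : Coord → A) {m : PairIndex → A} (h : ∀ q ∈ pfaffians m, q = 0) :
    equations (slicePoint b m) = 0 := by
  obtain ⟨v, hv⟩ : ∃ v, v = slicePoint b m := ⟨_, rfl⟩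
  have h2 : v p2 = 0 := by rw [hv]; rfl
  have h4 : v p4 = 1 := by rw [hv]; rfl
  -- `s₃` is chosen so as to solve this equation.
  have e1 : equations v 1 = 0 := by
    rw [hv]
    simp only [equations, slicePoint, Matrix.cons_val]
    ring
  rw [← slicePlucker_slicePoint b m, ← hv, pfaffians_eq_zero_iff] at h
  obtain ⟨q1, q2, q3, q4, q5⟩ := h
  simp [pfaffian, skewMatrix, slicePlucker] at q1 q2 q3 q4 q5
  rw [← hv]
  have e0 : equations v 0 = 0 := by
    simp only [equations, Matrix.cons_val, h2, h4]
    linear_combination q1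
  have e2 : equations v 2 = 0 := by
    simp only [equations, Matrix.cons_val, h2, h4]
    linear_combination q2
  have e3 : equations v 3 = 0 := by
    simp only [equations, Matrix.cons_val, h2, h4] at e1 ⊢
    linear_combination q4 + v p3 * e1
  have e5 : equations v 5 = 0 := by
    simp only [equations, Matrix.cons_val, h2, h4] at e3 ⊢
    linear_combination q3 + v p3 * e3
  have e6 : equations v 6 = 0 := by
    simp only [equations, Matrix.cons_val, h2, h4] at e1 ⊢
    linear_combination q5 - v t245 * e1
  -- Since `p₄ = 1`, syzygies put `F₅, F₈, F₉` into the ideal of the other six.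
  refine equations_eq_zero_of e0 e1 e2 e3 ?_ e5 e6 ?_ ?_ <;>
    simp only [equations, Matrix.cons_val, h2, h4] at e0 e1 e2 e3 e5 e6 ⊢
  · linear_combination v u2 * e0 - v u1 * e1 - v p3 * e2 + v p1 * e3
  · linear_combination (-v p1 * v t135 - v p3 * v t136) * e0 + (-v p1 * v t136 - v p3 * v t245 -
      v s2) * e1 + v t136 * e2 + (v s1 + v t245) * e3 + v p3 * e6
  · linear_combination (v u2 * v t136 + v t123) * e0 + (-v u1 * v t136 - v s3) * e1 +
      (-v p1 * v t135 - 2 * v p3 * v t136 - v t125) * e2 + (-v p3 * v t245 + v s2) * e3 +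
      v t245 * e5 + v u2 * e6

end Slice

/-! ### From the slice to `p₂p₄ ≠ 0`. -/

section MainChart

open Coord

variable {A : Type*} [CommRing A]

/-- The translate of a point by `shear` and `scale` to the slice `p₂ = 0`, `p₄ = 1`, where `i` is
the inverse of `p₄`. -/
def toSlice (i : A) (v : Coord → A) : Coord → A := scale i (shear (-(v p2 * i)) v)

/-- The Plücker coordinates on the chart `p₂ p₄ ≠ 0`, where `i` is the inverse of `p₄`. -/
def mainPlucker (i : A) (v : Coord → A) : PairIndex → A := slicePlucker (toSlice i v)

/-- The base coordinates of the translate to the slice of the point with base coordinates `b` and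
Plücker coordinates `m`, where `i` and `j` are the inverses of `p₄` and `p₂`. -/
def sliceBase (i j : A) (b : BaseCoord → A) (m : PairIndex → A) : Coord → A :=
  let r := b .p2 * i
  let r' := b .p4 * j
  let x := r' ^ 3 * (m ⟨(1, 2), by decide⟩ - b .t246 - 3 * r * b .t245 - 3 * r ^ 2 * b .t136)
  let y := b .t136 + r * x
  let z := b .t245 + 2 * r * b .t136 + r ^ 2 * x
  let c := i * b .p3
  let s := m ⟨(2, 4), by decide⟩ + y * m ⟨(0, 2), by decide⟩ + z * c
  fun
  | p3 => c | t1 => b .t1 | t135 => x | t136 => y | t245 => z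
  | t125 => r' * (m ⟨(1, 3), by decide⟩ - s - y * m ⟨(0, 2), by decide⟩ - 2 * z * c - b .t126)
  | _ => 0

/-- The point of the chart `p₂ p₄ ≠ 0` with base coordinates `b` and Plücker coordinates `m`,
where `i` and `j` are the inverses of `p₄` and `p₂`. -/
def mainPoint (i j : A) (b : BaseCoord → A) (m : PairIndex → A) : Coord → A :=
  shear (b .p2 * i) (scale (b .p4) (slicePoint (sliceBase i j b m) m))

theorem toSlice_p4 {i : A} {v : Coord → A} (hi : v p4 * i = 1) : toSlice i v p4 = 1 := by
  simp only [toSlice, scale, shear]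
  linear_combination hi

theorem toSlice_p2 {i : A} {v : Coord → A} (hi : v p4 * i = 1) : toSlice i v p2 = 0 := by
  simp only [toSlice, scale, shear]
  linear_combination -i * v p2 * hi

theorem equations_toSlice (i : A) {v : Coord → A} (h : equations v = 0) :
    equations (toSlice i v) = 0 :=
  equations_scale i (equations_shear _ h)

theorem mainPlucker_pfaffians {i : A} {v : Coord → A} (h : equations v = 0) (hi : v p4 * i = 1) :
    ∀ q ∈ pfaffians (mainPlucker i v), q = 0 :=
  slicePlucker_pfaffians (equations_toSlice i h) (toSlice_p2 hi) (toSlice_p4 hi)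

theorem equations_mainPoint (i j : A) (b : BaseCoord → A) {m : PairIndex → A}
    (h : ∀ q ∈ pfaffians m, q = 0) : equations (mainPoint i j b m) = 0 :=
  equations_shear _ (equations_scale _ (equations_slicePoint _ h))

variable {i j : A} {b : BaseCoord → A} {m : PairIndex → A}

/-- With `r = p₂ / p₄`, the shear brings `r t₁₂₅` into `t₁₂₆` and `r³ t₁₃₅` into `t₂₄₆`. The choice
in `sliceBase` solves for `t₁₂₅` and `t₁₃₅`, which is possible because `r` has the inverse `r'`;
this is where `p₂ ≠ 0` enters. -/
theorem mainPoint_toCoord (hi : b .p4 * i = 1) (hj : b .p2 * j = 1) (c : BaseCoord) :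
    mainPoint i j b m c.toCoord = b c := by
  obtain ⟨r, hr⟩ : ∃ r, r = b .p2 * i := ⟨_, rfl⟩
  obtain ⟨r', hr'⟩ : ∃ r', r' = b .p4 * j := ⟨_, rfl⟩
  have h : r * r' = 1 := by rw [hr, hr']; linear_combination b .p2 * j * hi + hj
  cases c <;> simp only [mainPoint, shear, scale, slicePoint, sliceBase, BaseCoord.toCoord,
    ← hr, ← hr']
  · rw [hr]; linear_combination b .p2 * hi
  · linear_combination b .p3 * hi
  · ring
  -- `s` is the value of `t₁₂₆` at the point of the slice.
  · obtain ⟨s, hs⟩ : ∃ s, s = m ⟨(1, 3), by decide⟩ - (m ⟨(2, 4), by decide⟩ +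
      (b .t136 + r * (r' ^ 3 * (m ⟨(1, 2), by decide⟩ - b .t246 - 3 * r * b .t245 -
        3 * r ^ 2 * b .t136))) * m ⟨(0, 2), by decide⟩ + (b .t245 + 2 * r * b .t136 +
        r ^ 2 * (r' ^ 3 * (m ⟨(1, 2), by decide⟩ - b .t246 - 3 * r * b .t245 -
        3 * r ^ 2 * b .t136))) * (i * b .p3)) - (b .t136 + r * (r' ^ 3 * (m ⟨(1, 2), by decide⟩ -
        b .t246 - 3 * r * b .t245 - 3 * r ^ 2 * b .t136))) * m ⟨(0, 2), by decide⟩ -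
        2 * (b .t245 + 2 * r * b .t136 + r ^ 2 * (r' ^ 3 * (m ⟨(1, 2), by decide⟩ - b .t246 -
        3 * r * b .t245 - 3 * r ^ 2 * b .t136))) * (i * b .p3) := ⟨_, rfl⟩
    rw [← hs]
    linear_combination (b .t126 - s) * h
  · ring
  · ring
  · have h3 : r ^ 3 * r' ^ 3 = 1 := by rw [← mul_pow, h, one_pow]
    linear_combination (-(m ⟨(1, 2), by decide⟩ - b .t246 - 3 * r * b .t245 -
      3 * r ^ 2 * b .t136)) * h3

theorem mainPlucker_mainPoint (hi : b .p4 * i = 1) (hj : b .p2 * j = 1) :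
    mainPlucker i (mainPoint i j b m) = m := by
  have h2 : mainPoint i j b m p2 = b .p2 := mainPoint_toCoord hi hj .p2
  rw [mainPlucker, toSlice, h2, mainPoint, shear_neg_shear, scale_scale (by rw [mul_comm, hi]),
    slicePlucker_slicePoint]

theorem mainPoint_mainPlucker {v : Coord → A} (h : equations v = 0) (hi : v p4 * i = 1)
    (hj : v p2 * j = 1) :
    mainPoint i j (fun c => v c.toCoord) (mainPlucker i v) = v := by
  obtain ⟨r', hr'⟩ : ∃ r', r' = v p4 * j := ⟨_, rfl⟩
  have hs := slicePoint_slicePlucker (equations_toSlice i h) (toSlice_p2 hi) (toSlice_p4 hi)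
  -- These six are the only base coordinates on which `slicePoint` depends.
  have key : ∀ c, c = p3 ∨ c = t1 ∨ c = t125 ∨ c = t135 ∨ c = t136 ∨ c = t245 →
      sliceBase i j (fun c => v c.toCoord) (mainPlucker i v) c = toSlice i v c := by
    have hr : v p2 * i * r' = 1 := by rw [hr']; linear_combination v p2 * j * hi + hj
    have hr3 : (v p2 * i) ^ 3 * r' ^ 3 = 1 := by rw [← mul_pow, hr, one_pow]
    have e135 : r' ^ 3 * (mainPlucker i v ⟨(1, 2), by decide⟩ - v t246 - 3 * (v p2 * i) * v t245 -
        3 * (v p2 * i) ^ 2 * v t136) = v t135 := by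
      simp [mainPlucker, slicePlucker, toSlice, scale, shear]
      linear_combination v t135 * hr3
    rintro c (rfl | rfl | rfl | rfl | rfl | rfl) <;>
      simp only [sliceBase, BaseCoord.toCoord, ← hr', e135]
    · simp [toSlice, scale, shear]
    · simp [toSlice, scale, shear]
    · simp [mainPlucker, slicePlucker, toSlice, scale, shear]
      linear_combination v t125 * hr
    · simp [toSlice, scale, shear]
    · simp only [toSlice, scale, shear]
      ring
    · simp only [toSlice, scale, shear]
      ring
  have hb : ∀ b b' : Coord → A, (∀ c, c = p3 ∨ c = t1 ∨ c = t125 ∨ c = t135 ∨ c = t136 ∨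
      c = t245 → b c = b' c) → ∀ m, slicePoint b m = slicePoint b' m := by
    intro b b' hbb m
    have h1 := hbb p3 (by simp)
    have h2 := hbb t1 (by simp)
    have h3 := hbb t125 (by simp)
    have h4 := hbb t135 (by simp)
    have h5 := hbb t136 (by simp)
    have h6 := hbb t245 (by simp)
    simp only [slicePoint, h1, h2, h3, h4, h5, h6]
  rw [mainPoint, hb _ _ key, mainPlucker, hs, toSlice]
  simp only [BaseCoord.toCoord]
  rw [scale_scale hi, shear_shear_neg]

end MainChart

/-! ### Compatibility of the constructions with ring homomorphisms. -/

section Naturality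

variable {A B F : Type*} [CommRing A] [CommRing B] [FunLike F A B] [RingHomClass F A B] (f : F)

theorem map_mainPlucker (i : A) (v : Coord → A) (e : PairIndex) :
    f (mainPlucker i v e) = mainPlucker (f i) (fun c => f (v c)) e := by
  have h2 : f 2 = 2 := map_ofNat f 2
  have h3 : f 3 = 3 := map_ofNat f 3
  revert e
  refine congrFun (pairIndex_funext ?_ ?_ ?_ ?_ ?_ ?_ ?_ ?_ ?_ ?_) <;>
    simp [mainPlucker, slicePlucker, toSlice, scale, shear, h2, h3]

theorem map_slicePoint (b : Coord → A) (m : PairIndex → A) (c : Coord) :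
    f (slicePoint b m c) = slicePoint (fun c => f (b c)) (fun e => f (m e)) c := by
  have h2 : f 2 = 2 := map_ofNat f 2
  cases c <;> simp [slicePoint, h2]

theorem map_sliceBase (i j : A) (b : BaseCoord → A) (m : PairIndex → A) (c : Coord) :
    f (sliceBase i j b m c) =
      sliceBase (f i) (f j) (fun c => f (b c)) (fun e => f (m e)) c := by
  have h2 : f 2 = 2 := map_ofNat f 2
  have h3 : f 3 = 3 := map_ofNat f 3
  cases c <;> simp [sliceBase, h2, h3]

theorem map_scale (r : A) (v : Coord → A) (c : Coord) :
    f (scale r v c) = scale (f r) (fun c => f (v c)) c := by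
  cases c <;> simp [scale]

theorem map_swap (v : Coord → A) (c : Coord) : f (swap v c) = swap (fun c => f (v c)) c := by
  cases c <;> simp [swap]

theorem map_shear (r : A) (v : Coord → A) (c : Coord) :
    f (shear r v c) = shear (f r) (fun c => f (v c)) c := by
  have h2 : f 2 = 2 := map_ofNat f 2
  have h3 : f 3 = 3 := map_ofNat f 3
  cases c <;> simp [shear, h2, h3]

theorem map_twistedShear (r : A) (v : Coord → A) (c : Coord) :
    f (twistedShear r v c) = twistedShear (f r) (fun c => f (v c)) c := by
  cases c <;> simp [twistedShear, map_ofNat f]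

theorem map_mainPoint (i j : A) (b : BaseCoord → A) (m : PairIndex → A) (c : Coord) :
    f (mainPoint i j b m c) =
      mainPoint (f i) (f j) (fun c => f (b c)) (fun e => f (m e)) c := by
  simp only [mainPoint, map_shear, map_scale, map_slicePoint, map_sliceBase, map_mul]

end Naturality

/-! ### The explicit equations of the singular locus. -/

section Explicit

open Coord

variable {K : Type*} [Field K]

/-- The explicit equations are the formulas of the chart for the other eleven coordinates,
specialized to the vertex. -/
theorem explicitEquations_mainPoint {b : BaseCoord → K} (h2 : b .p2 ≠ 0) (h4 : b .p4 ≠ 0) :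
    ExplicitEquations (mainPoint (b .p4)⁻¹ (b .p2)⁻¹ b 0) := by
  have hb := fun c => mainPoint_toCoord (m := 0) (mul_inv_cancel₀ h4) (mul_inv_cancel₀ h2) c
  have e2 := hb .p2
  have e3 := hb .p3
  have e4 := hb .p4
  have e1 := hb .t1
  have e126 := hb .t126
  have e136 := hb .t136
  have e245 := hb .t245
  have e246 := hb .t246
  simp only [BaseCoord.toCoord] at e2 e3 e4 e1 e126 e136 e245 e246
  simp only [ExplicitEquations, e2, e3, e4, e1, e126, e136, e245, e246]
  refine ⟨?_, ?_, ?_, ?_, ?_, ?_, ?_, ?_, ?_, ?_, ?_⟩ <;>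
    simp [mainPoint, shear, scale, slicePoint, sliceBase] <;> field_simp <;> try ring1

/-- The system is triangular: `u₂` and `s₁` depend on the eight base coordinates alone and then give
`u₁, t₂` and `s₂, s₃`; the rest is direct. -/
theorem explicitEquations_unique {v w : Coord → K} (hv : ExplicitEquations v)
    (hw : ExplicitEquations w) (h : ∀ c : BaseCoord, v c.toCoord = w c.toCoord) : v = w := by
  have e2 := h .p2
  have e3 := h .p3
  have e4 := h .p4
  have e1 := h .t1
  have e126 := h .t126
  have e136 := h .t136
  have e245 := h .t245
  have e246 := h .t246
  simp only [BaseCoord.toCoord] at e2 e3 e4 e1 e126 e136 e245 e246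
  obtain ⟨a1, a2, a3, a4, a5, a6, a7, a8, a9, a10, a11⟩ := hv
  obtain ⟨b1, b2, b3, b4, b5, b6, b7, b8, b9, b10, b11⟩ := hw
  rw [e2, e3, e4] at a1
  rw [e3, e4, e1] at a3
  rw [← b3] at a3
  rw [e2, e4, a3, ← b2] at a2
  rw [e3, e4, a3, ← b4] at a4
  rw [e136, e245, e246, e2, e4, ← b5] at a5
  rw [e3, e4, a5, ← b6] at a6
  rw [e3, e4, e1, a5, ← b7] at a7
  rw [e126, e136, e245, e246, e1, e2, e3, e4, ← b8] at a8
  rw [e126, e245, e246, e1, e2, e3, e4, ← b9] at a9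
  rw [e126, e136, e245, e246, e2, e3, e4, ← b10] at a10
  rw [e136, e245, e246, e2, e4, ← b11] at a11
  rw [← b1] at a1
  funext c
  cases c <;> assumption

/-- On `p₂ p₄ ≠ 0` the explicit equations are equivalent to the vanishing of the Plücker
coordinates. -/
theorem mainPlucker_eq_zero_iff {v : Coord → K} (h : equations v = 0) (h2 : v p2 ≠ 0)
    (h4 : v p4 ≠ 0) : mainPlucker (v p4)⁻¹ v = 0 ↔ ExplicitEquations v := by
  have hE : ExplicitEquations (mainPoint (v p4)⁻¹ (v p2)⁻¹ (fun c => v c.toCoord) 0) :=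
    explicitEquations_mainPoint (b := fun c => v c.toCoord) h2 h4
  constructor
  · intro hm
    have hv := mainPoint_mainPlucker h (mul_inv_cancel₀ h4) (mul_inv_cancel₀ h2)
    rw [hm] at hv
    rwa [hv] at hE
  · intro hv
    have := explicitEquations_unique hv hE fun c =>
      (mainPoint_toCoord (m := 0) (b := fun c => v c.toCoord) (mul_inv_cancel₀ h4)
        (mul_inv_cancel₀ h2) c).symm
    have hm : mainPlucker (v p4)⁻¹ (mainPoint (v p4)⁻¹ (v p2)⁻¹ (fun c => v c.toCoord) 0) = 0 :=
      mainPlucker_mainPoint (b := fun c => v c.toCoord) (mul_inv_cancel₀ h4) (mul_inv_cancel₀ h2)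
    rwa [← this] at hm

end Explicit

/-! ### Solving for `u₁, u₂, s₃, t₂` near the points with `p = u = 0`, `s₁ ≠ 0`. -/

section SChart

open Coord

/-- Replacement of the coordinates `u₁, u₂, s₃, t₂`. -/
def withValues {A : Type*} (a b c d : A) (v : Coord → A) : Coord → A
  | u1 => a | u2 => b | s3 => c | t2 => d
  | p1 => v p1 | p2 => v p2 | p3 => v p3 | p4 => v p4 | s1 => v s1 | s2 => v s2 | t1 => v t1
  | t123 => v t123 | t124 => v t124 | t125 => v t125 | t126 => v t126
  | t135 => v t135 | t136 => v t136 | t245 => v t245 | t246 => v t246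

theorem withValues_self {A : Type*} (v : Coord → A) :
    withValues (v u1) (v u2) (v s3) (v t2) v = v := by
  funext c; cases c <;> rfl

theorem withValues_withValues {A : Type*} (a b c d a' b' c' d' : A) (v : Coord → A) :
    withValues a b c d (withValues a' b' c' d' v) = withValues a b c d v := by
  funext c; cases c <;> rfl

theorem map_withValues {A B F : Type*} [FunLike F A B] (f : F) (a b c d : A)
    (v : Coord → A) (x : Coord) :
    f (withValues a b c d v x) = withValues (f a) (f b) (f c) (f d) (fun x => f (v x)) x := by
  cases x <;> rfl

variable {A : Type*} [CommRing A]

/-- The determinant of the linear system for `u₁, u₂` that is given by the first two equations. -/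
def sDet (v : Coord → A) : A :=
  (v s1 - (v t136 * v p2 + v t245 * v p4)) * (v s1 + (v t136 * v p2 + v t245 * v p4)) +
    (v t245 * v p2 + v t246 * v p4) * (v t135 * v p2 + v t136 * v p4)

/-- The coefficients of the linear system for `u₁, u₂` that is given by the equations
`s₁ F₁ + p₂ F₇ = 0` and `s₁ F₂ + p₄ F₇ = 0`, from which `s₃` is eliminated. -/
def sMatrix (v : Coord → A) : Matrix (Fin 2) (Fin 2) A :=
  let x := -2 * (v t136 ^ 2 - v t135 * v t245) * v p2 + (v t135 * v t246 - v t136 * v t245) * v p4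
  let y := -2 * (v t245 ^ 2 - v t136 * v t246) * v p4 + (v t135 * v t246 - v t136 * v t245) * v p2
  !![v s1 * (v s1 - (v t136 * v p2 + v t245 * v p4)) + v p2 * x,
      -v s1 * (v t245 * v p2 + v t246 * v p4) + v p2 * y;
    v s1 * (v t135 * v p2 + v t136 * v p4) + v p4 * x,
      v s1 * (v s1 + (v t136 * v p2 + v t245 * v p4)) + v p4 * y]

/-- The determinant of `sMatrix`. -/
def sDet' (v : Coord → A) : A :=
  sMatrix v 0 0 * sMatrix v 1 1 - sMatrix v 0 1 * sMatrix v 1 0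

/-- `s₃` has coefficient `-p₂` in `F₁` and `s₁` in `F₇`, so it cancels; `t₂` occurs in neither, and
the rest is affine in `u₁, u₂`. -/
theorem equations_withValues_zero (a b c d : A) (v : Coord → A) :
    v s1 * equations (withValues a b c d v) 0 + v p2 * equations (withValues a b c d v) 6 =
      sMatrix v 0 0 * a + sMatrix v 0 1 * b + (v s1 * equations (withValues 0 0 0 0 v) 0 +
        v p2 * equations (withValues 0 0 0 0 v) 6) := by
  simp only [equations, withValues, sMatrix, Matrix.cons_val, Matrix.of_apply]
  ring

theorem equations_withValues_one (a b c d : A) (v : Coord → A) :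
    v s1 * equations (withValues a b c d v) 1 + v p4 * equations (withValues a b c d v) 6 =
      sMatrix v 1 0 * a + sMatrix v 1 1 * b + (v s1 * equations (withValues 0 0 0 0 v) 1 +
        v p4 * equations (withValues 0 0 0 0 v) 6) := by
  simp only [equations, withValues, sMatrix, Matrix.cons_val, Matrix.of_apply]
  ring

theorem equations_withValues_six (a b c d : A) (v : Coord → A) :
    equations (withValues a b c d v) 6 = v s1 * c + equations (withValues a b 0 0 v) 6 := by
  simp only [equations, withValues, Matrix.cons_val]
  ring

/-- The coefficient of `t₂` in `F₈` is, up to sign, the determinant of the coefficients of `u₁, u₂`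
in `F₁, F₂`. -/
theorem equations_withValues_seven (a b c d : A) (v : Coord → A) :
    equations (withValues a b c d v) 7 = -(sDet v * d) + equations (withValues a b c 0 v) 7 := by
  simp only [equations, withValues, sDet, Matrix.cons_val]
  ring

/-- The point with prescribed values of the fifteen coordinates other than `u₁, u₂, s₃, t₂`, where
`i, j, k` are the inverses of `s₁`, `sDet'`, `sDet`. -/
def sPoint (i j k : A) (v : Coord → A) : Coord → A :=
  let y := v s1 * equations (withValues 0 0 0 0 v) 0 + v p2 * equations (withValues 0 0 0 0 v) 6
  let z := v s1 * equations (withValues 0 0 0 0 v) 1 + v p4 * equations (withValues 0 0 0 0 v) 6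
  let a := j * (sMatrix v 0 1 * z - sMatrix v 1 1 * y)
  let b := j * (sMatrix v 1 0 * y - sMatrix v 0 0 * z)
  let c := -i * equations (withValues a b 0 0 v) 6
  withValues a b c (k * equations (withValues a b c 0 v) 7) v

/-- On the open subset where `s₁` and `sDet` are invertible, four of the nine equations imply the
other ones. -/
theorem equations_eq_zero_of_sDet {v : Coord → A} {i k : A} (hi : v s1 * i = 1)
    (hk : sDet v * k = 1) (e0 : equations v 0 = 0) (e1 : equations v 1 = 0)
    (e6 : equations v 6 = 0) (e7 : equations v 7 = 0) : equations v = 0 := by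
  have hs : ∀ x, v s1 * x = 0 → x = 0 := fun x hx => by
    linear_combination i * hx - x * hi
  have hd : ∀ x, sDet v * x = 0 → x = 0 := fun x hx => by
    linear_combination k * hx - x * hk
  -- Syzygies give a linear system for `F₃, F₄` with the matrix that `u₁, u₂` have in `F₁, F₂`; its
  -- determinant is `sDet`.
  have a2 : (v s1 - (v t136 * v p2 + v t245 * v p4)) * equations v 2 -
      (v t245 * v p2 + v t246 * v p4) * equations v 3 = 0 := by
    simp only [equations, Matrix.cons_val] at e0 e1 e6 e7 ⊢
    linear_combination (-v p1 * v t136 - v p3 * v t245 + v s2) * e0 +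
      (-v p1 * v t245 - v p3 * v t246) * e1 - v p1 * e6 + v p2 * e7
  have a3 : (v t135 * v p2 + v t136 * v p4) * equations v 2 +
      (v s1 + (v t136 * v p2 + v t245 * v p4)) * equations v 3 = 0 := by
    simp only [equations, Matrix.cons_val] at e0 e1 e6 e7 ⊢
    linear_combination (v p1 * v t135 + v p3 * v t136) * e0 +
      (v p1 * v t136 + v p3 * v t245 + v s2) * e1 - v p3 * e6 + v p4 * e7
  have e2 : equations v 2 = 0 := hd _ (by
    unfold sDet
    linear_combination (v s1 + (v t136 * v p2 + v t245 * v p4)) * a2 +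
      (v t245 * v p2 + v t246 * v p4) * a3)
  have e3 : equations v 3 = 0 := hd _ (by
    unfold sDet
    linear_combination (v s1 - (v t136 * v p2 + v t245 * v p4)) * a3 -
      (v t135 * v p2 + v t136 * v p4) * a2)
  -- Further syzygies make `s₁F₅` and `s₁F₆` multiples of `F₉`; inserting this into the third
  -- relation leaves `sDet · F₉ = 0`.
  have a4 : v s1 * equations v 4 - v p2 * equations v 8 = 0 := by
    simp only [equations, Matrix.cons_val] at e0 e1 e2 e3 e6 e7 ⊢
    linear_combination (-v p1 * v t125 - v p2 * v t1 * v t136 - v p4 * v t1 * v t245 -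
      v u1 * v t136 - v u2 * v t245 + v s3) * e0 + (-v p1 * v t126 - v p2 * v t1 * v t245 -
      v p4 * v t1 * v t246 - v u1 * v t245 - v u2 * v t246) * e1 + (-v p1 * v t136 + v p2 * v t125 -
      v p3 * v t245) * e2 + (-v p1 * v t245 + v p2 * v t126 - v p3 * v t246) * e3 +
      v p2 * v t1 * e6 + v p1 * e7
  have a5 : v s1 * equations v 5 - v p4 * equations v 8 = 0 := by
    simp only [equations, Matrix.cons_val] at e0 e1 e2 e3 e6 e7 ⊢
    linear_combination (v p2 * v t1 * v t135 - v p3 * v t125 + v p4 * v t1 * v t136 + v u1 * v t135 +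
      v u2 * v t136) * e0 + (v p2 * v t1 * v t136 - v p3 * v t126 + v p4 * v t1 * v t245 +
      v u1 * v t136 + v u2 * v t245 + v s3) * e1 + (v p1 * v t135 + v p3 * v t136 +
      v p4 * v t125) * e2 + (v p1 * v t136 + v p3 * v t245 + v p4 * v t126) * e3 +
      v p4 * v t1 * e6 + v p3 * e7
  have a8 : v s1 * equations v 8 + (v p2 * (v t135 * v t245 - v t136 ^ 2) +
      v p4 * (v t135 * v t246 - v t136 * v t245)) * equations v 4 +
      v p4 * (v t136 * v t246 - v t245 ^ 2) * equations v 5 = 0 := by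
    simp only [equations, Matrix.cons_val] at e0 e1 e2 e3 e6 e7 ⊢
    linear_combination (v p2 * v t123 * v t136 - v p2 * v t124 * v t135 + v p4 * v t123 * v t245 -
      v p4 * v t124 * v t136 + v u1 * v t135 * v t245 - v u1 * v t136 ^ 2 +
      v u2 * v t135 * v t246 - v u2 * v t136 * v t245 + v s1 * v t123 - v s2 * v t125) * e0 +
      (v p2 * v t123 * v t245 - v p2 * v t124 * v t136 + v p4 * v t123 * v t246 -
      v p4 * v t124 * v t245 + v u2 * v t136 * v t246 - v u2 * v t245 ^ 2 + v s1 * v t124 -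
      v s2 * v t126) * e1 + (-v p1 * v t135 * v t245 + v p1 * v t136 ^ 2 - v p2 * v t125 * v t136 +
      v p2 * v t126 * v t135 - v p3 * v t135 * v t246 + v p3 * v t136 * v t245 -
      v p4 * v t125 * v t245 + v p4 * v t126 * v t136) * e2 + (-v p2 * v t125 * v t245 +
      v p2 * v t126 * v t136 - v p3 * v t136 * v t246 + v p3 * v t245 ^ 2 -
      v p4 * v t125 * v t246 + v p4 * v t126 * v t245) * e3 + v s3 * e6 + v s2 * e7
  have e8 : equations v 8 = 0 := hd _ (by
    unfold sDet
    linear_combination v s1 * a8 - (v p2 * (v t135 * v t245 - v t136 ^ 2) +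
      v p4 * (v t135 * v t246 - v t136 * v t245)) * a4 -
      v p4 * (v t136 * v t246 - v t245 ^ 2) * a5)
  have e4 : equations v 4 = 0 := hs _ (by linear_combination a4 + v p2 * e8)
  have e5 : equations v 5 = 0 := hs _ (by linear_combination a5 + v p4 * e8)
  exact equations_eq_zero_of e0 e1 e2 e3 e4 e5 e6 e7 e8

variable {i j k : A} {v : Coord → A}

/-- Cramer's rule for `sMatrix` gives `u₁, u₂`, then `F₇` gives `s₃` and `F₈` gives `t₂`. Since `s₁`
is invertible, `F₁` and `F₂` follow from the eliminated equations. -/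
theorem equations_sPoint (hi : v s1 * i = 1) (hj : sDet' v * j = 1) (hk : sDet v * k = 1) :
    equations (sPoint i j k v) = 0 := by
  obtain ⟨a, b, c, d, ha⟩ : ∃ a b c d, sPoint i j k v = withValues a b c d v := ⟨_, _, _, _, rfl⟩
  have hd : sDet (sPoint i j k v) = sDet v := rfl
  have h6 : equations (sPoint i j k v) 6 = 0 := by
    simp only [sPoint]
    rw [equations_withValues_six]
    linear_combination -equations (withValues (j * _) (j * _) 0 0 v) 6 * hi
  have h7 : equations (sPoint i j k v) 7 = 0 := by
    simp only [sPoint]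
    rw [equations_withValues_seven]
    linear_combination -equations (withValues (j * _) (j * _) (-i * _) 0 v) 7 * hk
  have h0 : v s1 * equations (sPoint i j k v) 0 + v p2 * equations (sPoint i j k v) 6 = 0 := by
    simp only [sPoint]
    rw [equations_withValues_zero]
    generalize v s1 * equations (withValues 0 0 0 0 v) 0 +
      v p2 * equations (withValues 0 0 0 0 v) 6 = y
    generalize v s1 * equations (withValues 0 0 0 0 v) 1 +
      v p4 * equations (withValues 0 0 0 0 v) 6 = z
    unfold sDet' at hj
    linear_combination -y * hj
  have h1 : v s1 * equations (sPoint i j k v) 1 + v p4 * equations (sPoint i j k v) 6 = 0 := by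
    simp only [sPoint]
    rw [equations_withValues_one]
    generalize v s1 * equations (withValues 0 0 0 0 v) 0 +
      v p2 * equations (withValues 0 0 0 0 v) 6 = y
    generalize v s1 * equations (withValues 0 0 0 0 v) 1 +
      v p4 * equations (withValues 0 0 0 0 v) 6 = z
    unfold sDet' at hj
    linear_combination -z * hj
  rw [h6] at h0 h1
  refine equations_eq_zero_of_sDet (i := i) (k := k) hi (by rw [hd, hk]) ?_ ?_ h6 h7
  · linear_combination i * h0 - equations (sPoint i j k v) 0 * hi
  · linear_combination i * h1 - equations (sPoint i j k v) 1 * hi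

theorem sPoint_eq_self (h : equations v = 0) (hi : v s1 * i = 1) (hj : sDet' v * j = 1)
    (hk : sDet v * k = 1) : sPoint i j k v = v := by
  have h0 := equations_withValues_zero (v u1) (v u2) (v s3) (v t2) v
  have h1 := equations_withValues_one (v u1) (v u2) (v s3) (v t2) v
  have h6 := equations_withValues_six (v u1) (v u2) (v s3) (v t2) v
  have h7 := equations_withValues_seven (v u1) (v u2) (v s3) (v t2) v
  rw [withValues_self, h] at h0 h1 h6 h7
  simp only [Pi.zero_apply, mul_zero, add_zero] at h0 h1 h6 h7
  unfold sDet' at hj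
  simp only [sPoint]
  generalize v s1 * equations (withValues 0 0 0 0 v) 0 +
    v p2 * equations (withValues 0 0 0 0 v) 6 = y at h0 ⊢
  generalize v s1 * equations (withValues 0 0 0 0 v) 1 +
    v p4 * equations (withValues 0 0 0 0 v) 6 = z at h1 ⊢
  have ea : j * (sMatrix v 0 1 * z - sMatrix v 1 1 * y) = v u1 := by
    linear_combination j * sMatrix v 1 1 * h0 - j * sMatrix v 0 1 * h1 + v u1 * hj
  have eb : j * (sMatrix v 1 0 * y - sMatrix v 0 0 * z) = v u2 := by
    linear_combination j * sMatrix v 0 0 * h1 - j * sMatrix v 1 0 * h0 + v u2 * hj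
  rw [ea, eb]
  have ec : -i * equations (withValues (v u1) (v u2) 0 0 v) 6 = v s3 := by
    linear_combination i * h6 + v s3 * hi
  rw [ec]
  have ed : k * equations (withValues (v u1) (v u2) (v s3) 0 v) 7 = v t2 := by
    linear_combination -k * h7 + v t2 * hk
  rw [ed, withValues_self]

theorem sPoint_withValues (a b c d : A) :
    sPoint i j k (withValues a b c d v) = sPoint i j k v := by
  simp only [sPoint, withValues_withValues]
  rfl

variable {B F : Type*} [CommRing B] [FunLike F A B] [RingHomClass F A B] (f : F)

theorem map_sMatrix (v : Coord → A) (x y : Fin 2) :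
    f (sMatrix v x y) = sMatrix (fun x => f (v x)) x y := by
  have h2 : f 2 = 2 := map_ofNat f 2
  fin_cases x <;> fin_cases y <;> simp [sMatrix, h2]

theorem map_sDet (v : Coord → A) : f (sDet v) = sDet (fun x => f (v x)) := by
  simp [sDet]

theorem map_sDet' (v : Coord → A) : f (sDet' v) = sDet' (fun x => f (v x)) := by
  simp [sDet', map_sMatrix]

theorem map_sPoint (v : Coord → A) (x : Coord) :
    f (sPoint i j k v x) = sPoint (f i) (f j) (f k) (fun x => f (v x)) x := by
  simp only [sPoint, map_withValues, map_mul, map_sub, map_add, map_neg, map_equations,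
    map_sMatrix, map_zero]

end SChart

/-! ### Points and automorphisms of `Π`. -/

section PiRing

open Coord

variable {A : Type*} [CommRing A] [Algebra ℂ A]

theorem equations_coord : equations coord = 0 := by
  funext i
  refine (map_equations (Ideal.Quotient.mk piIdeal) MvPolynomial.X i).symm.trans ?_
  exact Ideal.Quotient.eq_zero_iff_mem.2 (Ideal.subset_span ⟨i, rfl⟩)

/-- The morphism to `Π` that is given by a point with coordinates in a `ℂ`-algebra. -/
noncomputable def piLift (v : Coord → A) (h : equations v = 0) : PiRing →ₐ[ℂ] A :=
  Ideal.Quotient.liftₐ piIdeal (MvPolynomial.aeval v) (by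
    change piIdeal ≤ RingHom.ker (MvPolynomial.aeval v)
    refine Ideal.span_le.2 ?_
    rintro _ ⟨i, rfl⟩
    rw [SetLike.mem_coe, RingHom.mem_ker, map_equations]
    simp [h])

@[simp]
theorem piLift_coord (v : Coord → A) (h : equations v = 0) (c : Coord) :
    piLift v h (coord c) = v c :=
  MvPolynomial.aeval_X v c

theorem piRing_algHom_ext {φ ψ : PiRing →ₐ[ℂ] A} (h : ∀ c, φ (coord c) = ψ (coord c)) : φ = ψ :=
  Ideal.Quotient.algHom_ext _ (MvPolynomial.algHom_ext h)

/-- The automorphism of `Π` that is given by two mutually inverse transformations of points. -/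
noncomputable def piAut (v w : Coord → PiRing) (hv : equations v = 0) (hw : equations w = 0)
    (h₁ : ∀ c, piLift v hv (w c) = coord c) (h₂ : ∀ c, piLift w hw (v c) = coord c) :
    PiRing ≃ₐ[ℂ] PiRing :=
  AlgEquiv.ofAlgHom (piLift v hv) (piLift w hw)
    (piRing_algHom_ext fun c => by simp [h₁]) (piRing_algHom_ext fun c => by simp [h₂])

noncomputable def swapAut : PiRing ≃ₐ[ℂ] PiRing :=
  piAut (swap coord) (swap coord) (equations_swap equations_coord)
    (equations_swap equations_coord) (fun c => by simp [map_swap, swap_swap])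
    (fun c => by simp [map_swap, swap_swap])

theorem swapAut_coord (c : Coord) : swapAut (coord c) = swap coord c := by
  simp [swapAut, piAut]

noncomputable def shearAut : PiRing ≃ₐ[ℂ] PiRing :=
  piAut (shear 1 coord) (shear (-1) coord) (equations_shear _ equations_coord)
    (equations_shear _ equations_coord)
    (fun c => by simp only [map_shear, piLift_coord, map_neg, map_one, shear_neg_shear])
    (fun c => by simp only [map_shear, piLift_coord, map_one, shear_shear_neg])

theorem shearAut_coord (c : Coord) : shearAut (coord c) = shear 1 coord c := by
  simp [shearAut, piAut]

theorem shearAut_symm_coord (c : Coord) : shearAut.symm (coord c) = shear (-1) coord c := by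
  simp [shearAut, piAut]

noncomputable def twistedShearAut : PiRing ≃ₐ[ℂ] PiRing :=
  piAut (twistedShear 1 coord) (twistedShear (-1) coord) (equations_twistedShear _ equations_coord)
    (equations_twistedShear _ equations_coord)
    (fun c => by simp only [map_twistedShear, piLift_coord, map_neg, map_one, twistedShear_neg])
    (fun c => by
      simp only [map_twistedShear, piLift_coord, map_one]
      nth_rw 1 [← neg_neg (1 : PiRing)]
      rw [twistedShear_neg])

theorem twistedShearAut_coord (c : Coord) : twistedShearAut (coord c) = twistedShear 1 coord c := by
  simp [twistedShearAut, piAut]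

theorem twistedShearAut_symm_coord (c : Coord) :
    twistedShearAut.symm (coord c) = twistedShear (-1) coord c := by
  simp [twistedShearAut, piAut]

end PiRing

/-! ### The chart isomorphism on `p₂p₄ ≠ 0`. -/

section MainChart

open Coord

theorem map_eq_of_mul_eq_one {A : Type*} [CommRing A] {x y z : A} (hy : x * y = 1)
    (hz : x * z = 1) : y = z :=
  left_inv_eq_right_inv (by rw [mul_comm, hy]) hz

/-- The isomorphism between `{p₂ p₄ ≠ 0}` and an open subscheme of the Pfaffian variety. -/
theorem exists_mainChart :
    ∃ e : Localization.Away (coord .p2 * coord .p4) ≃ₐ[ℂ]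
        Localization.Away (baseCoord .p2 * baseCoord .p4),
      (∀ b : BaseCoord, e (algebraMap _ _ (coord b.toCoord)) = algebraMap _ _ (baseCoord b)) ∧
      ∃ i : Localization.Away (coord .p2 * coord .p4), algebraMap _ _ (coord .p4) * i = 1 ∧
        ∀ k : PairIndex, e.symm (algebraMap _ _ (plucker (MvPolynomial BaseCoord ℂ) k)) =
          mainPlucker i (fun c => algebraMap _ _ (coord c)) k := by
  let f : PiRing := coord .p2 * coord .p4
  let g : PfaffianRing := baseCoord .p2 * baseCoord .p4
  let v : Coord → Localization.Away f := fun c => algebraMap _ _ (coord c)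
  have hv : equations v = 0 := equations_map (algebraMap PiRing (Localization.Away f))
    equations_coord
  have hf : v p2 * v p4 * IsLocalization.Away.invSelf f = 1 := by
    rw [← map_mul]; exact IsLocalization.Away.mul_invSelf f
  obtain ⟨i, hi⟩ : ∃ i, v p4 * i = 1 := ⟨v p2 * IsLocalization.Away.invSelf f, by
    linear_combination hf⟩
  obtain ⟨j, hj⟩ : ∃ j, v p2 * j = 1 := ⟨v p4 * IsLocalization.Away.invSelf f, by
    linear_combination hf⟩
  let b : BaseCoord → Localization.Away g := fun c => algebraMap _ _ (baseCoord c)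
  let m : PairIndex → Localization.Away g := fun k =>
    algebraMap _ _ (plucker (MvPolynomial BaseCoord ℂ) k)
  have hm : ∀ q ∈ pfaffians m, q = 0 := pfaffians_map _ (plucker_pfaffians _)
  have hg : b .p2 * b .p4 * IsLocalization.Away.invSelf g = 1 := by
    rw [← map_mul]; exact IsLocalization.Away.mul_invSelf g
  obtain ⟨i', hi'⟩ : ∃ i, b .p4 * i = 1 := ⟨b .p2 * IsLocalization.Away.invSelf g, by
    linear_combination hg⟩
  obtain ⟨j', hj'⟩ : ∃ j, b .p2 * j = 1 := ⟨b .p4 * IsLocalization.Away.invSelf g, by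
    linear_combination hg⟩
  let φ : PiRing →ₐ[ℂ] Localization.Away g := piLift (mainPoint i' j' b m)
    (equations_mainPoint i' j' b hm)
  let ψ : PfaffianRing →ₐ[ℂ] Localization.Away f :=
    coneLift (MvPolynomial.aeval fun c => v c.toCoord) (mainPlucker i v)
      (mainPlucker_pfaffians hv hi)
  have hφb : ∀ c : BaseCoord, φ (coord c.toCoord) = b c := fun c => by
    rw [piLift_coord, mainPoint_toCoord hi' hj']
  have hψb : ∀ c : BaseCoord, ψ (baseCoord c) = v c.toCoord := fun c => by
    rw [baseCoord, coneLift_algebraMap, MvPolynomial.aeval_X]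
  have hψm : ∀ k, ψ (plucker _ k) = mainPlucker i v k := fun k => coneLift_plucker _ _ _ k
  -- The composites are compared on generators, where `mainPoint` and `mainPlucker` undo each other;
  -- `χ` respects the inverses of `p₂` and `p₄` because inverses are unique.
  let e := awayEquiv φ ψ
    (by
      have h2 : φ (coord p2) = b .p2 := hφb .p2
      have h4 : φ (coord p4) = b .p4 := hφb .p4
      rw [map_mul, h2, h4]
      exact IsUnit.of_mul_eq_one _ hg)
    (by
      rw [map_mul, hψb .p2, hψb .p4]
      exact IsUnit.of_mul_eq_one _ hf)
    (fun χ hχ a => by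
      have hb : ∀ c : BaseCoord, χ (b c) = v c.toCoord := fun c => by rw [hχ, hψb]
      have hχm : ∀ k, χ (m k) = mainPlucker i v k := fun k => by rw [hχ, hψm]
      have hχi : χ i' = i := map_eq_of_mul_eq_one
        (by have := congrArg χ hi'; rwa [map_mul, map_one, hb .p4] at this) hi
      have hχj : χ j' = j := map_eq_of_mul_eq_one
        (by have := congrArg χ hj'; rwa [map_mul, map_one, hb .p2] at this) hj
      have : χ.comp φ = Algebra.algHom ℂ PiRing _ := by
        refine piRing_algHom_ext fun c => ?_
        rw [AlgHom.comp_apply, piLift_coord, map_mainPoint, hχi, hχj, funext hb, funext hχm,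
          mainPoint_mainPlucker hv hi hj]
        rfl
      exact DFunLike.congr_fun this a)
    (fun χ hχ a => by
      have hχv : ∀ c, χ (v c) = mainPoint i' j' b m c := fun c => by rw [hχ, piLift_coord]
      have hχi : χ i = i' := map_eq_of_mul_eq_one
        (by
          have := congrArg χ hi
          have h4 : mainPoint i' j' b m p4 = b .p4 := mainPoint_toCoord hi' hj' .p4
          rwa [map_mul, map_one, hχv, h4] at this) hi'
      have : χ.comp ψ = Algebra.algHom ℂ PfaffianRing _ := by
        refine coneRing_algHom_ext (DFunLike.congr_fun (?_ :
          (χ.comp ψ).comp (Algebra.algHom ℂ _ _) = (Algebra.algHom ℂ PfaffianRing _).comp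
            (Algebra.algHom ℂ _ _))) fun k => ?_
        · refine MvPolynomial.algHom_ext fun c => ?_
          have h1 : χ (ψ (baseCoord c)) = b c := by
            rw [hψb, hχv, mainPoint_toCoord hi' hj']
          exact h1
        · have h1 : χ (ψ (plucker _ k)) = m k := by
            rw [hψm, map_mainPlucker, hχi, funext hχv, mainPlucker_mainPoint hi' hj']
          exact h1
      exact DFunLike.congr_fun this a)
  refine ⟨e, fun c => ?_, i, hi, fun k => ?_⟩
  · exact (awayEquiv_algebraMap φ ψ _ _ _ _ _).trans (hφb c)
  · exact (awayEquiv_symm_algebraMap φ ψ _ _ _ _ _).trans (hψm k)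

end MainChart

/-! ### The smooth chart as an open piece of affine `15`-space. -/

section SChart

open Coord

/-- The fifteen coordinates other than `u₁, u₂, s₃, t₂`. -/
abbrev FreeCoord : Type := {c : Coord // c ∉ ({u1, u2, s3, t2} : Finset Coord)}

/-- The point with the given fifteen coordinates for which `u₁, u₂, s₃, t₂` vanish. -/
def extendZero {A : Type*} [Zero A] (x : FreeCoord → A) : Coord → A := fun c =>
  if h : c ∉ ({u1, u2, s3, t2} : Finset Coord) then x ⟨c, h⟩ else 0

variable {A : Type*} [CommRing A]

theorem extendZero_restrict (v : Coord → A) :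
    extendZero (fun c : FreeCoord => v c) = withValues 0 0 0 0 v := by
  funext c; cases c <;> rfl

theorem map_extendZero {B F : Type*} [CommRing B] [FunLike F A B] [RingHomClass F A B] (f : F)
    (x : FreeCoord → A) (c : Coord) : f (extendZero x c) = extendZero (fun c => f (x c)) c := by
  unfold extendZero
  split_ifs <;> simp

theorem sPoint_extendZero (i j k : A) (x : FreeCoord → A) (c : FreeCoord) :
    sPoint i j k (extendZero x) c = x c := by
  obtain ⟨c, hc⟩ := c
  cases c <;> first | rfl | exact absurd hc (by decide)

/-- The product of the functions that are invertible on the chart in which `u₁, u₂, s₃, t₂` are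
expressed through the other coordinates. -/
def sDenominator (v : Coord → A) : A := v s1 * sDet' v * sDet v

theorem map_sDenominator {B F : Type*} [CommRing B] [FunLike F A B] [RingHomClass F A B] (f : F)
    (v : Coord → A) : f (sDenominator v) = sDenominator (fun c => f (v c)) := by
  simp only [sDenominator, map_mul, map_sDet, map_sDet']

theorem sDenominator_sPoint (i j k : A) (v : Coord → A) :
    sDenominator (sPoint i j k v) = sDenominator v := rfl

theorem sDenominator_withValues (a b c d : A) (v : Coord → A) :
    sDenominator (withValues a b c d v) = sDenominator v := rfl

theorem exists_inverses {v : Coord → A} {r : A} (h : sDenominator v * r = 1) :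
    ∃ i j k, v s1 * i = 1 ∧ sDet' v * j = 1 ∧ sDet v * k = 1 :=
  ⟨sDet' v * sDet v * r, v s1 * sDet v * r, v s1 * sDet' v * r,
    by unfold sDenominator at h; linear_combination h,
    by unfold sDenominator at h; linear_combination h,
    by unfold sDenominator at h; linear_combination h⟩

theorem sDenominator_extendZero_ne_zero :
    sDenominator (extendZero (MvPolynomial.X : FreeCoord → MvPolynomial FreeCoord ℂ)) ≠ 0 := by
  intro h
  -- At `s₁ = 1`, with all other coordinates zero, all three factors equal `1`.
  have h' := congrArg (MvPolynomial.eval fun c : FreeCoord => if c.1 = s1 then (1 : ℂ) else 0) h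
  rw [map_sDenominator] at h'
  simp only [map_extendZero, MvPolynomial.eval_X, map_zero] at h'
  simp [sDenominator, extendZero, sDet', sDet, sMatrix] at h'

/-- An open subscheme of `Π` is isomorphic to an open subscheme of the affine `15`-space. -/
theorem nonempty_sChart :
    Nonempty (Localization.Away (sDenominator coord) ≃ₐ[ℂ] Localization.Away
      (sDenominator (extendZero (MvPolynomial.X : FreeCoord → MvPolynomial FreeCoord ℂ)))) := by
  let f : PiRing := sDenominator coord
  let g := sDenominator (extendZero (MvPolynomial.X : FreeCoord → MvPolynomial FreeCoord ℂ))
  let v : Coord → Localization.Away f := fun c => algebraMap _ _ (coord c)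
  let x : FreeCoord → Localization.Away g := fun c =>
    algebraMap (MvPolynomial FreeCoord ℂ) _ (MvPolynomial.X c)
  have hv : equations v = 0 := equations_map (algebraMap PiRing (Localization.Away f))
    equations_coord
  have hf : sDenominator v * IsLocalization.Away.invSelf f = 1 := by
    rw [← map_sDenominator]; exact IsLocalization.Away.mul_invSelf f
  have hx : algebraMap _ _ g = sDenominator (extendZero x) := by
    rw [map_sDenominator]
    simp only [map_extendZero]
    rfl
  have hg : sDenominator (extendZero x) * IsLocalization.Away.invSelf g = 1 := by
    rw [← hx]; exact IsLocalization.Away.mul_invSelf g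
  obtain ⟨i, j, k, hi, hj, hk⟩ := exists_inverses hf
  obtain ⟨i', j', k', hi', hj', hk'⟩ := exists_inverses hg
  let φ : PiRing →ₐ[ℂ] Localization.Away g := piLift (sPoint i' j' k' (extendZero x))
    (equations_sPoint hi' hj' hk')
  let ψ : MvPolynomial FreeCoord ℂ →ₐ[ℂ] Localization.Away f :=
    MvPolynomial.aeval fun c : FreeCoord => v c
  have hφ : ∀ c, φ (coord c) = sPoint i' j' k' (extendZero x) c := fun c => piLift_coord _ _ c
  have hψ : ∀ c, ψ (MvPolynomial.X c) = v c := fun c => MvPolynomial.aeval_X _ c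
  refine ⟨awayEquiv φ ψ ?_ ?_ (fun χ hχ a => ?_) (fun χ hχ a => ?_)⟩
  · rw [map_sDenominator, funext hφ, sDenominator_sPoint]
    exact IsUnit.of_mul_eq_one _ hg
  · rw [map_sDenominator]
    simp only [map_extendZero, hψ]
    rw [extendZero_restrict, sDenominator_withValues]
    exact IsUnit.of_mul_eq_one _ hf
  · have hχx : ∀ c, χ (extendZero x c) = withValues 0 0 0 0 v c := fun c => by
      have hc : ∀ c : FreeCoord, χ (x c) = v c := fun c => (hχ _).trans (hψ c)
      rw [map_extendZero, funext hc, extendZero_restrict]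
    have hχi : χ i' = i := map_eq_of_mul_eq_one
      (by have := congrArg χ hi'; rwa [map_mul, map_one, hχx] at this) hi
    have hχj : χ j' = j := map_eq_of_mul_eq_one
      (by have := congrArg χ hj'; rwa [map_mul, map_one, map_sDet', funext hχx] at this) hj
    have hχk : χ k' = k := map_eq_of_mul_eq_one
      (by have := congrArg χ hk'; rwa [map_mul, map_one, map_sDet, funext hχx] at this) hk
    have : χ.comp φ = Algebra.algHom ℂ PiRing _ := by
      refine piRing_algHom_ext fun c => ?_
      rw [AlgHom.comp_apply, hφ, map_sPoint, hχi, hχj, hχk, funext hχx, sPoint_withValues,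
        sPoint_eq_self hv hi hj hk]
      rfl
    exact DFunLike.congr_fun this a
  · have : χ.comp ψ = Algebra.algHom ℂ _ _ := by
      refine MvPolynomial.algHom_ext fun c => ?_
      rw [AlgHom.comp_apply, hψ, hχ, hφ, sPoint_extendZero]
      rfl
    exact DFunLike.congr_fun this a

theorem ringKrullDim_sChart : ringKrullDim (Localization.Away (sDenominator coord)) = 15 := by
  obtain ⟨e⟩ := nonempty_sChart
  rw [ringKrullDim_eq_of_ringEquiv e.toRingEquiv,
    ringKrullDim_away_mvPolynomial sDenominator_extendZero_ne_zero, Nat.card_eq_fintype_card]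
  have : Fintype.card FreeCoord = 15 := by decide
  rw [this]
  rfl

instance : IrreducibleSpace (PrimeSpectrum (Localization.Away (sDenominator coord))) := by
  obtain ⟨e⟩ := nonempty_sChart
  have := irreducibleSpace_away (isNilpotent_iff_eq_zero.not.2 sDenominator_extendZero_ne_zero)
  exact irreducibleSpace_of_ringEquiv e.toRingEquiv

theorem notMem_singularLocus_of_sDenominator {x : PrimeSpectrum PiRing}
    (h : sDenominator coord ∉ x.asIdeal) : x ∉ singularLocus PiRing := by
  obtain ⟨e⟩ := nonempty_sChart
  obtain ⟨z, rfl⟩ := exists_comap_away_eq h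
  rw [← mem_singularLocus_away]
  obtain ⟨y, rfl⟩ := (PrimeSpectrum.homeomorphOfRingEquiv e.toRingEquiv.symm).surjective z
  have h1 := mem_singularLocus_ringEquiv e.toRingEquiv y
  intro h2
  have h3 := mem_singularLocus_away y
  rw [singularLocus_eq_empty (MvPolynomial FreeCoord ℂ)] at h3
  exact h3.1 (h1.1 h2)

/-- The smooth chart has to meet `{p₂p₄ ≠ 0}` for irreducibility. With `s₁ = p₂ = p₄ = 1` and the
other free coordinates zero both determinants are `1`, so `sPoint` provides a common point. -/
theorem exists_mem_sChart :
    ∃ x : PrimeSpectrum PiRing, sDenominator coord ∉ x.asIdeal ∧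
      coord p2 * coord p4 ∉ x.asIdeal := by
  let v : Coord → ℂ := fun c => if c = s1 ∨ c = p2 ∨ c = p4 then 1 else 0
  have h1 : v s1 * 1 = 1 := by simp [v]
  have h2 : sDet' v * 1 = 1 := by simp [v, sDet', sMatrix]
  have h3 : sDet v * 1 = 1 := by simp [v, sDet]
  refine ⟨⟨RingHom.ker (piLift _ (equations_sPoint h1 h2 h3)), RingHom.ker_isPrime _⟩, ?_, ?_⟩
  · change ¬ piLift _ (equations_sPoint h1 h2 h3) _ = 0
    rw [map_sDenominator, funext (piLift_coord _ (equations_sPoint h1 h2 h3)),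
      sDenominator_sPoint, sDenominator]
    rw [mul_one] at h1 h2 h3
    simp [h1, h2, h3]
  · change ¬ piLift _ (equations_sPoint h1 h2 h3) _ = 0
    simp only [map_mul, piLift_coord]
    simp [sPoint, withValues, v]

end SChart

/-! ### Transport of charts along isomorphisms. -/

section Congr

variable {k A B : Type*} [CommRing k] [CommRing A] [CommRing B] [Algebra k A] [Algebra k B]

/-- The isomorphism of basic open subschemes that is induced by an isomorphism. -/
noncomputable def awayCongr (σ : A ≃ₐ[k] B) (f : A) :
    Localization.Away f ≃ₐ[k] Localization.Away (σ f) :=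
  awayEquiv ((Algebra.algHom k B _).comp (σ : A →ₐ[k] B))
    ((Algebra.algHom k A _).comp (σ.symm : B →ₐ[k] A))
    (IsLocalization.Away.algebraMap_isUnit (σ f))
    (by
      change IsUnit (algebraMap A _ (σ.symm (σ f)))
      rw [AlgEquiv.symm_apply_apply]
      exact IsLocalization.Away.algebraMap_isUnit f)
    (fun χ hχ a => by
      refine (hχ (σ a)).trans ?_
      change algebraMap A _ (σ.symm (σ a)) = _
      rw [AlgEquiv.symm_apply_apply])
    (fun χ hχ b => by
      refine (hχ (σ.symm b)).trans ?_
      change algebraMap B _ (σ (σ.symm b)) = _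
      rw [AlgEquiv.apply_symm_apply])

/-- The isomorphism of cones that is induced by an isomorphism of base rings. -/
noncomputable def coneCongr (ε : A ≃ₐ[k] B) : ConeRing A ≃ₐ[k] ConeRing B :=
  AlgEquiv.ofAlgHom
    (coneLift ((Algebra.algHom k B (ConeRing B)).comp (ε : A →ₐ[k] B)) (plucker B)
      (plucker_pfaffians B))
    (coneLift ((Algebra.algHom k A (ConeRing A)).comp (ε.symm : B →ₐ[k] A)) (plucker A)
      (plucker_pfaffians A))
    (coneRing_algHom_ext (fun b => by
      rw [AlgHom.comp_apply, coneLift_algebraMap]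
      change coneLift _ _ _ (algebraMap A (ConeRing A) (ε.symm b)) = _
      rw [coneLift_algebraMap]
      change algebraMap B (ConeRing B) (ε (ε.symm b)) = _
      rw [AlgEquiv.apply_symm_apply, AlgHom.id_apply]) (fun e => by simp))
    (coneRing_algHom_ext (fun a => by
      rw [AlgHom.comp_apply, coneLift_algebraMap]
      change coneLift _ _ _ (algebraMap B (ConeRing B) (ε a)) = _
      rw [coneLift_algebraMap]
      change algebraMap A (ConeRing A) (ε.symm (ε a)) = _
      rw [AlgEquiv.symm_apply_apply, AlgHom.id_apply]) (fun e => by simp))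

end Congr

/-! ### Consequences of a cone chart for the subset. -/

section Charts

open PrimeSpectrum

variable {A : Type*} [CommRing A] [Algebra ℂ A] {τ : Type*} {f : A}
  {g : ConeRing (MvPolynomial τ ℂ)} {Z : Set (PrimeSpectrum A)}

/-- Isomorphisms preserve regularity of local rings, and the singular points of the cone over affine
space are exactly its vertices, so no condition on `e` is needed. -/
theorem isConeChart_singularLocus [Finite τ]
    (e : Localization.Away f ≃ₐ[ℂ] Localization.Away g) : IsConeChart (singularLocus A) e := by
  intro z
  have h1 := mem_singularLocus_ringEquiv e.symm.toRingEquiv z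
  rw [← mem_singularLocus_away, ← h1, mem_singularLocus_away, singularLocus_coneRing]
  exact Set.forall_mem_range

theorem isConeChart_inter (e : Localization.Away f ≃ₐ[ℂ] Localization.Away g) (he : IsConeChart Z e)
    {U : Set (PrimeSpectrum A)} (hU : ∀ x : PrimeSpectrum A, f ∉ x.asIdeal → x ∈ U) :
    IsConeChart (Z ∩ U) e := fun z =>
  (and_iff_left (hU _ (comap_away_mem_basicOpen f z))).trans (he z)

/-- A cone chart shows that the subset is closed in a basic open subset. -/
theorem exists_isClosed_of_isConeChart (e : Localization.Away f ≃ₐ[ℂ] Localization.Away g)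
    (he : IsConeChart Z e) :
    ∃ C : Set (PrimeSpectrum A), IsClosed C ∧ ∀ x, f ∉ x.asIdeal → (x ∈ Z ↔ x ∈ C) := by
  -- The `a k` are numerators of the pulled-back Plücker coordinates; the denominators are powers of
  -- `f` and do not affect vanishing where `f ≠ 0`.
  choose n a ha using fun k => IsLocalization.Away.surj f
    (e.symm (algebraMap _ _ (plucker (MvPolynomial τ ℂ) k)))
  refine ⟨zeroLocus (Set.range a), isClosed_zeroLocus _, fun x hx => ?_⟩
  obtain ⟨z, rfl⟩ := exists_comap_away_eq hx
  rw [he z]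
  refine (forall_congr' fun k => ?_).trans Set.forall_mem_range.symm
  change _ ↔ algebraMap _ _ (a k) ∈ z.asIdeal
  rw [← ha k, z.isPrime.mul_mem_iff_mem_or_mem]
  refine (or_iff_left fun h => ?_).symm
  exact comap_away_mem_basicOpen f z (z.isPrime.mem_of_pow_mem _ h)

theorem isLocallyClosed_of_isConeChart
    (h : ∀ x ∈ Z, ∃ (f : A) (g : ConeRing (MvPolynomial τ ℂ))
      (e : Localization.Away f ≃ₐ[ℂ] Localization.Away g), f ∉ x.asIdeal ∧ IsConeChart Z e) :
    IsLocallyClosed Z := by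
  refine ((isLocallyClosed_tfae Z).out 0 2).2 fun x hx => ?_
  obtain ⟨f, g, e, hfx, he⟩ := h x hx
  obtain ⟨C, hC, hZ⟩ := exists_isClosed_of_isConeChart e he
  refine ⟨basicOpen f, (basicOpen f).isOpen.mem_nhds hfx, ?_⟩
  have : (Subtype.val : ↥(basicOpen f : Set (PrimeSpectrum A)) → PrimeSpectrum A) ⁻¹' Z =
      Subtype.val ⁻¹' C := Set.ext fun x => hZ x x.2
  rw [this]
  exact hC.preimage continuous_subtype_val

/-- The chart carries the subset to the part of the vertex section in `{g ≠ 0}`, and the section is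
a closed embedding of the base, on which `g` restricts to `coneVertex g`. -/
theorem topologicalKrullDim_inter_basicOpen_of_isConeChart
    (e : Localization.Away f ≃ₐ[ℂ] Localization.Away g) (he : IsConeChart Z e) :
    topologicalKrullDim ↥(Z ∩ basicOpen f) =
      ringKrullDim (Localization.Away (coneVertex (MvPolynomial τ ℂ) g)) := by
  let B := MvPolynomial τ ℂ
  let V := zeroLocus (Set.range (plucker B))
  rw [← topologicalKrullDim_basicOpen]
  calc topologicalKrullDim ↥(Z ∩ basicOpen f)
      = topologicalKrullDim ↥(comap (algebraMap A (Localization.Away f)) ⁻¹' (Z ∩ basicOpen f)) :=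
        (topologicalKrullDim_preimage_of_isEmbedding (isEmbedding_comap_away f) (by
          rw [localization_away_comap_range (Localization.Away f) f]
          exact Set.inter_subset_right)).symm
    _ = topologicalKrullDim ↥((homeomorphOfRingEquiv e.toRingEquiv) ⁻¹'
          (comap (algebraMap (ConeRing B) (Localization.Away g)) ⁻¹' (V ∩ basicOpen g))) := by
        refine congrArg (fun S : Set (PrimeSpectrum (Localization.Away f)) =>
          topologicalKrullDim ↥S) (Set.ext fun z => ?_)
        refine (and_iff_left (comap_away_mem_basicOpen f z)).trans ?_
        refine (he z).trans (Iff.trans ?_ (and_iff_left (comap_away_mem_basicOpen g _)).symm)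
        exact ⟨by rintro h _ ⟨k, rfl⟩; exact h k, fun h k => h ⟨k, rfl⟩⟩
    _ = topologicalKrullDim
          ↥(comap (algebraMap (ConeRing B) (Localization.Away g)) ⁻¹' (V ∩ basicOpen g)) :=
        topologicalKrullDim_preimage_of_isEmbedding (Homeomorph.isEmbedding _)
          (by
            rw [(homeomorphOfRingEquiv e.toRingEquiv).surjective.range_eq]
            exact Set.subset_univ _)
    _ = topologicalKrullDim ↥(V ∩ basicOpen g) :=
        topologicalKrullDim_preimage_of_isEmbedding (isEmbedding_comap_away g) (by
          rw [localization_away_comap_range (Localization.Away g) g]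
          exact Set.inter_subset_right)
    _ = topologicalKrullDim ↥(comap (coneVertex B : ConeRing B →+* B) ⁻¹' (V ∩ basicOpen g)) :=
        (topologicalKrullDim_preimage_of_isEmbedding
          (isClosedEmbedding_comap_of_surjective _ _ (coneVertex_surjective B)).isEmbedding (by
            exact Set.inter_subset_left.trans (zeroLocus_range_plucker B).le)).symm
    _ = topologicalKrullDim ↥(basicOpen (coneVertex B g) : Set (PrimeSpectrum B)) := by
        refine congrArg (fun S : Set (PrimeSpectrum B) => topologicalKrullDim ↥S)
          (Set.ext fun y => and_iff_right ?_)
        exact (zeroLocus_range_plucker B).ge ⟨y, rfl⟩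

end Charts

/-! ### Moving points into `p₂p₄ ≠ 0`. -/

section Symmetries

open Coord PrimeSpectrum

theorem valueAt_eq_zero_iff {x : PrimeSpectrum PiRing} {c : Coord} :
    valueAt x c = 0 ↔ coord c ∈ x.asIdeal :=
  Ideal.algebraMap_residueField_eq_zero

theorem equations_valueAt (x : PrimeSpectrum PiRing) : equations (valueAt x) = 0 :=
  equations_map (algebraMap PiRing x.asIdeal.ResidueField) equations_coord

theorem mem_affineT_iff {x : PrimeSpectrum PiRing} :
    x ∈ affineT ↔ ∀ c ∈ fiberCoords, valueAt x c = 0 := by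
  simp only [valueAt_eq_zero_iff]
  exact Set.forall_mem_image

/-- The generic point of the linear subspace of `Π` on which all coordinates but
`p₁, p₂, p₃, p₄, u₁, u₂, t₁, t₂` vanish. -/
noncomputable def linearPoint : Coord → MvPolynomial Coord ℂ
  | p1 => .X p1 | p2 => .X p2 | p3 => .X p3 | p4 => .X p4 | u1 => .X u1 | u2 => .X u2
  | t1 => .X t1 | t2 => .X t2
  | _ => 0

theorem equations_linearPoint : equations linearPoint = 0 := by
  funext i
  fin_cases i <;> simp [equations, linearPoint]

noncomputable def linearHom : PiRing →ₐ[ℂ] MvPolynomial Coord ℂ :=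
  piLift linearPoint equations_linearPoint

theorem linearHom_coord (c : Coord) : linearHom (coord c) = linearPoint c := piLift_coord _ _ c

/-- By `h`, `σ⁻¹` preserves the ideal of the linear subspace, so `linearHom ∘ σ⁻¹` factors through
`linearHom`; evaluation at `σ a` gives the claim. -/
theorem linearHom_eq_zero_of_apply (σ : PiRing ≃ₐ[ℂ] PiRing)
    (h : ∀ c, linearPoint c = 0 → linearHom (σ.symm (coord c)) = 0) {a : PiRing}
    (ha : linearHom (σ a) = 0) : linearHom a = 0 := by
  let θ : MvPolynomial Coord ℂ →ₐ[ℂ] MvPolynomial Coord ℂ :=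
    MvPolynomial.aeval fun c => linearHom (σ.symm (coord c))
  have hθ : θ.comp linearHom = linearHom.comp (σ.symm : PiRing →ₐ[ℂ] PiRing) := by
    refine piRing_algHom_ext fun c => ?_
    rw [AlgHom.comp_apply, linearHom_coord]
    have hc : linearPoint c = 0 ∨ linearPoint c = MvPolynomial.X c := by
      cases c <;> simp [linearPoint]
    obtain hc | hc := hc
    · rw [hc, map_zero]
      exact (h c hc).symm
    · rw [hc]
      exact MvPolynomial.aeval_X _ c
  have := DFunLike.congr_fun hθ (σ a)
  rw [AlgHom.comp_apply, ha, map_zero] at this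
  exact (this.trans (congrArg linearHom (σ.symm_apply_apply a))).symm

/-- The automorphisms of `Π` that preserve `𝔸_T` and a linear subspace. -/
structure IsSymmetry (σ : PiRing ≃ₐ[ℂ] PiRing) : Prop where
  comap_mem : ∀ x ∈ affineT, comap (σ : PiRing →+* PiRing) x ∈ affineT
  linearHom_eq_zero : ∀ a, linearHom (σ a) = 0 → linearHom a = 0

theorem IsSymmetry.refl : IsSymmetry AlgEquiv.refl := ⟨fun _ h => h, fun _ h => h⟩

theorem IsSymmetry.trans {σ τ : PiRing ≃ₐ[ℂ] PiRing} (hσ : IsSymmetry σ) (hτ : IsSymmetry τ) :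
    IsSymmetry (σ.trans τ) :=
  ⟨fun x hx => hσ.1 _ (hτ.1 x hx), fun _ ha => hσ.2 _ (hτ.2 _ ha)⟩

/-- `T` is given over all rings so that it can be evaluated on coordinates in a residue field, where
membership in `𝔸_T` is the vanishing of nine values. -/
theorem isSymmetry_of {σ : PiRing ≃ₐ[ℂ] PiRing}
    {T : ∀ {A : Type} [CommRing A], (Coord → A) → Coord → A}
    (hT : ∀ {A B : Type} [CommRing A] [CommRing B] (f : A →+* B) (v : Coord → A) c,
      f (T v c) = T (fun c => f (v c)) c)
    (h : ∀ c, σ (coord c) = T coord c)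
    (h₁ : ∀ {K : Type} [Field K] (v : Coord → K), (∀ c ∈ fiberCoords, v c = 0) →
      ∀ c ∈ fiberCoords, T v c = 0)
    (h₂ : ∀ c, linearPoint c = 0 → linearHom (σ.symm (coord c)) = 0) : IsSymmetry σ := by
  refine ⟨fun x hx => ?_, fun a ha => linearHom_eq_zero_of_apply σ h₂ ha⟩
  rw [mem_affineT_iff] at hx
  rintro _ ⟨c, hc, rfl⟩
  change σ (coord c) ∈ x.asIdeal
  rw [← Ideal.algebraMap_residueField_eq_zero, h, hT]
  exact h₁ _ hx c hc

theorem swapAut_symm_coord (c : Coord) : swapAut.symm (coord c) = swap coord c := by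
  simp [swapAut, piAut]

theorem forall_mem_fiberCoords {P : Coord → Prop} : (∀ c ∈ fiberCoords, P c) ↔
    P p1 ∧ P p2 ∧ P p3 ∧ P p4 ∧ P u1 ∧ P u2 ∧ P s1 ∧ P s2 ∧ P s3 := by
  simp [fiberCoords]

theorem isSymmetry_swapAut : IsSymmetry swapAut := by
  refine isSymmetry_of (T := swap) (fun f v c => map_swap f v c) swapAut_coord (fun v h => ?_)
    fun c hc => ?_
  · rw [forall_mem_fiberCoords] at h ⊢
    simp [swap, h]
  · rw [swapAut_symm_coord]
    cases c <;> simp [linearPoint, swap, linearHom_coord] at hc ⊢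

theorem isSymmetry_shearAut : IsSymmetry shearAut := by
  refine isSymmetry_of (T := shear 1) (fun f v c => ?_) shearAut_coord (fun v h => ?_)
    fun c hc => ?_
  · rw [map_shear, map_one]
  · rw [forall_mem_fiberCoords] at h ⊢
    simp [shear, h]
  · rw [shearAut_symm_coord]
    cases c <;> simp [linearPoint, shear, linearHom_coord] at hc ⊢

theorem isSymmetry_twistedShearAut : IsSymmetry twistedShearAut := by
  refine isSymmetry_of (T := twistedShear 1) (fun f v c => ?_) twistedShearAut_coord (fun v h => ?_)
    fun c hc => ?_
  · rw [map_twistedShear, map_one]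
  · rw [forall_mem_fiberCoords] at h ⊢
    simp [twistedShear, h]
  · rw [twistedShearAut_symm_coord]
    cases c <;> simp [linearPoint, twistedShear, linearHom_coord] at hc ⊢

/-- Points that some symmetry moves to a point with `p₂ p₄ ≠ 0`. -/
def IsMovable (x : PrimeSpectrum PiRing) : Prop :=
  ∃ σ, IsSymmetry σ ∧ σ (coord p2 * coord p4) ∉ x.asIdeal

theorem IsMovable.of_comap {σ : PiRing ≃ₐ[ℂ] PiRing} (hσ : IsSymmetry σ)
    {x : PrimeSpectrum PiRing} (h : IsMovable (comap (σ : PiRing →+* PiRing) x)) : IsMovable x := by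
  obtain ⟨τ, hτ, h⟩ := h
  exact ⟨τ.trans σ, hτ.trans hσ, h⟩

theorem isMovable_of_p2_p4 {x : PrimeSpectrum PiRing} (h2 : coord p2 ∉ x.asIdeal)
    (h4 : coord p4 ∉ x.asIdeal) : IsMovable x :=
  ⟨AlgEquiv.refl, IsSymmetry.refl, fun h => (x.isPrime.mem_or_mem h).elim h2 h4⟩

/-- Where `p₂` vanishes, the shear replaces it by `p₂ + p₄`. -/
theorem isMovable_of_p4 {x : PrimeSpectrum PiRing} (h4 : coord p4 ∉ x.asIdeal) : IsMovable x := by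
  by_cases h2 : coord p2 ∈ x.asIdeal
  · refine IsMovable.of_comap isSymmetry_shearAut (isMovable_of_p2_p4 ?_ ?_)
    · change shearAut (coord p2) ∉ x.asIdeal
      rw [shearAut_coord, shear, one_mul]
      exact fun h => h4 ((Ideal.add_mem_iff_right _ h2).1 h)
    · change shearAut (coord p4) ∉ x.asIdeal
      rwa [shearAut_coord]
  · exact isMovable_of_p2_p4 h2 h4

theorem isMovable_of_swap {c c' : Coord} (hc : ∀ v : Coord → PiRing, swap v c = v c')
    (h : ∀ x : PrimeSpectrum PiRing, coord c ∉ x.asIdeal → IsMovable x)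
    {x : PrimeSpectrum PiRing} (hx : coord c' ∉ x.asIdeal) : IsMovable x := by
  refine IsMovable.of_comap isSymmetry_swapAut (h _ ?_)
  change swapAut (coord c) ∉ x.asIdeal
  rwa [swapAut_coord, hc]

theorem three_mul_mem_iff {x : PrimeSpectrum PiRing} {a : PiRing} :
    3 * a ∈ x.asIdeal ↔ a ∈ x.asIdeal := by
  have h : IsUnit (3 : PiRing) := by
    have := (IsUnit.mk0 (3 : ℂ) (by norm_num)).map (algebraMap ℂ PiRing)
    rwa [map_ofNat] at this
  exact Ideal.unit_mul_mem_iff_mem _ h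

/-- Where `p₄` vanishes, the twisted shear replaces it by `p₄ + 3p₁`. -/
theorem isMovable_of_p1 {x : PrimeSpectrum PiRing} (h1 : coord p1 ∉ x.asIdeal) : IsMovable x := by
  by_cases h4 : coord p4 ∈ x.asIdeal
  · refine IsMovable.of_comap isSymmetry_twistedShearAut (isMovable_of_p4 ?_)
    change twistedShearAut (coord p4) ∉ x.asIdeal
    rw [twistedShearAut_coord, twistedShear, mul_one]
    exact fun h => h1 (three_mul_mem_iff.1 ((Ideal.add_mem_iff_right _ h4).1 h))
  · exact isMovable_of_p4 h4

theorem isMovable_of_p3 {x : PrimeSpectrum PiRing} (h : coord p3 ∉ x.asIdeal) : IsMovable x :=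
  isMovable_of_swap (c := p1) (fun _ => rfl) (fun _ => isMovable_of_p1) h

theorem isMovable_of_p2 {x : PrimeSpectrum PiRing} (h : coord p2 ∉ x.asIdeal) : IsMovable x :=
  isMovable_of_swap (c := p4) (fun _ => rfl) (fun _ => isMovable_of_p4) h

/-- Where `p₂` and `p₃` vanish, the twisted shear turns `p₃` into `-3u₁`, up to terms that vanish.
-/
theorem isMovable_of_u1 {x : PrimeSpectrum PiRing} (h : coord u1 ∉ x.asIdeal) : IsMovable x := by
  by_cases h3 : coord p3 ∈ x.asIdeal
  · by_cases h2 : coord p2 ∈ x.asIdeal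
    · refine IsMovable.of_comap isSymmetry_twistedShearAut (isMovable_of_p3 ?_)
      change twistedShearAut (coord p3) ∉ x.asIdeal
      rw [twistedShearAut_coord, twistedShear, mul_one]
      intro h'
      have := x.asIdeal.sub_mem h3 h'
      rw [sub_sub_cancel, three_mul_mem_iff,
        Ideal.add_mem_iff_right _ (Ideal.mul_mem_left _ _ h2)] at this
      exact h this
    · exact isMovable_of_p2 h2
  · exact isMovable_of_p3 h3

theorem isMovable_of_u2 {x : PrimeSpectrum PiRing} (h : coord u2 ∉ x.asIdeal) : IsMovable x :=
  isMovable_of_swap (c := u1) (fun _ => rfl) (fun _ => isMovable_of_u1) h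

/-- At an unmovable point all `pᵢ` and `uᵢ` vanish, and `sDenominator` is a power of `s₁`. If `s₁ =
0` too, then `F₇` gives `s₂² = 0` and `F₉` gives `s₃² = 0`, so the point lies in `𝔸_T`. -/
theorem isMovable_or_sDenominator_notMem {x : PrimeSpectrum PiRing} (hx : x ∉ affineT) :
    IsMovable x ∨ sDenominator coord ∉ x.asIdeal := by
  by_contra! h
  obtain ⟨h, hs⟩ := h
  have h1 := valueAt_eq_zero_iff.2 (not_not.1 fun h' => h (isMovable_of_p1 h'))
  have h2 := valueAt_eq_zero_iff.2 (not_not.1 fun h' => h (isMovable_of_p2 h'))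
  have h3 := valueAt_eq_zero_iff.2 (not_not.1 fun h' => h (isMovable_of_p3 h'))
  have h4 := valueAt_eq_zero_iff.2 (not_not.1 fun h' => h (isMovable_of_p4 h'))
  have h5 := valueAt_eq_zero_iff.2 (not_not.1 fun h' => h (isMovable_of_u1 h'))
  have h6 := valueAt_eq_zero_iff.2 (not_not.1 fun h' => h (isMovable_of_u2 h'))
  rw [← Ideal.algebraMap_residueField_eq_zero, map_sDenominator] at hs
  change sDenominator (valueAt x) = 0 at hs
  have hs1 : valueAt x s1 = 0 := by
    simpa [sDenominator, sDet, sDet', sMatrix, h2, h4] using hs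
  have e6 := congrFun (equations_valueAt x) 6
  have e8 := congrFun (equations_valueAt x) 8
  have hs2 : valueAt x s2 = 0 := by
    simpa [equations, h1, h2, h3, h4, h5, h6, hs1] using e6
  have hs3 : valueAt x s3 = 0 := by
    simpa [equations, h1, h2, h3, h4, h5, h6, hs1, hs2] using e8
  exact hx (mem_affineT_iff.2 (forall_mem_fiberCoords.2 ⟨h1, h2, h3, h4, h5, h6, hs1, hs2, hs3⟩))

end Symmetries

/-! ### Assembly of the global statements. -/

section Main

open Coord PrimeSpectrum

theorem notMem_affineT_of_symmetry {σ : PiRing ≃ₐ[ℂ] PiRing} (hσ : IsSymmetry σ)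
    (x : PrimeSpectrum PiRing) (hx : σ (coord p2 * coord p4) ∉ x.asIdeal) : x ∈ affineTᶜ := by
  intro h
  refine hx ?_
  rw [map_mul]
  exact Ideal.mul_mem_right _ _ (hσ.comap_mem x h ⟨p2, by simp [fiberCoords], rfl⟩)

theorem isConeChart_Delta {τ : Type*} [Finite τ] {f : PiRing}
    {g : ConeRing (MvPolynomial τ ℂ)} (e : Localization.Away f ≃ₐ[ℂ] Localization.Away g)
    (hf : ∀ x : PrimeSpectrum PiRing, f ∉ x.asIdeal → x ∈ affineTᶜ) : IsConeChart Delta e :=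
  isConeChart_inter e (isConeChart_singularLocus e) hf

theorem natCard_baseCoord : Nat.card BaseCoord = 8 := by
  rw [Nat.card_eq_fintype_card]
  decide

theorem nonempty_chart_of_symmetry (σ : PiRing ≃ₐ[ℂ] PiRing) :
    Nonempty (Localization.Away (σ (coord p2 * coord p4)) ≃ₐ[ℂ]
      Localization.Away (baseCoord .p2 * baseCoord .p4)) := by
  obtain ⟨e, -⟩ := exists_mainChart
  exact ⟨(awayCongr σ _).symm.trans e⟩

theorem isMovable_of_mem_Delta {x : PrimeSpectrum PiRing} (hx : x ∈ Delta) : IsMovable x :=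
  (isMovable_or_sDenominator_notMem hx.2).resolve_right fun h =>
    notMem_singularLocus_of_sDenominator h hx.1

theorem hasConeSingularitiesAlong_Delta : HasConeSingularitiesAlong PiRing 8 Delta := by
  intro x hx
  obtain ⟨σ, hσ, hfx⟩ := isMovable_of_mem_Delta hx
  obtain ⟨e⟩ := nonempty_chart_of_symmetry σ
  let ε := coneCongr (MvPolynomial.renameEquiv ℂ
    (Finite.equivFinOfCardEq natCard_baseCoord))
  exact ⟨_, hfx, _, e.trans (awayCongr ε _),
    isConeChart_Delta _ (notMem_affineT_of_symmetry hσ)⟩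

theorem coneVertex_baseCoord (b : BaseCoord) :
    coneVertex _ (baseCoord b) = MvPolynomial.X b :=
  coneLift_algebraMap _ _ _ _

theorem coneVertex_denominator_ne_zero :
    coneVertex _ (baseCoord .p2 * baseCoord .p4) ≠ 0 := by
  rw [map_mul, coneVertex_baseCoord, coneVertex_baseCoord]
  exact mul_ne_zero (MvPolynomial.X_ne_zero _) (MvPolynomial.X_ne_zero _)

instance irreducibleSpace_away_of_symmetry (σ : PiRing ≃ₐ[ℂ] PiRing) :
    IrreducibleSpace (PrimeSpectrum (Localization.Away (σ (coord p2 * coord p4)))) := by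
  obtain ⟨e⟩ := nonempty_chart_of_symmetry σ
  have : IrreducibleSpace
      (PrimeSpectrum (Localization.Away (baseCoord .p2 * baseCoord .p4))) :=
    -- `p₂p₄` is not nilpotent, since it is a nonzero polynomial on the vertex section.
    irreducibleSpace_away fun h => coneVertex_denominator_ne_zero
      (isNilpotent_iff_eq_zero.1 (h.map (coneVertex _)))
  exact irreducibleSpace_of_ringEquiv e.toRingEquiv

theorem notMem_affineT_of_sDenominator (x : PrimeSpectrum PiRing)
    (hx : sDenominator coord ∉ x.asIdeal) : x ∈ affineTᶜ := by
  intro h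
  refine hx ?_
  rw [sDenominator, mul_assoc]
  exact Ideal.mul_mem_right _ _ (h ⟨s1, by simp [fiberCoords], rfl⟩)

theorem isIrreducible_affineT_compl : IsIrreducible (affineTᶜ : Set (PrimeSpectrum PiRing)) := by
  have h : IsIrreducible (basicOpen (coord p2 * coord p4) : Set (PrimeSpectrum PiRing)) :=
    have : IrreducibleSpace (PrimeSpectrum (Localization.Away (coord p2 * coord p4))) :=
      irreducibleSpace_away_of_symmetry AlgEquiv.refl
    isIrreducible_basicOpen _
  refine isIrreducible_of_open_cover (basicOpen (coord p2 * coord p4)).isOpen h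
    (notMem_affineT_of_symmetry IsSymmetry.refl) fun x hx => ?_
  obtain ⟨σ, hσ, hfx⟩ | hfx := isMovable_or_sDenominator_notMem hx
  -- The generic point of the linear subspace lies in both open sets, because `p₂p₄` is nonzero
  -- there and `σ` is compatible with the subspace.
  · refine ⟨basicOpen (σ (coord p2 * coord p4)), hfx, isIrreducible_basicOpen _,
      ⟨⟨RingHom.ker linearHom, RingHom.ker_isPrime _⟩, fun h => ?_, fun h => ?_⟩⟩
    · have h' := hσ.linearHom_eq_zero _ h
      rw [map_mul, linearHom_coord, linearHom_coord] at h'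
      exact mul_ne_zero (MvPolynomial.X_ne_zero _) (MvPolynomial.X_ne_zero _) h'
    · have h' : linearHom _ = 0 := h
      rw [map_mul, linearHom_coord, linearHom_coord] at h'
      exact mul_ne_zero (MvPolynomial.X_ne_zero _) (MvPolynomial.X_ne_zero _) h'
  · obtain ⟨y, hy, hy'⟩ := exists_mem_sChart
    exact ⟨basicOpen (sDenominator coord), hfx, isIrreducible_basicOpen _, y, hy, hy'⟩

theorem topologicalKrullDim_affineT_compl :
    topologicalKrullDim ↥(affineTᶜ : Set (PrimeSpectrum PiRing)) = 15 := by
  refine le_antisymm (topologicalKrullDim_le_of_local fun x hx => ?_) ?_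
  · obtain ⟨σ, hσ, hfx⟩ | hfx := isMovable_or_sDenominator_notMem hx
    · refine ⟨_, (basicOpen (σ (coord p2 * coord p4))).isOpen, hfx,
        (topologicalKrullDim_mono Set.inter_subset_right).trans ?_⟩
      obtain ⟨e⟩ := nonempty_chart_of_symmetry σ
      rw [topologicalKrullDim_basicOpen, ringKrullDim_eq_of_ringEquiv e.toRingEquiv]
      refine (ringKrullDim_away_le _).trans ((ringKrullDim_coneRing_le _).trans ?_)
      rw [MvPolynomial.ringKrullDim_of_isNoetherianRing, ringKrullDim_eq_zero_of_field, zero_add,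
        natCard_baseCoord]
      exact le_of_eq (by norm_num)
    · refine ⟨_, (basicOpen (sDenominator coord)).isOpen, hfx,
        (topologicalKrullDim_mono Set.inter_subset_right).trans ?_⟩
      rw [topologicalKrullDim_basicOpen, ringKrullDim_sChart]
  · rw [← ringKrullDim_sChart, ← topologicalKrullDim_basicOpen]
    exact topologicalKrullDim_mono notMem_affineT_of_sDenominator

theorem isLocallyClosed_Delta : IsLocallyClosed Delta := by
  refine isLocallyClosed_of_isConeChart (τ := BaseCoord) fun x hx => ?_
  obtain ⟨σ, hσ, hfx⟩ := isMovable_of_mem_Delta hx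
  obtain ⟨e⟩ := nonempty_chart_of_symmetry σ
  exact ⟨_, _, e, hfx, isConeChart_Delta e (notMem_affineT_of_symmetry hσ)⟩

theorem topologicalKrullDim_Delta_inter {σ : PiRing ≃ₐ[ℂ] PiRing} (hσ : IsSymmetry σ) :
    topologicalKrullDim ↥(Delta ∩ basicOpen (σ (coord p2 * coord p4))) = 8 := by
  obtain ⟨e⟩ := nonempty_chart_of_symmetry σ
  rw [topologicalKrullDim_inter_basicOpen_of_isConeChart e
    (isConeChart_Delta e (notMem_affineT_of_symmetry hσ)),
    ringKrullDim_away_mvPolynomial coneVertex_denominator_ne_zero, natCard_baseCoord]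
  rfl

theorem topologicalKrullDim_Delta : topologicalKrullDim ↥Delta = 8 := by
  refine le_antisymm (topologicalKrullDim_le_of_local fun x hx => ?_) ?_
  · obtain ⟨σ, hσ, hfx⟩ := isMovable_of_mem_Delta hx
    exact ⟨_, (basicOpen (σ (coord p2 * coord p4))).isOpen, hfx,
      (topologicalKrullDim_Delta_inter hσ).le⟩
  · rw [← topologicalKrullDim_Delta_inter IsSymmetry.refl]
    exact topologicalKrullDim_mono Set.inter_subset_left

/-- The point `x` is the kernel of the evaluation of the localization in its residue field, where
`i` becomes `p₄⁻¹`. The chart condition then says that the Plücker coordinates of the values at `x`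
vanish. -/
theorem mem_Delta_iff {e : Localization.Away (coord p2 * coord p4) ≃ₐ[ℂ]
      Localization.Away (baseCoord .p2 * baseCoord .p4)} (he : IsConeChart Delta e)
    {i : Localization.Away (coord p2 * coord p4)} (hi : algebraMap _ _ (coord p4) * i = 1)
    (h : ∀ k : PairIndex, e.symm (algebraMap _ _ (plucker (MvPolynomial BaseCoord ℂ) k)) =
      mainPlucker i (fun c => algebraMap _ _ (coord c)) k)
    {x : PrimeSpectrum PiRing} (hx : valueAt x p2 * valueAt x p4 ≠ 0) :
    x ∈ Delta ↔ ExplicitEquations (valueAt x) := by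
  let K := x.asIdeal.ResidueField
  let f : PiRing := coord p2 * coord p4
  have hu : IsUnit (algebraMap PiRing K f) := by
    rw [map_mul]
    exact IsUnit.mk0 _ hx
  let ρ : Localization.Away f →+* K := IsLocalization.Away.lift f hu
  have hρ : ∀ a, ρ (algebraMap _ _ a) = algebraMap PiRing K a := fun a =>
    IsLocalization.Away.lift_eq f hu a
  let z : PrimeSpectrum (Localization.Away f) := ⟨RingHom.ker ρ, RingHom.ker_isPrime _⟩
  have hz : comap (algebraMap PiRing (Localization.Away f)) z = x := by
    ext a
    change ρ (algebraMap _ _ a) = 0 ↔ _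
    rw [hρ, Ideal.algebraMap_residueField_eq_zero]
  have hi' : ρ i = (valueAt x p4)⁻¹ := by
    have := congrArg ρ hi
    rw [map_mul, map_one, hρ] at this
    exact eq_inv_of_mul_eq_one_right this
  rw [← mainPlucker_eq_zero_iff (equations_valueAt x) (left_ne_zero_of_mul hx)
    (right_ne_zero_of_mul hx), ← hi', funext_iff]
  conv_lhs => rw [← hz]
  refine (he z).trans (forall_congr' fun k => ?_)
  rw [h]
  change ρ _ = 0 ↔ _
  rw [map_mainPlucker]
  exact Iff.of_eq (congrArg (fun v => mainPlucker (ρ i) v k = 0) (funext fun c => hρ (coord c)))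

end Main
end PiFifteen

theorem mainTheorem10 :
    IsIrreducible (PiFifteen.affineTᶜ : Set (PrimeSpectrum PiFifteen.PiRing)) ∧
    topologicalKrullDim ↥(PiFifteen.affineTᶜ : Set (PrimeSpectrum PiFifteen.PiRing)) = 15 ∧
    IsLocallyClosed PiFifteen.Delta ∧
    topologicalKrullDim ↥PiFifteen.Delta = 8 ∧
    (∀ x : PrimeSpectrum PiFifteen.PiRing,
      PiFifteen.valueAt x .p2 * PiFifteen.valueAt x .p4 ≠ 0 →
        (x ∈ PiFifteen.Delta ↔ PiFifteen.ExplicitEquations (PiFifteen.valueAt x))) ∧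
    PiFifteen.HasConeSingularitiesAlong PiFifteen.PiRing 8 PiFifteen.Delta ∧
    (∃ e : Localization.Away (PiFifteen.coord .p2 * PiFifteen.coord .p4) ≃ₐ[ℂ]
        Localization.Away (PiFifteen.baseCoord .p2 * PiFifteen.baseCoord .p4),
      (∀ b : PiFifteen.BaseCoord,
        e (algebraMap _ _ (PiFifteen.coord b.toCoord)) =
          algebraMap _ _ (PiFifteen.baseCoord b)) ∧
      PiFifteen.IsConeChart PiFifteen.Delta e) := by
  obtain ⟨e, hb, i, hi, hp⟩ := PiFifteen.exists_mainChart
  have he : PiFifteen.IsConeChart PiFifteen.Delta e := PiFifteen.isConeChart_Delta e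
    (PiFifteen.notMem_affineT_of_symmetry PiFifteen.IsSymmetry.refl)
  exact ⟨PiFifteen.isIrreducible_affineT_compl, PiFifteen.topologicalKrullDim_affineT_compl,
    PiFifteen.isLocallyClosed_Delta, PiFifteen.topologicalKrullDim_Delta,
    fun _ => PiFifteen.mem_Delta_iff he hi hp, PiFifteen.hasConeSingularitiesAlong_Delta,
    e, hb, he⟩
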